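/- **Rooted trees and epimorphisms.** A rooted tree is a finite tree with at least two vertices and a distinguished root; its edge relation is taken reflexive and symmetric, and $x\le y$ means that the arc from the root to $y$ contains $x$. An epimorphism $f\colon S\to T$ of rooted trees maps edges to edges, is onto on vertices and on edges, and preserves the root and the order. It is *light* if no two distinct vertices in one fibre are adjacent, and *confluent* if for each connected set $Q\subseteq V(T)$ every component of $f^{-1}(Q)$ is mapped onto $Q$. It is a *splitting edge map* if $S$ arises from $T$, with the same root, by replacing one edge $\langle a,b\rangle$ by $\langle a,x\rangle,\langle x,b\rangle$ with a new vertex $x$, and $f$ is the identity on $T$ and sends $x$ to $a$ or $b$. It is *simple-monotone* if it is a composition of splitting edge maps, and *simple-confluent* if it is a composition of light confluent epimorphisms and simple-monotone epimorphisms. Let $\mathcal T_{\mathcal{CE}}$ be the family of all rooted trees with all simple-confluent epimorphisms. **The projective Fraïssé limit.** Let $K=\varprojlim\{F_n,\alpha_n\}$ be the inverse limit of a sequence in $\mathcal T_{\mathcal{CE}}$: a compact zero-dimensional metrizable space, with a root and with the closed edge relation "$a_n,b_n$ form a (possibly degenerate) edge of $F_n$ for all $n$". A map $h\colon K\to A$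 onto a rooted tree $A$ belongs to the family if $h=h'\circ\alpha_m^\infty$ for some $m$ and some simple-confluent $h'\colon F_m\to A$, where $\alpha_m^\infty\colon K\to F_m$ is the projection. A rooted topological graph (a compact, zero-dimensional, second-countable Hausdorff space with a root and a closed, reflexive, symmetric edge relation) is a *projective Fraïssé limit* of $\mathcal T_{\mathcal{CE}}$ if it is isomorphic to such a $K$ for which (1) every rooted tree $A$ admits a map $K\to A$ in the family; (2) for every $f\colon K\to A$ in the family and every simple-confluent $g\colon B\to A$ there is $h\colon K\to B$ in the family with $f=g\circ h$; (3) for every compatible metric and every $\varepsilon>0$ some map $K\to G$ in the family has all fibres of diameter $<\varepsilon$. **Mohler–Nikiel dendroids.** Let $(d_n)_{n\ge1}$ be a sequence in $[0,1)$ that is dense in $[0,1)$, contains $0$, and in which every number that occurs occurs infinitely often. Put $Y_0=[0,1]$. Let $Y_{n+1}$ be the quotient of $Y_n\times\{0,1\}$ obtained by identifying $(y,0)$ with $(y,1)$ whenever $g^n_0(y)\le d_{n+1}$, let $g_n\colon Y_{n+1}\to Y_n$ send $(y,0)$ and $(y,1)$ to $y$, and let $g_0^n=g_0\circ\dots\circ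 g_{n-1}\colon Y_n\to[0,1]$. The inverse limit $MN_{(d_n)}=\varprojlim\{Y_n,g_n\}$ is the Mohler–Nikiel universal dendroid for $(d_n)$. **Theorem.** The family $\mathcal T_{\mathcal{CE}}$ has a projective Fraïssé limit. For every projective Fraïssé limit $\mathbb T_{\mathcal{CE}}$ of it the edge relation is transitive, hence an equivalence relation, and for every sequence $(d_n)$ as above the topological realization $|\mathbb T_{\mathcal{CE}}|$, i.e. the quotient space of $V(\mathbb T_{\mathcal{CE}})$ by the edge relation, is homeomorphic to $MN_{(d_n)}$. -/

import Mathlib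

/-! ## Finite rooted trees and simple-confluent epimorphisms -/

/-- A finite rooted tree with at least two vertices. The graph is given by its non-degenerate edges;
the reflexive edge relation is `FinRootedTree.E`. -/
structure FinRootedTree : Type 1 where
  V : Type
  finite : Finite V
  nontrivial : Nontrivial V
  graph : SimpleGraph V
  isTree : graph.IsTree
  root : V

namespace FinRootedTree

/-- The reflexive and symmetric edge relation. -/
def E (T : FinRootedTree) (a b : T.V) : Prop := a = b ∨ T.graph.Adj a b

/-- The tree order: `a ≤ b` iff the arc from the root to `b` contains `a`. -/
def le (T : FinRootedTree) (a b : T.V) : Prop :=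
  ∃ p : T.graph.Walk T.root b, p.IsPath ∧ a ∈ p.support

instance (T : FinRootedTree) : Finite T.V := T.finite

instance (T : FinRootedTree) : TopologicalSpace T.V := ⊥

instance (T : FinRootedTree) : DiscreteTopology T.V := ⟨rfl⟩

/-- Epimorphisms of rooted trees: they map edges to edges, are onto on vertices and on edges,
and preserve the root and the order. -/
structure IsEpi {S T : FinRootedTree} (f : S.V → T.V) : Prop where
  map_edge : ∀ a b, S.E a b → T.E (f a) (f b)
  surj : Function.Surjective f
  edge_surj : ∀ a b, T.E a b → ∃ a' b', S.E a' b' ∧ f a' = a ∧ f b' = b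
  map_root : f S.root = T.root
  mono : ∀ a b, S.le a b → T.le (f a) (f b)

/-- For every connected set `Q` of vertices of `T`, every component of the preimage of `Q`
is mapped onto `Q`. -/
def IsConfluent {S T : FinRootedTree} (f : S.V → T.V) : Prop :=
  ∀ Q : Set T.V, (T.graph.induce Q).Connected →
    ∀ C : (S.graph.induce (f ⁻¹' Q)).ConnectedComponent,
      f '' (Subtype.val '' C.supp) = Q

/-- No two distinct vertices in the same fibre are joined by an edge. -/
def IsLight {S T : FinRootedTree} (f : S.V → T.V) : Prop :=
  ∀ a b, f a = f b → ¬ S.graph.Adj a b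

/-- `S` is obtained from the rooted tree `T` (embedded by `ι`) by replacing an edge `⟨a, b⟩` by two
edges `⟨a, x⟩`, `⟨x, b⟩`, where `x` is a new vertex; `f` is the identity on `T` and maps `x` to one
of `a`, `b`. -/
def IsSplittingEdge {S T : FinRootedTree} (f : S.V → T.V) : Prop :=
  IsEpi f ∧ ∃ (ι : T.V → S.V) (x : S.V) (a b : T.V),
    T.graph.Adj a b ∧
    Function.Injective ι ∧ x ∉ Set.range ι ∧ (∀ v, v = x ∨ v ∈ Set.range ι) ∧
    ι T.root = S.root ∧
    (∀ u v, S.graph.Adj (ι u) (ι v) ↔ T.graph.Adj u v ∧ s(u, v) ≠ s(a, b)) ∧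
    (∀ u, S.graph.Adj x (ι u) ↔ u = a ∨ u = b) ∧
    (∀ u, f (ι u) = u) ∧ (f x = a ∨ f x = b)

/-- Compositions of splitting edge maps. -/
inductive IsSimpleMonotone : {S T : FinRootedTree} → (S.V → T.V) → Prop
  | split {S T : FinRootedTree} {f : S.V → T.V} : IsSplittingEdge f → IsSimpleMonotone f
  | comp {R S T : FinRootedTree} {f : S.V → T.V} {g : R.V → S.V} :
      IsSimpleMonotone f → IsSimpleMonotone g → IsSimpleMonotone (f ∘ g)

/-- Compositions of light confluent epimorphisms and simple-monotone epimorphisms. -/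
inductive IsSimpleConfluent : {S T : FinRootedTree} → (S.V → T.V) → Prop
  | light {S T : FinRootedTree} {f : S.V → T.V} :
      IsEpi f → IsLight f → IsConfluent f → IsSimpleConfluent f
  | mono {S T : FinRootedTree} {f : S.V → T.V} : IsSimpleMonotone f → IsSimpleConfluent f
  | comp {R S T : FinRootedTree} {f : S.V → T.V} {g : R.V → S.V} :
      IsSimpleConfluent f → IsSimpleConfluent g → IsSimpleConfluent (f ∘ g)

theorem IsEpi.comp {R S T : FinRootedTree} {f : S.V → T.V} {g : R.V → S.V}
    (hf : IsEpi f) (hg : IsEpi g) : IsEpi (f ∘ g) where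
  map_edge a b h := hf.map_edge _ _ (hg.map_edge _ _ h)
  surj := hf.surj.comp hg.surj
  edge_surj a b h := by
    obtain ⟨a', b', h', rfl, rfl⟩ := hf.edge_surj a b h
    obtain ⟨a'', b'', h'', rfl, rfl⟩ := hg.edge_surj a' b' h'
    exact ⟨a'', b'', h'', rfl, rfl⟩
  map_root := by simp [hg.map_root, hf.map_root]
  mono a b h := hf.mono _ _ (hg.mono _ _ h)

theorem IsSimpleMonotone.isEpi {S T : FinRootedTree} {f : S.V → T.V}
    (hf : IsSimpleMonotone f) : IsEpi f := by
  induction hf with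
  | split h => exact h.1
  | comp _ _ h1 h2 => exact h1.comp h2

theorem IsSimpleConfluent.isEpi {S T : FinRootedTree} {f : S.V → T.V}
    (hf : IsSimpleConfluent f) : IsEpi f := by
  induction hf with
  | light h _ _ => exact h
  | mono h => exact h.isEpi
  | comp _ _ h1 h2 => exact h1.comp h2

end FinRootedTree

/-! ## Topological graphs, inverse limits and projective Fraïssé limits -/

/-- A rooted topological graph: a zero-dimensional, compact, second-countable (Hausdorff) space
with a closed, reflexive and symmetric edge relation and a distinguished vertex. (For compact
Hausdorff spaces, zero-dimensional means totally disconnected.) -/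
structure RootedTopGraph : Type 1 where
  V : Type
  top : TopologicalSpace V
  compact : CompactSpace V
  t2 : T2Space V
  secondCountable : SecondCountableTopology V
  totallyDisconnected : TotallyDisconnectedSpace V
  E : V → V → Prop
  closed : IsClosed {p : V × V | E p.1 p.2}
  refl : ∀ a, E a a
  symm : ∀ a b, E a b → E b a
  root : V

namespace RootedTopGraph

instance (K : RootedTopGraph) : TopologicalSpace K.V := K.top

/-- Isomorphisms of rooted topological graphs. -/
structure Iso (K L : RootedTopGraph) where
  toHomeo : K.V ≃ₜ L.V
  edge_iff : ∀ a b, K.E a b ↔ L.E (toHomeo a) (toHomeo b)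
  map_root : toHomeo K.root = L.root

/-- `K` is a prespace if its edge relation is transitive (hence an equivalence relation). -/
def IsPrespace (K : RootedTopGraph) : Prop := ∀ a b c, K.E a b → K.E b c → K.E a c

/-- The topological realization of a prespace `K`: the quotient space by the edge relation. -/
def Realization (K : RootedTopGraph) : Type := Quot K.E

instance (K : RootedTopGraph) : TopologicalSpace K.Realization :=
  inferInstanceAs (TopologicalSpace (Quot K.E))

end RootedTopGraph

/-- A family consisting of all finite rooted trees (with at least two vertices) together with
a fixed collection of epimorphisms among them. -/
structure TreeFamily where
  Mem : ∀ {S T : FinRootedTree}, (S.V → T.V) → Prop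
  isEpi : ∀ {S T : FinRootedTree} {f : S.V → T.V}, Mem f → FinRootedTree.IsEpi f

/-- The family of rooted trees with simple-confluent epimorphisms. -/
def TCE : TreeFamily where
  Mem := FinRootedTree.IsSimpleConfluent
  isEpi := FinRootedTree.IsSimpleConfluent.isEpi

/-- An inverse sequence with bonding maps in the family `𝓕`. -/
structure InvSeq (𝓕 : TreeFamily) where
  obj : ℕ → FinRootedTree
  map : ∀ n, (obj (n + 1)).V → (obj n).V
  mem : ∀ n, 𝓕.Mem (map n)

namespace InvSeq

variable {𝓕 : TreeFamily}

/-- The vertices of the inverse limit, with the topology of a subspace of the product of the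
discrete spaces of vertices. -/
abbrev LimV (S : InvSeq 𝓕) : Type :=
  {x : ∀ n, (S.obj n).V // ∀ n, S.map n (x (n + 1)) = x n}

theorem isClosed_lim (S : InvSeq 𝓕) :
    IsClosed {x : ∀ n, (S.obj n).V | ∀ n, S.map n (x (n + 1)) = x n} := by
  rw [Set.ofPred_forall]
  exact isClosed_iInter fun n => isClosed_eq
    ((continuous_of_discreteTopology (f := S.map n)).comp (continuous_apply (n + 1)))
    (continuous_apply n)

/-- The inverse limit as a rooted topological graph: two vertices are joined by an edge iff all of
their coordinates are. -/
def lim (S : InvSeq 𝓕) : RootedTopGraph where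
  V := S.LimV
  top := inferInstance
  compact := isCompact_iff_compactSpace.mp S.isClosed_lim.isCompact
  t2 := inferInstance
  secondCountable := by
    have : ∀ n, SecondCountableTopology (S.obj n).V := fun n =>
      have : Countable (S.obj n).V := Finite.to_countable
      inferInstance
    exact TopologicalSpace.Subtype.secondCountableTopology _
  totallyDisconnected := inferInstance
  E x y := ∀ n, (S.obj n).E (x.1 n) (y.1 n)
  closed := by
    rw [Set.ofPred_forall]
    refine isClosed_iInter fun n => ?_
    have hc : Continuous fun p : S.LimV × S.LimV => (p.1.1 n, p.2.1 n) :=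
      ((continuous_apply n).comp (continuous_subtype_val.comp continuous_fst)).prodMk
        ((continuous_apply n).comp (continuous_subtype_val.comp continuous_snd))
    exact (isClosed_discrete
      {q : (S.obj n).V × (S.obj n).V | (S.obj n).E q.1 q.2}).preimage hc
  refl x n := Or.inl rfl
  symm x y h n := (h n).elim (fun e => Or.inl e.symm) (fun e => Or.inr e.symm)
  root := ⟨fun n => (S.obj n).root, fun n => (𝓕.isEpi (S.mem n)).map_root⟩

/-- The canonical projection of the inverse limit to the `n`-th tree. -/
def proj (S : InvSeq 𝓕) (n : ℕ) (x : S.lim.V) : (S.obj n).V := x.1 n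

/-- For `K` represented (through `e`) as the inverse limit of `S`: the epimorphisms from `K` onto
a finite rooted tree `A` that belong to the family extended to inverse limits, namely those
that factor as a projection followed by an epimorphism of the family. -/
def MemLim (S : InvSeq 𝓕) {K : RootedTopGraph} (e : K.Iso S.lim) {A : FinRootedTree}
    (h : K.V → A.V) : Prop :=
  ∃ (m : ℕ) (h' : (S.obj m).V → A.V), 𝓕.Mem h' ∧ ∀ x, h x = h' (S.proj m (e.toHomeo x))

end InvSeq

/-- `K` is a projective Fraïssé limit of the family `𝓕`: it is the inverse limit of a sequence in
`𝓕`, it projects onto all members of `𝓕`, it has the extension property, and (for every compatible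
metric) it has projections with arbitrarily small fibres. -/
def IsProjFraisseLimit (𝓕 : TreeFamily) (K : RootedTopGraph) : Prop :=
  ∃ (S : InvSeq 𝓕) (e : K.Iso S.lim),
    (∀ A : FinRootedTree, ∃ h : K.V → A.V, S.MemLim e h) ∧
    (∀ (A B : FinRootedTree) (f : K.V → A.V) (g : B.V → A.V), S.MemLim e f → 𝓕.Mem g →
      ∃ h : K.V → B.V, S.MemLim e h ∧ f = g ∘ h) ∧
    (∀ m : MetricSpace K.V, m.toUniformSpace.toTopologicalSpace = K.top → ∀ ε : ℝ, 0 < ε →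
      ∃ (G : FinRootedTree) (f : K.V → G.V), S.MemLim e f ∧
        ∀ a : G.V, @Metric.diam K.V m.toPseudoMetricSpace (f ⁻¹' {a}) < ε)

/-! ## Mohler–Nikiel dendroids -/

/-- A stage of the construction: a space `Y` with the map `Y → [0, 1]` that is the composition of
the bonding maps constructed so far. -/
structure MNStage : Type 1 where
  Y : Type
  top : TopologicalSpace Y
  ht : Y → unitInterval

namespace MNStage

instance (Y : MNStage) : TopologicalSpace Y.Y := Y.top

/-- In two disjoint copies of `Y`, identify the two copies of every point of height at most `t`. -/
def glue (Y : MNStage) (t : ℝ) : Setoid (Y.Y × Bool) where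
  r p q := p.1 = q.1 ∧ (p.2 = q.2 ∨ (Y.ht p.1 : ℝ) ≤ t)
  iseqv :=
    { refl := fun _ => ⟨rfl, Or.inl rfl⟩
      symm := fun {p q} h => ⟨h.1.symm, h.2.imp Eq.symm (fun h' => h.1 ▸ h')⟩
      trans := fun {p q r} h k => ⟨h.1.trans k.1, by
        rcases h.2 with h2 | h2
        · rcases k.2 with k2 | k2
          · exact Or.inl (h2.trans k2)
          · exact Or.inr (h.1 ▸ k2)
        · exact Or.inr h2⟩ }

/-- One step of the construction. -/
def double (Y : MNStage) (t : ℝ) : MNStage where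
  Y := Quotient (Y.glue t)
  top := inferInstance
  ht := Quotient.lift (fun p => Y.ht p.1) (fun _ _ h => congrArg Y.ht h.1)

/-- The bonding map, sending both copies of a point `y` to `y`. -/
def bond (Y : MNStage) (t : ℝ) : (Y.double t).Y → Y.Y :=
  Quotient.lift (fun p => p.1) (fun _ _ h => h.1)

end MNStage

/-- The stages for a sequence `d` (the `n`-th step uses the number `d n`, starting with `n = 0`). -/
def mnStage (d : ℕ → ℝ) : ℕ → MNStage
  | 0 => ⟨unitInterval, inferInstance, id⟩
  | n + 1 => (mnStage d n).double (d n)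

/-- The bonding maps of the inverse sequence of stages. -/
def mnBond (d : ℕ → ℝ) (n : ℕ) : (mnStage d (n + 1)).Y → (mnStage d n).Y :=
  (mnStage d n).bond (d n)

/-- The inverse limit of the stages, as a subspace of the product. -/
abbrev MNDendroid (d : ℕ → ℝ) : Type :=
  {y : ∀ n, (mnStage d n).Y // ∀ n, mnBond d n (y (n + 1)) = y n}

/-- `d` is a dense sequence in `[0, 1)` which contains `0` and in which every number that occurs
occurs infinitely often. -/
def IsMNSequence (d : ℕ → ℝ) : Prop :=
  (∀ n, d n ∈ Set.Ico (0 : ℝ) 1) ∧ Set.Ico (0 : ℝ) 1 ⊆ closure (Set.range d) ∧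
    (∃ n, d n = 0) ∧ ∀ n, ∃ m > n, d m = d n

/-! ## Rooted trees in terms of parents -/

namespace FinRootedTree

/-! The dendroid is discretised into finite trees, these trees are shown to have the extension
property for simple-confluent maps, and uniqueness of the Fraïssé limit does the rest.

A point of `MNDendroid d` is a height `t` together with a choice of copy for each index `j` with `d
j < t` (`mnLimPoint_eq_iff`). A `Grid` cuts the interval at finitely many heights, none of them a
ramification height `d j`, and keeps finitely many indices. A vertex of its tree is a piece with
lower endpoint `t` and a choice of copies at the kept indices with `d j < t`. Keeping more indices
gives a light confluent projection (`Grid.isLC_proj`). A further cut splits edges, because each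
piece contains at most one ramification height (`Grid.isMono_proj_insert`).

For the extension property, amalgamation pulls a simple-confluent `g : B → A` back along a
simple-confluent `f : G.tree → A`, so that only maps onto `G.tree` need to be dominated. Light
confluent maps are amalgamated by fibre products. The pullback of a splitting splits all edges that
are mapped onto the split edge (`IsSplitPullback`). A splitting of an edge of `G.tree` is dominated
by one new cut close to the level of that edge (`Grid.exists_lift_split`). A light confluent map is
dominated by keeping many indices of one height in each piece; they exist because `d` is dense and
takes each of its values infinitely often (`Grid.exists_lift_lc`). Projections onto all trees then
follow from the extension property, since every tree maps simple-confluently onto an edge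
(`isSimpleConfluent_toEdge`).

A back-and-forth argument (`InvSeq.IsFraisse.nonempty_iso`) makes every limit isomorphic to the one
built from the grids of any given `d`. That one is compared with the dendroid through the compact
space `CutPoint`, in which every cut is doubled and which maps onto both. Two of its points have
adjacent images in all trees exactly when they have the same image in the dendroid
(`GridSeq.E_limVert_iff`): adjacency on all scales fixes the height and then the branches. So the
edge relation is an equality of images, hence transitive, and compactness turns the induced
bijection into a homeomorphism. As the limit does not depend on `d`, this holds for all `d`. -/

/-- The distance from the root. -/
noncomputable def ht (T : FinRootedTree) (v : T.V) : ℕ := T.graph.dist T.root v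

theorem exists_adj_ht (T : FinRootedTree) {v : T.V} (hv : v ≠ T.root) :
    ∃ u, T.graph.Adj v u ∧ T.ht u + 1 = T.ht v := by
  obtain ⟨p, hp⟩ := T.isTree.connected.exists_walk_length_eq_dist T.root v
  have hn : ¬ p.Nil := SimpleGraph.Walk.not_nil_of_ne hv.symm
  refine ⟨p.penultimate, (p.adj_penultimate hn).symm, ?_⟩
  have h1 : T.ht p.penultimate ≤ p.dropLast.length := SimpleGraph.dist_le _
  have h2 := T.isTree.dist_eq_dist_add_one_of_adj T.root (p.adj_penultimate hn)
  have h3 : p.dropLast.length + 1 = p.length := by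
    rw [SimpleGraph.Walk.length_dropLast_add_one hn]
  unfold ht at *
  omega

/-- The parent of a vertex; the root is its own parent. -/
noncomputable def par (T : FinRootedTree) (v : T.V) : T.V :=
  open Classical in if h : v = T.root then T.root else (T.exists_adj_ht h).choose

@[simp] theorem par_root (T : FinRootedTree) : T.par T.root = T.root := by simp [par]

theorem adj_par (T : FinRootedTree) {v : T.V} (hv : v ≠ T.root) : T.graph.Adj v (T.par v) := by
  rw [par, dif_neg hv]; exact (T.exists_adj_ht hv).choose_spec.1

theorem ht_par (T : FinRootedTree) {v : T.V} (hv : v ≠ T.root) : T.ht (T.par v) + 1 = T.ht v := by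
  rw [par, dif_neg hv]; exact (T.exists_adj_ht hv).choose_spec.2

@[simp] theorem ht_root (T : FinRootedTree) : T.ht T.root = 0 := by simp [ht]

theorem par_ne (T : FinRootedTree) {v : T.V} (hv : v ≠ T.root) : T.par v ≠ v :=
  (T.adj_par hv).ne'

theorem exists_path_concat (T : FinRootedTree) {u v : T.V} (h : T.graph.Adj u v)
    (hh : T.ht u + 1 = T.ht v) :
    ∃ p : T.graph.Walk T.root u, p.IsPath ∧ (p.concat h).IsPath := by
  obtain ⟨p, hp⟩ := T.isTree.connected.exists_walk_length_eq_dist T.root u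
  refine ⟨p, p.isPath_of_length_eq_dist hp, SimpleGraph.Walk.isPath_of_length_eq_dist _ ?_⟩
  rw [SimpleGraph.Walk.length_concat, hp]; exact hh

theorem path_unique (T : FinRootedTree) {u v : T.V} {p q : T.graph.Walk u v} (hp : p.IsPath)
    (hq : q.IsPath) : p = q :=
  congrArg Subtype.val (T.isTree.isAcyclic.subsingleton_path u v |>.elim ⟨p, hp⟩ ⟨q, hq⟩)

theorem eq_par (T : FinRootedTree) {u v : T.V} (h : T.graph.Adj u v) (hh : T.ht u + 1 = T.ht v) :
    u = T.par v := by
  have hv : v ≠ T.root := by rintro rfl; simp at hh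
  obtain ⟨p, -, hp⟩ := T.exists_path_concat h hh
  obtain ⟨q, -, hq⟩ := T.exists_path_concat (T.adj_par hv).symm (T.ht_par hv)
  have := congrArg SimpleGraph.Walk.penultimate (T.path_unique hp hq)
  simpa using this

theorem adj_iff (T : FinRootedTree) {u v : T.V} :
    T.graph.Adj u v ↔ (v ≠ T.root ∧ T.par v = u) ∨ (u ≠ T.root ∧ T.par u = v) := by
  constructor
  · intro h
    rcases T.isTree.dist_eq_dist_add_one_of_adj T.root h with h1 | h1
    · exact Or.inr ⟨by rintro rfl; simp at h1, (T.eq_par h.symm h1.symm).symm⟩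
    · exact Or.inl ⟨by rintro rfl; simp at h1, (T.eq_par h h1.symm).symm⟩
  · rintro (⟨h, rfl⟩ | ⟨h, rfl⟩)
    · exact (T.adj_par h).symm
    · exact T.adj_par h

theorem E_iff (T : FinRootedTree) {u v : T.V} :
    T.E u v ↔ u = v ∨ T.par v = u ∨ T.par u = v := by
  rw [E, adj_iff]
  by_cases hu : u = T.root <;> by_cases hv : v = T.root <;> simp_all [eq_comm]

theorem par_induction (T : FinRootedTree) {P : T.V → Prop} (h0 : P T.root)
    (h1 : ∀ v, v ≠ T.root → P (T.par v) → P v) (v : T.V) : P v := by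
  induction hn : T.ht v generalizing v with
  | zero =>
    by_cases hv : v = T.root
    · exact hv ▸ h0
    · have := T.ht_par hv; omega
  | succ n ih =>
    by_cases hv : v = T.root
    · exact hv ▸ h0
    · have := T.ht_par hv; exact h1 v hv (ih _ (by omega))

theorem le_root_iff (T : FinRootedTree) {a : T.V} : T.le a T.root ↔ a = T.root := by
  constructor
  · rintro ⟨p, hp, ha⟩
    rw [T.path_unique hp SimpleGraph.Walk.IsPath.nil] at ha
    simpa using ha
  · rintro rfl
    exact ⟨_, SimpleGraph.Walk.IsPath.nil, by simp⟩

theorem le_iff (T : FinRootedTree) {a v : T.V} (hv : v ≠ T.root) :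
    T.le a v ↔ a = v ∨ T.le a (T.par v) := by
  obtain ⟨p, hp, hp'⟩ := T.exists_path_concat (T.adj_par hv).symm (T.ht_par hv)
  constructor
  · rintro ⟨q, hq, ha⟩
    rw [T.path_unique hq hp', SimpleGraph.Walk.support_concat] at ha
    rcases (by simpa using ha : a ∈ p.support ∨ a = v) with h | h
    · exact Or.inr ⟨p, hp, h⟩
    · exact Or.inl (by simpa using h)
  · rintro (rfl | ⟨q, hq, ha⟩)
    · exact ⟨_, hp', by simp⟩
    · rw [T.path_unique hq hp] at ha
      exact ⟨_, hp', by simp [SimpleGraph.Walk.support_concat, ha]⟩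

theorem le_refl (T : FinRootedTree) (a : T.V) : T.le a a := by
  by_cases h : a = T.root
  · rw [h, le_root_iff]
  · exact (T.le_iff h).2 (Or.inl rfl)

theorem le_of_le_par (T : FinRootedTree) {a v : T.V} (h : T.le a (T.par v)) : T.le a v := by
  by_cases hv : v = T.root
  · simpa [hv] using h
  · exact (T.le_iff hv).2 (Or.inr h)

theorem ht_le_of_le (T : FinRootedTree) {a v : T.V} (h : T.le a v) : T.ht a ≤ T.ht v := by
  induction v using T.par_induction with
  | h0 => rw [le_root_iff] at h; rw [h]
  | h1 v hv ih =>
    rcases (T.le_iff hv).1 h with rfl | h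
    · exact _root_.le_refl _
    · have := ih h; have := T.ht_par hv; omega

/-- A decreasing choice of neighbours is the parent function. -/
theorem par_eq_of (T : FinRootedTree) (p : T.V → T.V) (rk : T.V → ℕ)
    (hadj : ∀ v, v ≠ T.root → T.graph.Adj v (p v)) (hrk : ∀ v, v ≠ T.root → rk (p v) < rk v)
    {v : T.V} (hv : v ≠ T.root) : T.par v = p v := by
  induction hn : rk v using Nat.strong_induction_on generalizing v with
  | _ n ih =>
    -- If `p v` were a child of `v`, induction would give `p (p v) = v`, although the rank drops at
    -- both steps.
    rcases T.adj_iff.1 (hadj v hv) with ⟨h1, h2⟩ | ⟨-, h2⟩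
    · have h3 := ih _ (hn ▸ hrk v hv) h1 rfl
      have h4 := hrk v hv
      have h5 := hrk _ h1
      rw [← h3, h2] at h5
      omega
    · exact h2

/-- The tree given by a decreasing parent function. -/
noncomputable def ofPar (V : Type) [Finite V] [Nontrivial V] (root : V) (p : V → V) (rk : V → ℕ)
    (hrk : ∀ v, v ≠ root → rk (p v) < rk v) : FinRootedTree where
  V := V
  finite := inferInstance
  nontrivial := inferInstance
  graph := SimpleGraph.fromRel fun u v => v ≠ root ∧ p v = u
  root := root
  isTree := by
    set G : SimpleGraph V := SimpleGraph.fromRel fun u v => v ≠ root ∧ p v = u with hG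
    have hne : ∀ v, v ≠ root → v ≠ p v := fun v hv h => by have := hrk v hv; rw [← h] at this; omega
    have hadj : ∀ v, v ≠ root → G.Adj v (p v) := fun v hv => by
      rw [hG, SimpleGraph.fromRel_adj]; exact ⟨hne v hv, Or.inr ⟨hv, rfl⟩⟩
    have hreach : ∀ v, G.Reachable v root := by
      intro v
      induction hn : rk v using Nat.strong_induction_on generalizing v with
      | _ n ih =>
        by_cases hv : v = root
        · rw [hv]
        · exact (hadj v hv).reachable.trans (ih _ (hn ▸ hrk v hv) _ rfl)
    have hconn : G.Connected := by
      have : Nonempty V := ⟨root⟩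
      exact ⟨fun u v => (hreach u).trans (hreach v).symm⟩
    rw [SimpleGraph.isTree_iff_connected_and_card]
    refine ⟨hconn, le_antisymm ?_ hconn.card_vert_le_card_edgeSet_add_one⟩
    -- Every edge joins some non-root vertex `v` to `p v`, so there are at most `|V| - 1` edges; a
    -- connected graph with so few edges is a tree.
    have hsurj : Function.Surjective
        (fun v : {v : V // v ≠ root} => (⟨s(v.1, p v.1), hadj v.1 v.2⟩ : G.edgeSet)) := by
      rintro ⟨e, he⟩
      induction e using Sym2.ind with
      | _ a b =>
        have he' := he
        rw [SimpleGraph.mem_edgeSet, hG, SimpleGraph.fromRel_adj] at he'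
        rcases he'.2 with ⟨h1, h2⟩ | ⟨h1, h2⟩
        · exact ⟨⟨b, h1⟩, Subtype.ext (by simp [h2, Sym2.eq_swap])⟩
        · exact ⟨⟨a, h1⟩, Subtype.ext (by simp [h2])⟩
    have h1 : Nat.card G.edgeSet ≤ _ := Nat.card_le_card_of_surjective _ hsurj
    have h2 : Nat.card {v : V // v ≠ root} + 1 = Nat.card V := by
      classical
      have := Fintype.ofFinite V
      have : Nonempty V := ⟨root⟩
      rw [Nat.card_eq_fintype_card, Nat.card_eq_fintype_card, Fintype.card_subtype_compl]
      simp only [Fintype.card_unique]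
      have := Fintype.card_pos (α := V)
      omega
    exact (Nat.succ_le_succ h1).trans h2.le

theorem ofPar_par (V : Type) [Finite V] [Nontrivial V] (root : V) (p : V → V) (rk : V → ℕ)
    (hrk : ∀ v, v ≠ root → rk (p v) < rk v) {v : V} (hv : v ≠ root) :
    (ofPar V root p rk hrk).par v = p v := by
  refine (ofPar V root p rk hrk).par_eq_of p rk (fun v hv => ?_) hrk hv
  refine (SimpleGraph.fromRel_adj _ _ _).2 ⟨fun h => ?_, Or.inr ⟨hv, rfl⟩⟩
  have := hrk v hv
  rw [← h] at this
  omega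

/-- Epimorphisms in terms of parents. -/
theorem isEpi_iff {S T : FinRootedTree} {f : S.V → T.V} :
    IsEpi f ↔ f S.root = T.root ∧
      (∀ v, v ≠ S.root → f v = f (S.par v) ∨ (f v ≠ T.root ∧ T.par (f v) = f (S.par v))) ∧
      Function.Surjective f := by
  constructor
  · intro h
    refine ⟨h.map_root, fun v hv => ?_, h.surj⟩
    have h1 := h.map_edge _ _ (Or.inr (S.adj_par hv))
    -- Order preservation rules out that `f (S.par v)` is a child of `f v`.
    have h2 := T.ht_le_of_le
      (h.mono (S.par v) v (S.le_of_le_par (S.le_refl _)))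
    rcases h1 with h1 | h1
    · exact Or.inl h1
    · rcases T.adj_iff.1 h1 with ⟨h3, h4⟩ | h3
      · have := T.ht_par h3; rw [h4] at this; omega
      · exact Or.inr h3
  · rintro ⟨h0, h1, h2⟩
    refine ⟨fun a b hab => ?_, h2, fun a b hab => ?_, h0, fun a b hab => ?_⟩
    · have key : ∀ v, v ≠ S.root → T.E (f v) (f (S.par v)) := fun v hv => by
        rcases h1 v hv with h | ⟨h3, h4⟩
        · exact Or.inl h
        · exact Or.inr (h4 ▸ T.adj_par h3)
      rcases hab with rfl | hab
      · exact Or.inl rfl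
      · rcases S.adj_iff.1 hab with ⟨h, rfl⟩ | ⟨h, rfl⟩
        · exact (key b h).imp Eq.symm SimpleGraph.Adj.symm
        · exact key a h
    · rcases hab with rfl | hab
      · obtain ⟨v, rfl⟩ := h2 a
        exact ⟨v, v, Or.inl rfl, rfl, rfl⟩
      -- Descend from a preimage of `b` towards the root until the fibre is left; the last step
      -- covers the edge below `b`.
      · have key : ∀ b, b ≠ T.root → ∃ v, v ≠ S.root ∧ f v = b ∧ f (S.par v) = T.par b := by
          intro b hb
          obtain ⟨v, rfl⟩ := h2 b
          induction v using S.par_induction with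
          | h0 => exact absurd h0 hb
          | h1 v hv ih =>
            rcases h1 v hv with h | ⟨-, h⟩
            · obtain ⟨w, hw⟩ := ih (h ▸ hb)
              exact ⟨w, hw.1, h ▸ hw.2.1, h ▸ hw.2.2⟩
            · exact ⟨v, hv, rfl, h.symm⟩
        rcases T.adj_iff.1 hab with ⟨h, rfl⟩ | ⟨h, rfl⟩
        · obtain ⟨v, hv, h3, h4⟩ := key b h
          exact ⟨_, v, Or.inr (S.adj_par hv).symm, h4, h3⟩
        · obtain ⟨v, hv, h3, h4⟩ := key a h
          exact ⟨v, _, Or.inr (S.adj_par hv), h3, h4⟩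
    · induction b using S.par_induction with
      | h0 => rw [le_root_iff] at hab; rw [hab]; exact T.le_refl _
      | h1 b hb ih =>
        rcases (S.le_iff hb).1 hab with rfl | hab
        · exact T.le_refl _
        · have := ih hab
          rcases h1 b hb with h | ⟨-, h⟩
          · rwa [h]
          · exact T.le_of_le_par (h ▸ this)

/-- Light confluent epimorphisms in terms of parents: they preserve parents and lift children. -/
structure IsLC {S T : FinRootedTree} (f : S.V → T.V) : Prop where
  map_root : f S.root = T.root
  ne_root : ∀ v, v ≠ S.root → f v ≠ T.root
  map_par : ∀ v, v ≠ S.root → T.par (f v) = f (S.par v)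
  lift : ∀ v b, b ≠ T.root → T.par b = f v → ∃ w, w ≠ S.root ∧ S.par w = v ∧ f w = b

namespace IsLC

variable {R S T : FinRootedTree} {f : S.V → T.V} {g : R.V → S.V}

theorem surjective (h : IsLC f) : Function.Surjective f := by
  intro b
  induction b using T.par_induction with
  | h0 => exact ⟨_, h.map_root⟩
  | h1 b hb ih =>
    obtain ⟨v, hv⟩ := ih
    obtain ⟨w, -, -, hw⟩ := h.lift v b hb hv.symm
    exact ⟨w, hw⟩

theorem isEpi (h : IsLC f) : IsEpi f :=
  isEpi_iff.2 ⟨h.map_root, fun v hv => Or.inr ⟨h.ne_root v hv, h.map_par v hv⟩, h.surjective⟩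

theorem isLight (h : IsLC f) : IsLight f := by
  have key : ∀ v, v ≠ S.root → f v ≠ f (S.par v) := fun v hv => by
    rw [← h.map_par v hv]; exact (T.par_ne (h.ne_root v hv)).symm
  intro a b hab hadj
  rcases S.adj_iff.1 hadj with ⟨hb, rfl⟩ | ⟨ha, rfl⟩
  · exact key b hb hab.symm
  · exact key a ha hab

/-- An edge of `Q` lifts at any vertex over either of its ends: upwards by `lift`, downwards by
`map_par`. Hence the image of a component is closed under adjacency in `Q`, and `Q` is connected. -/
theorem isConfluent (h : IsLC f) : IsConfluent f := by
  intro Q hQ C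
  have hsub : ∀ q ∈ f '' (Subtype.val '' C.supp), q ∈ Q := by
    rintro _ ⟨_, ⟨⟨v, hv⟩, -, rfl⟩, rfl⟩; exact hv
  refine Set.Subset.antisymm hsub ?_
  have hstep : ∀ q q' : Q, (T.graph.induce Q).Adj q q' →
      q.1 ∈ f '' (Subtype.val '' C.supp) → q'.1 ∈ f '' (Subtype.val '' C.supp) := by
    rintro ⟨q, hq⟩ ⟨q', hq'⟩ hadj ⟨_, ⟨⟨v, hv⟩, hvC, rfl⟩, hfv⟩
    simp only at hfv ⊢
    have hadj' : T.graph.Adj q q' := hadj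
    have mem : ∀ w, (hw : f w ∈ Q) → S.graph.Adj v w →
        f w ∈ f '' (Subtype.val '' C.supp) := by
      intro w hw hvw
      refine ⟨w, ⟨⟨w, hw⟩, ?_, rfl⟩, rfl⟩
      rw [SimpleGraph.ConnectedComponent.mem_supp_iff] at hvC ⊢
      rw [← hvC]
      exact SimpleGraph.ConnectedComponent.sound
        (SimpleGraph.Adj.reachable (G := S.graph.induce (f ⁻¹' Q))
          (u := ⟨w, hw⟩) (v := ⟨v, hv⟩) hvw.symm)
    rcases T.adj_iff.1 hadj' with ⟨h1, h2⟩ | ⟨h1, h2⟩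
    · obtain ⟨w, hw, h3, rfl⟩ := h.lift v q' h1 (by rw [h2, hfv])
      exact mem w hq' (h3 ▸ (S.adj_par hw).symm)
    · have hv0 : v ≠ S.root := by rintro rfl; exact h1 (hfv ▸ h.map_root)
      have h3 := h.map_par v hv0
      rw [hfv, h2] at h3
      rw [h3] at hq' ⊢
      exact mem _ hq' (S.adj_par hv0)
  obtain ⟨⟨v, hv⟩, hvC⟩ := C.nonempty_supp
  intro q hq
  obtain ⟨p⟩ := hQ.preconnected ⟨f v, hv⟩ ⟨q, hq⟩
  have : ∀ (a b : Q), (T.graph.induce Q).Walk a b → a.1 ∈ f '' (Subtype.val '' C.supp) →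
      b.1 ∈ f '' (Subtype.val '' C.supp) := by
    intro a b p
    induction p with
    | nil => exact id
    | cons hadj p ih => exact fun hu => ih (hstep _ _ hadj hu)
  exact this _ _ p ⟨v, ⟨⟨v, hv⟩, hvC, rfl⟩, rfl⟩

/-- Lightness excludes that an edge is collapsed, so parents go to parents. To lift a child `b` of
`f v`, apply confluence to the connected set `{f v, b}`: the component of `v` must reach `b`, and by
lightness its first step from `v` already does. -/
theorem of_light (h1 : IsEpi f) (h2 : IsLight f) (h3 : IsConfluent f) : IsLC f := by
  obtain ⟨h0, h4, -⟩ := isEpi_iff.1 h1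
  have key : ∀ v, v ≠ S.root → (f v ≠ T.root ∧ T.par (f v) = f (S.par v)) := fun v hv =>
    (h4 v hv).resolve_left fun h => h2 _ _ h (S.adj_par hv)
  refine ⟨h0, fun v hv => (key v hv).1, fun v hv => (key v hv).2, fun v b hb hbv => ?_⟩
  have hQ : (T.graph.induce {f v, b}).Connected :=
    T.graph.induce_pair_connected_of_adj (hbv ▸ (T.adj_par hb).symm)
  have hvQ : v ∈ f ⁻¹' {f v, b} := Set.mem_insert _ _
  have hC := h3 {f v, b} hQ
    ((S.graph.induce (f ⁻¹' {f v, b})).connectedComponentMk ⟨v, hvQ⟩)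
  have hbm : b ∈ ({f v, b} : Set T.V) := by simp
  rw [← hC] at hbm
  obtain ⟨_, ⟨⟨w, hw⟩, hwC, rfl⟩, hwb⟩ := hbm
  simp only at hwb
  rw [SimpleGraph.ConnectedComponent.mem_supp_iff, SimpleGraph.ConnectedComponent.eq] at hwC
  obtain ⟨p⟩ := hwC.symm
  have hne : b ≠ f v := fun h => T.par_ne hb (hbv.trans h.symm)
  have hn : ¬ p.Nil := SimpleGraph.Walk.not_nil_of_ne fun h => hne (by
    rw [← hwb]; exact congrArg f (congrArg Subtype.val h).symm)
  obtain ⟨u, hu⟩ : ∃ u, u = p.snd := ⟨_, rfl⟩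
  have hadj : S.graph.Adj v u.1 := hu ▸ p.adj_snd hn
  have hub : f u.1 = b := by
    rcases u.2 with h | h
    · exact absurd hadj (h2 _ _ h.symm)
    · exact h
  rcases S.adj_iff.1 hadj with ⟨h5, h6⟩ | ⟨h5, h6⟩
  · exact ⟨u.1, h5, h6, hub⟩
  · obtain ⟨h7, h8⟩ := key v h5
    rw [h6, hub] at h8
    have h9 := T.ht_par h7
    have h10 := T.ht_par hb
    rw [hbv] at h10
    rw [h8] at h9
    omega

theorem id (T : FinRootedTree) : IsLC (id : T.V → T.V) :=
  ⟨rfl, fun _ h => h, fun _ _ => rfl, fun _ b hb h => ⟨b, hb, h, rfl⟩⟩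

theorem isSimpleConfluent (h : IsLC f) : IsSimpleConfluent f :=
  .light h.isEpi h.isLight h.isConfluent

theorem of_bijective (hf : IsLC f) {e : T.V → S.V} (h1 : ∀ v, e (f v) = v)
    (h2 : ∀ v, f (e v) = v) : IsLC e where
  map_root := by rw [← hf.map_root, h1]
  ne_root v hv h := hv (by rw [← h2 v, h, hf.map_root])
  map_par v hv := by
    have : e v ≠ S.root := fun h => hv (by rw [← h2 v, h, hf.map_root])
    rw [← h1 (S.par (e v)), ← hf.map_par _ this, h2]
  lift v b hb h := by
    have := hf.ne_root b hb
    exact ⟨f b, this, by rw [hf.map_par b hb, h, h2], h1 b⟩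

end IsLC

end FinRootedTree

/-! ## Splitting edges -/

namespace FinRootedTree

/-- `f : S → T` splits the edge below `b` by the new vertex `x`, and `ι` embeds `T` into `S`. -/
structure SplitData {S T : FinRootedTree} (f : S.V → T.V) (ι : T.V → S.V) (x : S.V) (b : T.V) :
    Prop where
  ne_root : b ≠ T.root
  inv : ∀ u, f (ι u) = u
  ne_new : ∀ u, ι u ≠ x
  eq_of_ne : ∀ v, v ≠ x → ι (f v) = v
  root : ι T.root = S.root
  par_top : S.par (ι b) = x
  par_new : S.par x = ι (T.par b)
  par_old : ∀ u, u ≠ T.root → u ≠ b → S.par (ι u) = ι (T.par u)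
  map_new : f x = b ∨ f x = T.par b

namespace SplitData

variable {S T : FinRootedTree} {f : S.V → T.V} {ι : T.V → S.V} {x : S.V} {b : T.V}

theorem new_ne_root (h : SplitData f ι x b) : x ≠ S.root := fun hx =>
  h.ne_new T.root (h.root.trans hx.symm)

theorem injective (h : SplitData f ι x b) : Function.Injective ι :=
  Function.LeftInverse.injective h.inv

theorem ι_ne_root (h : SplitData f ι x b) {u : T.V} (hu : u ≠ T.root) : ι u ≠ S.root := fun hx =>
  hu (h.injective (hx.trans h.root.symm))

theorem map_root (h : SplitData f ι x b) : f S.root = T.root := by rw [← h.root, h.inv]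

theorem par_ι_eq_ι_iff (h : SplitData f ι x b) {u v : T.V} (hv : v ≠ T.root) :
    S.par (ι v) = ι u ↔ T.par v = u ∧ v ≠ b := by
  by_cases hvb : v = b
  · subst hvb
    simp only [h.par_top, ne_eq, not_true_eq_false, and_false, iff_false]
    exact (h.ne_new u).symm
  · rw [h.par_old v hv hvb, h.injective.eq_iff]; simp [hvb]

theorem isEpi (h : SplitData f ι x b) : IsEpi f := by
  refine isEpi_iff.2 ⟨h.map_root, fun v hv => ?_, fun u => ⟨ι u, h.inv u⟩⟩
  by_cases hvx : v = x
  · subst hvx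
    rw [h.par_new, h.inv]
    rcases h.map_new with h' | h'
    · exact Or.inr (by rw [h']; exact ⟨h.ne_root, rfl⟩)
    · exact Or.inl h'
  · obtain ⟨u, rfl⟩ : ∃ u, ι u = v := ⟨_, h.eq_of_ne v hvx⟩
    have hu : u ≠ T.root := fun hu => hv (hu ▸ h.root)
    rw [h.inv]
    by_cases hub : u = b
    · subst hub
      rw [h.par_top]
      exact h.map_new.imp Eq.symm fun h' => ⟨hu, h'.symm⟩
    · rw [h.par_old u hu hub, h.inv]; exact Or.inr ⟨hu, rfl⟩

theorem not_par_swap {u v : T.V} (hv : v ≠ T.root) (h : T.par v = u) (hu : u ≠ T.root) :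
    T.par u ≠ v := by
  subst h
  intro h
  have h1 := T.ht_par hv
  have h2 := T.ht_par hu
  rw [h] at h2
  omega

theorem isSplittingEdge (h : SplitData f ι x b) : IsSplittingEdge f := by
  refine ⟨h.isEpi, ι, x, T.par b, b, (T.adj_par h.ne_root).symm, h.injective, ?_, ?_, h.root, ?_, ?_,
    h.inv, h.map_new.symm⟩
  · rintro ⟨u, hu⟩; exact h.ne_new u hu
  · intro v
    by_cases hv : v = x
    · exact Or.inl hv
    · exact Or.inr ⟨_, h.eq_of_ne v hv⟩
  · have key : ∀ u v, (ι v ≠ S.root ∧ S.par (ι v) = ι u) ↔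
        (v ≠ T.root ∧ T.par v = u) ∧ s(u, v) ≠ s(T.par b, b) := by
      intro u v
      by_cases hv : v = T.root
      · simp [hv, h.root]
      · rw [h.par_ι_eq_ι_iff hv]
        simp only [hv, h.ι_ne_root hv, ne_eq, not_false_eq_true, true_and]
        refine and_congr_right fun h1 => not_congr ?_
        constructor
        · rintro rfl; rw [h1]
        · intro h2
          rcases Sym2.eq_iff.1 h2 with h2 | ⟨h2, h3⟩
          · exact h2.2
          · exact absurd h3.symm (not_par_swap hv (h1.trans h2) h.ne_root)
    intro u v
    rw [S.adj_iff, T.adj_iff, key, key, Sym2.eq_swap (a := v) (b := u), or_and_right]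
  · intro u
    rw [S.adj_iff]
    constructor
    · rintro (⟨h1, h2⟩ | ⟨h1, h2⟩)
      · have hu : u ≠ T.root := fun hu => h1 (hu ▸ h.root)
        refine Or.inr ?_
        by_contra hub
        rw [h.par_old u hu hub] at h2
        exact h.ne_new _ h2
      · rw [h.par_new] at h2
        exact Or.inl (h.injective h2).symm
    · rintro (rfl | rfl)
      · exact Or.inr ⟨h.new_ne_root, h.par_new⟩
      · exact Or.inl ⟨h.ι_ne_root h.ne_root, h.par_top⟩

/-- An isomorphism after a splitting is absorbed into the embedding `ι`, so a splitting edge map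
need not be a literal retraction onto a subset of the vertices. -/
theorem comp_iso {U : FinRootedTree} {e : T.V → U.V} (h : SplitData f ι x b) (he : IsLC e)
    {e' : U.V → T.V} (h1 : ∀ v, e' (e v) = v) (h2 : ∀ v, e (e' v) = v) :
    SplitData (e ∘ f) (ι ∘ e') x (e b) := by
  have he' := he.of_bijective h1 h2
  refine ⟨he.ne_root _ h.ne_root, fun u => by simp [h.inv, h2], fun u => h.ne_new _,
    fun v hv => by simp [h1, h.eq_of_ne v hv], by simp [he'.map_root, h.root],
    by simp [h1, h.par_top], ?_, fun u hu hub => ?_, ?_⟩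
  · simp [he.map_par _ h.ne_root, h1, h.par_new]
  · simp only [Function.comp_apply]
    rw [h.par_old _ (he'.ne_root u hu) (fun h3 => hub (by rw [← h3, h2])), he'.map_par u hu]
  · rw [he.map_par _ h.ne_root]
    exact h.map_new.imp (congrArg e) (congrArg e)

end SplitData

/-- The definition does not say which end of the split edge is nearer to the root. Once the edge is
oriented, the expected parent function of `S` is a rank-decreasing choice of neighbours, and
`par_eq_of` identifies it with `S.par`. -/
theorem IsSplittingEdge.exists_splitData {S T : FinRootedTree} {f : S.V → T.V}
    (h : IsSplittingEdge f) : ∃ ι x b, SplitData f ι x b := by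
  obtain ⟨-, ι, x, a, b, hab, hinj, hx, hcov, hroot, hold, hnew, hinv, hfx⟩ := h
  wlog hb : b ≠ T.root ∧ T.par b = a generalizing a b
  · refine this b a hab.symm ?_ ?_ hfx.symm ?_
    · intro u v; rw [hold u v, Sym2.eq_swap (a := b) (b := a)]
    · intro u; rw [hnew u, or_comm]
    · exact (T.adj_iff.1 hab).resolve_left hb
  obtain ⟨hb, rfl⟩ := hb
  have hne : ∀ u, ι u ≠ x := fun u hu => hx ⟨u, hu⟩
  have hcov' : ∀ v, v ≠ x → ι (f v) = v := fun v hv => by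
    obtain ⟨u, rfl⟩ := (hcov v).resolve_left hv
    rw [hinv]
  have hpar : ∀ v, v ≠ S.root → S.par v = open Classical in if v = x then ι (T.par b)
      else if v = ι b then x else ι (T.par (f v)) := by
    classical
    intro v hv
    refine S.par_eq_of (fun v => if v = x then ι (T.par b)
      else if v = ι b then x else ι (T.par (f v)))
      -- Doubling the heights leaves an odd rank for `x`, strictly between the ranks of `T.par b`
      -- and `b`.
      (fun v => if v = x then 2 * T.ht b - 1 else 2 * T.ht (f v)) (fun v hv => ?_)
      (fun v hv => ?_) hv
    · split_ifs with h1 h2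
      · rw [h1, hnew]; exact Or.inl rfl
      · rw [h2, SimpleGraph.adj_comm, hnew]; exact Or.inr rfl
      · obtain ⟨u, rfl⟩ := (hcov v).resolve_left h1
        have hu : u ≠ T.root := fun hu => hv (hu ▸ hroot)
        rw [hinv, hold]
        refine ⟨T.adj_par hu, fun h3 => ?_⟩
        rcases Sym2.eq_iff.1 h3 with ⟨h3, h4⟩ | ⟨h3, h4⟩
        · exact SplitData.not_par_swap hb h3.symm hu h4
        · exact h2 (by rw [h3])
    · have h5 := T.ht_par hb
      by_cases h1 : v = x
      · simp only [h1, if_true, hne, if_false, hinv]; omega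
      · obtain ⟨u, rfl⟩ := (hcov v).resolve_left h1
        have hu : u ≠ T.root := fun hu => hv (hu ▸ hroot)
        have h6 := T.ht_par hu
        by_cases h2 : u = b
        · subst h2; simp only [hne, if_false, if_true, hinv]; omega
        · simp only [hne, if_false, hinj.eq_iff, h2, hinv]; omega
  have hιr : ∀ u, u ≠ T.root → ι u ≠ S.root := fun u hu h => hu (hinj (h.trans hroot.symm))
  have hxr : x ≠ S.root := fun h => hne _ (hroot.trans h.symm)
  refine ⟨ι, x, b, hb, hinv, hne, hcov', hroot, ?_, ?_, fun u hu hub => ?_, hfx.symm⟩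
  · rw [hpar _ (hιr b hb), if_neg (hne b), if_pos rfl]
  · rw [hpar _ hxr, if_pos rfl]
  · rw [hpar _ (hιr u hu), if_neg (hne u), if_neg (fun h => hub (hinj h)), hinv]

/-- Compositions of splitting edge maps and isomorphisms. -/
inductive IsMono : {S T : FinRootedTree} → (S.V → T.V) → Prop
  | split {S T : FinRootedTree} {f : S.V → T.V} : IsSplittingEdge f → IsMono f
  | iso {S T : FinRootedTree} {f : S.V → T.V} : IsLC f → Function.Injective f → IsMono f
  | comp {R S T : FinRootedTree} {f : S.V → T.V} {g : R.V → S.V} :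
      IsMono f → IsMono g → IsMono (f ∘ g)

/-- A splitting adds a vertex, so isomorphisms are never compositions of splittings; they are light
confluent, though, so admitting them in `IsMono` does not leave the family. -/
theorem IsMono.isSimpleConfluent {S T : FinRootedTree} {f : S.V → T.V} (h : IsMono f) :
    IsSimpleConfluent f := by
  induction h with
  | split h => exact .mono (.split h)
  | iso h _ => exact h.isSimpleConfluent
  | comp _ _ h1 h2 => exact .comp h1 h2

theorem IsSimpleMonotone.isMono {S T : FinRootedTree} {f : S.V → T.V} (h : IsSimpleMonotone f) :
    IsMono f := by
  induction h with
  | split h => exact .split h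
  | comp _ _ h1 h2 => exact .comp h1 h2

theorem IsLC.exists_inverse {S T : FinRootedTree} {f : S.V → T.V} (h : IsLC f)
    (hi : Function.Injective f) : ∃ e : T.V → S.V, (∀ v, e (f v) = v) ∧ (∀ v, f (e v) = v) :=
  Function.bijective_iff_has_inverse.1 ⟨hi, h.surjective⟩

/-- An induction principle with combinatorial generators. -/
theorem IsSimpleConfluent.induction_on' {P : ∀ S T : FinRootedTree, (S.V → T.V) → Prop}
    {S T : FinRootedTree} {f : S.V → T.V} (h : IsSimpleConfluent f)
    (lc : ∀ {S T : FinRootedTree} {f : S.V → T.V}, IsLC f → P S T f)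
    (mono : ∀ {S T : FinRootedTree} {f : S.V → T.V}, IsMono f → P S T f)
    (comp : ∀ {R S T : FinRootedTree} {f : S.V → T.V} {g : R.V → S.V},
      P S T f → P R S g → P R T (f ∘ g)) : P S T f := by
  induction h with
  | light h1 h2 h3 => exact lc (.of_light h1 h2 h3)
  | mono h => exact mono h.isMono
  | comp _ _ h1 h2 => exact comp h1 h2

/-! ## Removing vertices -/

theorem remove_nontrivial (S : FinRootedTree) (x : S.V) (hx : x ≠ S.root)
    (hy : ∃ y, y ≠ x ∧ y ≠ S.root) : Nontrivial {v : S.V // v ≠ x} :=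
  ⟨⟨hy.choose, hy.choose_spec.1⟩, ⟨S.root, hx.symm⟩,
    fun h => hy.choose_spec.2 (congrArg Subtype.val h)⟩

/-- The parent function after removing `x`. -/
noncomputable def removePar (S : FinRootedTree) (x : S.V) (hx : x ≠ S.root)
    (v : {v : S.V // v ≠ x}) : {v : S.V // v ≠ x} :=
  open Classical in if h : S.par v.1 = x then ⟨S.par x, S.par_ne hx⟩ else ⟨S.par v.1, h⟩

theorem ht_removePar_lt (S : FinRootedTree) (x : S.V) (hx : x ≠ S.root) (v : {v : S.V // v ≠ x})
    (hv : v ≠ ⟨S.root, hx.symm⟩) : S.ht (S.removePar x hx v).1 < S.ht v.1 := by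
  have hv' : v.1 ≠ S.root := fun h => hv (Subtype.ext h)
  have h1 := S.ht_par hv'
  have h2 := S.ht_par hx
  unfold removePar
  split_ifs with h
  · rw [h] at h1; simp only; omega
  · simp only; omega

/-- Remove a vertex `x` from a tree and attach its children to its parent. -/
noncomputable def remove (S : FinRootedTree) (x : S.V) (hx : x ≠ S.root)
    (hy : ∃ y, y ≠ x ∧ y ≠ S.root) : FinRootedTree :=
  have := S.remove_nontrivial x hx hy
  ofPar {v : S.V // v ≠ x} ⟨S.root, hx.symm⟩ (S.removePar x hx) (fun v => S.ht v.1)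
    (S.ht_removePar_lt x hx)

section Remove

variable (S : FinRootedTree) (x : S.V) (hx : x ≠ S.root) (hy : ∃ y, y ≠ x ∧ y ≠ S.root)

/-- The inclusion of the remaining vertices. -/
def removeVal (v : (S.remove x hx hy).V) : S.V := Subtype.val (p := fun v => v ≠ x) v

/-- A vertex that is not removed. -/
def removeMk (v : S.V) (hv : v ≠ x) : (S.remove x hx hy).V := (⟨v, hv⟩ : {v : S.V // v ≠ x})

@[simp] theorem removeVal_mk (v : S.V) (hv : v ≠ x) :
    S.removeVal x hx hy (S.removeMk x hx hy v hv) = v := rfl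

theorem removeVal_ne (v : (S.remove x hx hy).V) : S.removeVal x hx hy v ≠ x :=
  Subtype.prop (p := fun v => v ≠ x) v

@[simp] theorem removeMk_val (v : (S.remove x hx hy).V) :
    S.removeMk x hx hy _ (S.removeVal_ne x hx hy v) = v := rfl

theorem removeVal_injective : Function.Injective (S.removeVal x hx hy) :=
  Subtype.val_injective (p := fun v => v ≠ x)

theorem removeVal_root : S.removeVal x hx hy (S.remove x hx hy).root = S.root := rfl

theorem removeVal_eq_root {v : (S.remove x hx hy).V} :
    S.removeVal x hx hy v = S.root ↔ v = (S.remove x hx hy).root :=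
  ⟨fun h => S.removeVal_injective x hx hy h, fun h => h ▸ rfl⟩

theorem removeVal_par (v : (S.remove x hx hy).V) :
    S.removeVal x hx hy ((S.remove x hx hy).par v) = open Classical in
      if S.par (S.removeVal x hx hy v) = x then S.par x else S.par (S.removeVal x hx hy v) := by
  by_cases hv : v = (S.remove x hx hy).root
  · subst hv; rw [par_root, removeVal_root, par_root, if_neg hx.symm]
  · have := S.remove_nontrivial x hx hy
    have h : (S.remove x hx hy).par v = _ :=
      ofPar_par _ _ _ (fun v => S.ht v.1) (S.ht_removePar_lt x hx) hv
    rw [h]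
    by_cases h1 : S.par (S.removeVal x hx hy v) = x
    · rw [if_pos h1]; exact congrArg Subtype.val (dif_pos h1)
    · rw [if_neg h1]; exact congrArg Subtype.val (dif_neg h1)

theorem removeVal_par_of_ne (v : (S.remove x hx hy).V) (h : S.par (S.removeVal x hx hy v) ≠ x) :
    S.removeVal x hx hy ((S.remove x hx hy).par v) = S.par (S.removeVal x hx hy v) := by
  rw [removeVal_par, if_neg h]

theorem removeVal_par_of_eq (v : (S.remove x hx hy).V) (h : S.par (S.removeVal x hx hy v) = x) :
    S.removeVal x hx hy ((S.remove x hx hy).par v) = S.par x := by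
  rw [removeVal_par, if_pos h]

theorem card_remove : Nat.card (S.remove x hx hy).V < Nat.card S.V := by
  have : Nat.card {v : S.V // v ≠ x} < Nat.card S.V := by
    classical
    have := Fintype.ofFinite S.V
    rw [Nat.card_eq_fintype_card, Nat.card_eq_fintype_card]
    exact Fintype.card_subtype_lt (x := x) (by simp)
  exact this

/-- The retraction that maps the removed vertex to `z`. -/
noncomputable def retract (z : S.V) (hz : z ≠ x) (v : S.V) : (S.remove x hx hy).V :=
  open Classical in if h : v = x then S.removeMk x hx hy z hz else S.removeMk x hx hy v h

theorem retract_self (z : S.V) (hz : z ≠ x) :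
    S.retract x hx hy z hz x = S.removeMk x hx hy z hz := by simp [retract]

theorem retract_of_ne (z : S.V) (hz : z ≠ x) {v : S.V} (hv : v ≠ x) :
    S.retract x hx hy z hz v = S.removeMk x hx hy v hv := by simp [retract, hv]

theorem comp_retract {T : FinRootedTree} {f : S.V → T.V} {z : S.V} (hz : z ≠ x) (hf : f x = f z) :
    f = (f ∘ S.removeVal x hx hy) ∘ S.retract x hx hy z hz := by
  funext v
  by_cases hv : v = x
  · subst hv; simp [retract_self, hf]
  · simp [S.retract_of_ne x hx hy z hz hv]

/-- A non-root vertex with exactly one child is the midpoint of a split edge: removing it joins the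
child to the parent, and the retraction to either end undoes the splitting. -/
theorem splitData_retract {y : S.V} (hyx : S.par y = x) (hyr : y ≠ S.root)
    (huniq : ∀ w, w ≠ S.root → S.par w = x → w = y) (z : S.V) (hz : z ≠ x)
    (hz' : z = y ∨ z = S.par x) :
    SplitData (S.retract x hx hy z hz) (S.removeVal x hx hy) x
      (S.removeMk x hx hy y (fun h => S.par_ne hyr (hyx.trans h.symm))) := by
  have hne : y ≠ x := fun h => S.par_ne hyr (hyx.trans h.symm)
  refine ⟨fun h => hyr ?_, fun u => ?_, S.removeVal_ne x hx hy, fun v hv => ?_, rfl, by simpa, ?_,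
    fun u hu hub => ?_, ?_⟩
  · exact (S.removeVal_eq_root x hx hy).2 h
  · rw [S.retract_of_ne x hx hy z hz (S.removeVal_ne x hx hy u), removeMk_val]
  · rw [S.retract_of_ne x hx hy z hz hv, removeVal_mk]
  · rw [removeVal_par_of_eq]; simp [hyx]
  · rw [removeVal_par_of_ne]
    intro h
    exact hub (S.removeVal_injective x hx hy
      (huniq _ (fun h => hu ((S.removeVal_eq_root x hx hy).1 h)) h))
  · rw [retract_self]
    rcases hz' with rfl | rfl
    · exact Or.inl rfl
    · refine Or.inr (S.removeVal_injective x hx hy ?_)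
      rw [removeVal_par_of_eq]
      · simp
      · simpa

end Remove

/-! ### Simultaneous splittings of several edges -/

/-- The parent of `v`, skipping one vertex of `X`. -/
noncomputable def skip (S : FinRootedTree) (X : Set S.V) (v : S.V) : S.V :=
  open Classical in if S.par v ∈ X then S.par (S.par v) else S.par v

theorem skip_of_mem (S : FinRootedTree) {X : Set S.V} {v : S.V} (h : S.par v ∈ X) :
    S.skip X v = S.par (S.par v) := if_pos h

theorem skip_of_notMem (S : FinRootedTree) {X : Set S.V} {v : S.V} (h : S.par v ∉ X) :
    S.skip X v = S.par v := if_neg h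

/-- `f` is light confluent once the vertices in `X` are removed; every vertex in `X` has a unique
child, and it is mapped to the image of that child or of its parent. -/
structure IsLCOff {S T : FinRootedTree} (X : Set S.V) (f : S.V → T.V) : Prop where
  root_notMem : S.root ∉ X
  child : ∀ x ∈ X, ∃ y, y ∉ X ∧ y ≠ S.root ∧ S.par y = x ∧
    (∀ w, w ≠ S.root → S.par w = x → w = y) ∧ (f x = f y ∨ f x = f (S.par x))
  par_notMem : ∀ x ∈ X, S.par x ∉ X
  map_root : f S.root = T.root
  ne_root : ∀ v, v ∉ X → v ≠ S.root → f v ≠ T.root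
  map_par : ∀ v, v ∉ X → v ≠ S.root → T.par (f v) = f (S.skip X v)
  lift : ∀ v, v ∉ X → ∀ b, b ≠ T.root → T.par b = f v →
    ∃ w, w ∉ X ∧ w ≠ S.root ∧ S.skip X w = v ∧ f w = b

namespace IsLCOff

variable {S T : FinRootedTree} {X : Set S.V} {f : S.V → T.V}

theorem isLC (h : IsLCOff (∅ : Set S.V) f) : IsLC f where
  map_root := h.map_root
  ne_root v hv := h.ne_root v id hv
  map_par v hv := by simpa [skip] using h.map_par v id hv
  lift v b hb hv := by simpa [skip] using h.lift v id b hb hv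

/-- Send `x` to whichever of its child and its parent has the same value under `f`; this is a
splitting through which `f` factors. Since no vertex of `X` has its parent in `X`, removing `x`
leaves the conditions at the other vertices of `X` intact. -/
theorem exists_factor (h : IsLCOff X f) {x : S.V} (hxX : x ∈ X) :
    ∃ (R : FinRootedTree) (r : S.V → R.V) (ι : R.V → S.V) (b : R.V) (g : R.V → T.V),
      SplitData r ι x b ∧ f = g ∘ r ∧ g = f ∘ ι ∧ IsLCOff (ι ⁻¹' X) g := by
  have hx : x ≠ S.root := fun hx => h.root_notMem (hx ▸ hxX)
  obtain ⟨y, hyX, hyr, hyx, huniq, hf⟩ := h.child x hxX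
  have hyne : y ≠ x := fun h => hyX (h ▸ hxX)
  have hy : ∃ y, y ≠ x ∧ y ≠ S.root := ⟨y, hyne, hyr⟩
  obtain ⟨z, hz, hz', hfz⟩ : ∃ z, z ≠ x ∧ (z = y ∨ z = S.par x) ∧ f x = f z := by
    rcases hf with hf | hf
    · exact ⟨y, hyne, Or.inl rfl, hf⟩
    · exact ⟨_, S.par_ne hx, Or.inr rfl, hf⟩
  refine ⟨S.remove x hx hy, S.retract x hx hy z hz, S.removeVal x hx hy, _, _,
    S.splitData_retract x hx hy hyx hyr huniq z hz hz', S.comp_retract x hx hy hz hfz, rfl, ?_⟩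
  set ι := S.removeVal x hx hy with hι
  -- A vertex `x` of `X` may be skipped or removed with the same effect on parents.
  have hskip : ∀ v, v ≠ (S.remove x hx hy).root → ι v ∉ X →
      ι ((S.remove x hx hy).skip (ι ⁻¹' X) v) = S.skip X (ι v) := by
    intro v hv hvX
    by_cases h1 : S.par (ι v) = x
    · have h2 := S.removeVal_par_of_eq x hx hy v h1
      rw [skip_of_notMem, skip_of_mem _ (h1 ▸ hxX), h1]
      · exact h2
      · rw [Set.mem_preimage, hι, h2]; exact h.par_notMem x hxX
    · have h2 := S.removeVal_par_of_ne x hx hy v h1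
      by_cases h3 : S.par (ι v) ∈ X
      · rw [skip_of_mem _ h3, skip_of_mem]
        · have h4 : S.par (ι ((S.remove x hx hy).par v)) ≠ x := by
            rw [hι, h2]; intro h4; exact h.par_notMem _ h3 (h4 ▸ hxX)
          rw [hι, S.removeVal_par_of_ne x hx hy _ h4, h2]
        · rw [Set.mem_preimage, hι, h2]; exact h3
      · rw [skip_of_notMem _ h3, skip_of_notMem]
        · exact h2
        · rw [Set.mem_preimage, hι, h2]; exact h3
  have hroot : ∀ {v}, ι v = S.root ↔ v = (S.remove x hx hy).root := S.removeVal_eq_root x hx hy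
  refine ⟨h.root_notMem, ?_, ?_, h.map_root, fun v hv hvr => h.ne_root _ hv
    (fun h' => hvr (hroot.1 h')), fun v hv hvr => ?_, fun v hv b hb hbv => ?_⟩
  · intro x' hx'
    obtain ⟨y', h1, h2, h3, h4, h5⟩ := h.child _ hx'
    have hxx' : ι x' ≠ x := S.removeVal_ne x hx hy x'
    have hy' : y' ≠ x := fun h' => h1 (h' ▸ hxX)
    refine ⟨S.removeMk x hx hy y' hy', h1, fun h' => h2 (hroot.2 h'), ?_, ?_, ?_⟩
    · apply S.removeVal_injective x hx hy
      rw [S.removeVal_par_of_ne x hx hy _ (by rw [removeVal_mk, h3]; exact hxx')]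
      exact h3
    · intro w hw hwx
      apply S.removeVal_injective x hx hy
      refine h4 _ (fun h' => hw (hroot.1 h')) ?_
      rw [← hwx, ← hι]
      symm
      refine S.removeVal_par_of_ne x hx hy _ fun h' => ?_
      have h6 := S.removeVal_par_of_eq x hx hy _ h'
      rw [hwx] at h6
      exact h.par_notMem x hxX (h6 ▸ hx')
    · refine h5.imp id fun h5 => ?_
      simp only [Function.comp_apply]
      rw [hι, S.removeVal_par_of_ne x hx hy _ fun h' => h.par_notMem _ hx' (h' ▸ hxX)]
      exact h5
  · intro x' hx'
    rw [Set.mem_preimage, hι,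
      S.removeVal_par_of_ne x hx hy _ fun h' => h.par_notMem _ hx' (h' ▸ hxX)]
    exact h.par_notMem _ hx'
  · simp only [Function.comp_apply]
    rw [hskip v hvr hv, h.map_par _ hv fun h' => hvr (hroot.1 h')]
  · obtain ⟨w, h1, h2, h3, h4⟩ := h.lift _ hv b hb hbv
    have hwx : w ≠ x := fun h' => h1 (h' ▸ hxX)
    have hw : S.removeMk x hx hy w hwx ≠ (S.remove x hx hy).root := fun h' => h2 (hroot.2 h')
    refine ⟨S.removeMk x hx hy w hwx, h1, hw, S.removeVal_injective x hx hy ?_, h4⟩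
    rw [← hι, hskip _ hw h1]
    exact h3

/-- Splitting off the vertices of `X` one at a time leaves an injective light confluent map, that
is, an isomorphism. -/
theorem isMono (h : IsLCOff X f) (hi : Set.InjOn f Xᶜ) : IsMono f := by
  induction hn : X.ncard generalizing S with
  | zero =>
    have hX : X = ∅ := (Set.ncard_eq_zero (Set.toFinite X)).1 hn
    subst hX
    exact .iso h.isLC (by simpa using hi)
  | succ n ih =>
    obtain ⟨x, hx⟩ : X.Nonempty := by
      rw [← Set.ncard_pos (Set.toFinite X)]; omega
    obtain ⟨R, r, ι, b, g, hr, rfl, hg, hLC⟩ := h.exists_factor hx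
    have hcard : (ι ⁻¹' X).ncard = n := by
      have h1 : ι '' (ι ⁻¹' X) = X \ {x} := by
        ext v
        constructor
        · rintro ⟨u, hu, rfl⟩; exact ⟨hu, hr.ne_new u⟩
        · rintro ⟨hv, hvx⟩
          have hvx : v ≠ x := hvx
          exact ⟨r v, by rwa [Set.mem_preimage, hr.eq_of_ne v hvx], hr.eq_of_ne v hvx⟩
      rw [← Set.ncard_image_of_injective _ hr.injective, h1, Set.ncard_sdiff_singleton_of_mem hx, hn]
      rfl
    refine .comp (ih hLC ?_ hcard) (.split hr.isSplittingEdge)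
    rw [hg]
    intro u hu v hv huv
    exact hr.injective (hi hu hv huv)

/-- The factorization leaves one splitting followed by an isomorphism, and `SplitData.comp_iso`
absorbs the latter. -/
theorem isSplittingEdge {x : S.V} (h : IsLCOff {x} f) (hi : Set.InjOn f {x}ᶜ) :
    IsSplittingEdge f := by
  obtain ⟨R, r, ι, b, g, hr, rfl, hg, hLC⟩ := h.exists_factor rfl
  have h1 : ι ⁻¹' {x} = ∅ := by
    ext u; simpa using hr.ne_new u
  rw [h1] at hLC
  have hgi : Function.Injective g := by
    rw [hg]
    intro u v huv
    exact hr.injective (hi (hr.ne_new u) (hr.ne_new v) huv)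
  obtain ⟨e, he1, he2⟩ := hLC.isLC.exists_inverse hgi
  exact (hr.comp_iso hLC.isLC he1 he2).isSplittingEdge

end IsLCOff

end FinRootedTree

/-! ## Amalgamation -/

namespace FinRootedTree

/-- Hides the construction `ofPar` behind an equivalence, so that its users deal only with the root
and the parents. -/
theorem exists_of_par (V : Type) [Finite V] [Nontrivial V] (root : V) (p : V → V) (rk : V → ℕ)
    (hrk : ∀ v, v ≠ root → rk (p v) < rk v) : ∃ (T : FinRootedTree) (e : T.V ≃ V),
      e T.root = root ∧ ∀ v, v ≠ T.root → e (T.par v) = p (e v) :=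
  ⟨ofPar V root p rk hrk, Equiv.refl _, rfl, fun _ hv => ofPar_par V root p rk hrk hv⟩

namespace IsLC

variable {S T : FinRootedTree} {f : S.V → T.V}

theorem eq_root_iff (h : IsLC f) {v : S.V} : f v = T.root ↔ v = S.root :=
  ⟨fun hv => by_contra fun hv' => h.ne_root v hv' hv, fun hv => hv ▸ h.map_root⟩

theorem map_par' (h : IsLC f) (v : S.V) : T.par (f v) = f (S.par v) := by
  by_cases hv : v = S.root
  · rw [hv, h.map_root, par_root, par_root, h.map_root]
  · exact h.map_par v hv

end IsLC

/-- The fibre product of two light confluent epimorphisms. -/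
theorem IsLC.exists_pullback {A B C : FinRootedTree} {f : C.V → A.V} {g : B.V → A.V}
    (hf : IsLC f) (hg : IsLC g) : ∃ (D : FinRootedTree) (g' : D.V → C.V) (f' : D.V → B.V),
      f ∘ g' = g ∘ f' ∧ IsLC g' ∧ IsLC f' ∧ (Function.Injective g → Function.Injective g') := by
  let V := {p : C.V × B.V // f p.1 = g p.2}
  let root : V := ⟨(C.root, B.root), by rw [hf.map_root, hg.map_root]⟩
  have : Nontrivial V := by
    have := A.nontrivial
    obtain ⟨a, ha⟩ := exists_ne A.root
    obtain ⟨c, hc⟩ := hf.surjective a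
    obtain ⟨b, hb⟩ := hg.surjective a
    refine ⟨⟨⟨(c, b), hc.trans hb.symm⟩, root, fun h => ha ?_⟩⟩
    rw [← hc, hf.eq_root_iff]
    exact congrArg (fun p : V => p.1.1) h
  obtain ⟨D, e, he0, he⟩ := exists_of_par V root
    (fun p => ⟨(C.par p.1.1, B.par p.1.2), by simp only [← hf.map_par', ← hg.map_par', p.2]⟩)
    (fun p => C.ht p.1.1) (fun p hp => by
      have : p.1.1 ≠ C.root := fun h => hp (Subtype.ext (Prod.ext h
        (hg.eq_root_iff.1 (by rw [← p.2]; exact hf.eq_root_iff.2 h))))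
      have := C.ht_par this
      simp only
      omega)
  have hv1 : ∀ v, v ≠ D.root → (e v).1.1 ≠ C.root := fun v hv h => hv (e.injective (by
    rw [he0]
    exact Subtype.ext (Prod.ext h
      (hg.eq_root_iff.1 (by rw [← (e v).2]; exact hf.eq_root_iff.2 h)))))
  have hv2 : ∀ v, v ≠ D.root → (e v).1.2 ≠ B.root := fun v hv h => hv1 v hv
    (hf.eq_root_iff.1 (by rw [(e v).2]; exact hg.eq_root_iff.2 h))
  refine ⟨D, fun v => (e v).1.1, fun v => (e v).1.2, funext fun v => (e v).2,
    ⟨by simp only [he0, root], hv1, fun v hv => by simp only [he v hv], ?_⟩,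
    ⟨by simp only [he0, root], hv2, fun v hv => by simp only [he v hv], ?_⟩, ?_⟩
  · intro v c hc hcv
    obtain ⟨b, hb, hb', hb''⟩ := hg.lift (e v).1.2 (f c) (hf.ne_root c hc)
      (by rw [hf.map_par', hcv, (e v).2])
    have hw : e.symm ⟨(c, b), hb''.symm⟩ ≠ D.root := fun h => hc (by
      have := congrArg e h
      rw [Equiv.apply_symm_apply, he0] at this
      exact congrArg (fun p : V => p.1.1) this)
    refine ⟨_, hw, e.injective ?_, by simp⟩
    rw [he _ hw]
    simp only [Equiv.apply_symm_apply]
    exact Subtype.ext (Prod.ext hcv hb')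
  · intro v b hb hbv
    obtain ⟨c, hc, hc', hc''⟩ := hf.lift (e v).1.1 (g b) (hg.ne_root b hb)
      (by rw [hg.map_par', hbv, (e v).2])
    have hw : e.symm ⟨(c, b), hc''⟩ ≠ D.root := fun h => hb (by
      have := congrArg e h
      rw [Equiv.apply_symm_apply, he0] at this
      exact congrArg (fun p : V => p.1.2) this)
    refine ⟨_, hw, e.injective ?_, by simp⟩
    rw [he _ hw]
    simp only [Equiv.apply_symm_apply]
    exact Subtype.ext (Prod.ext hc' hbv)
  · intro hi v w hvw
    refine e.injective (Subtype.ext (Prod.ext hvw (hi ?_)))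
    rw [← (e v).2, ← (e w).2]
    exact congrArg f hvw

/-- For a map that is bijective off `X`, preservation of skipped parents already gives the lifting
of children: the unique vertex over the child is one. -/
theorem IsLCOff.of_bijOn {S T : FinRootedTree} {X : Set S.V} {f : S.V → T.V}
    (root_notMem : S.root ∉ X)
    (child : ∀ x ∈ X, ∃ y, y ∉ X ∧ y ≠ S.root ∧ S.par y = x ∧
      (∀ w, w ≠ S.root → S.par w = x → w = y) ∧ (f x = f y ∨ f x = f (S.par x)))
    (par_notMem : ∀ x ∈ X, S.par x ∉ X) (map_root : f S.root = T.root)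
    (map_par : ∀ v, v ∉ X → v ≠ S.root → T.par (f v) = f (S.skip X v))
    (inj : Set.InjOn f Xᶜ) (surj : ∀ b, ∃ v, v ∉ X ∧ f v = b) : IsLCOff X f where
  root_notMem := root_notMem
  child := child
  par_notMem := par_notMem
  map_root := map_root
  ne_root v hv hvr h := hvr (inj hv root_notMem (h.trans map_root.symm))
  map_par := map_par
  lift v hv b hb hbv := by
    obtain ⟨w, hw, rfl⟩ := surj b
    have hwr : w ≠ S.root := fun h => hb (h ▸ map_root)
    refine ⟨w, hw, hwr, inj ?_ hv (by rw [← map_par w hw hwr, hbv]), rfl⟩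
    by_cases h : S.par w ∈ X
    · rw [S.skip_of_mem h]; exact par_notMem _ h
    · rw [S.skip_of_notMem h]; exact h

theorem IsEpi.par_eq_or {S T : FinRootedTree} {f : S.V → T.V} (hf : IsEpi f) (v : S.V) :
    f (S.par v) = f v ∨ f (S.par v) = T.par (f v) := by
  by_cases hv : v = S.root
  · left; rw [hv, par_root]
  · exact ((isEpi_iff.1 hf).2.1 v hv).imp Eq.symm fun h => h.2.symm

theorem IsEpi.exists_child {S T : FinRootedTree} {f : S.V → T.V} (hf : IsEpi f) {b : T.V}
    (hb : b ≠ T.root) : ∃ v, f v = b ∧ f (S.par v) ≠ b := by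
  obtain ⟨v, rfl⟩ := hf.surj b
  induction v using S.par_induction with
  | h0 => exact absurd hf.map_root hb
  | h1 v hv ih =>
    by_cases h : f (S.par v) = f v
    · rw [h] at ih; exact ih hb
    · exact ⟨v, rfl, h⟩

/-! ### Pulling back a splitting -/

/-- `D` is obtained from `C` by splitting all the edges that `f : C → A` maps onto the edge below
`b`; `snd` maps `D` to the tree obtained from `A` by splitting that edge. -/
structure IsSplitPullback {A B C D : FinRootedTree} (f : C.V → A.V) (ι : A.V → B.V) (x : B.V)
    (b : A.V) (fst : D.V → C.V) (snd : D.V → B.V) : Prop where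
  ext : ∀ u v, fst u = fst v → snd u = snd v → u = v
  cases : ∀ v, snd v = ι (f (fst v)) ∨ (snd v = x ∧ f (fst v) = b ∧ f (C.par (fst v)) ≠ b)
  exists_old : ∀ c, ∃ v, fst v = c ∧ snd v = ι (f c)
  exists_new : ∀ c, f c = b → f (C.par c) ≠ b → ∃ v, fst v = c ∧ snd v = x
  fst_root : fst D.root = C.root
  snd_root : snd D.root = B.root
  par_new : ∀ v, snd v = x →
    fst (D.par v) = C.par (fst v) ∧ snd (D.par v) = ι (f (C.par (fst v)))
  par_top : ∀ v, snd v ≠ x → f (fst v) = b → f (C.par (fst v)) ≠ b →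
    fst (D.par v) = fst v ∧ snd (D.par v) = x
  par_old : ∀ v, snd v ≠ x → ¬ (f (fst v) = b ∧ f (C.par (fst v)) ≠ b) →
    fst (D.par v) = C.par (fst v) ∧ snd (D.par v) = ι (f (C.par (fst v)))

/-- The vertices of `D` are pairs: `(c, ι (f c))` for every `c`, and in addition `(c, x)` for every
`c` at which the fibre over `b` is entered from below. -/
theorem SplitData.exists_isSplitPullback {A B C : FinRootedTree} {f : C.V → A.V} {g : B.V → A.V}
    {ι : A.V → B.V} {x : B.V} {b : A.V} (hf : IsEpi f) (hg : SplitData g ι x b) :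
    ∃ (D : FinRootedTree) (fst : D.V → C.V) (snd : D.V → B.V),
      IsSplitPullback f ι x b fst snd := by
  classical
  let V := {p : C.V × B.V //
    p.2 = ι (f p.1) ∨ (p.2 = x ∧ f p.1 = b ∧ f (C.par p.1) ≠ b)}
  let old : C.V → V := fun c => ⟨(c, ι (f c)), Or.inl rfl⟩
  let p : V → V := fun v => if v.1.2 = x then old (C.par v.1.1)
    else if h : f v.1.1 = b ∧ f (C.par v.1.1) ≠ b then ⟨(v.1.1, x), Or.inr ⟨rfl, h⟩⟩
    else old (C.par v.1.1)
  have : Nontrivial V := by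
    have := C.nontrivial
    obtain ⟨c, hc⟩ := exists_ne C.root
    exact ⟨⟨old c, old C.root, fun h => hc (congrArg (fun p : V => p.1.1) h)⟩⟩
  have hroot : ∀ v : V, v.1.1 = C.root → v = old C.root := by
    rintro ⟨⟨c, s⟩, h⟩ rfl
    rcases h with h | ⟨-, h, -⟩
    · exact Subtype.ext (Prod.ext rfl h)
    · exact absurd (h.symm.trans hf.map_root) hg.ne_root
  obtain ⟨D, e, he0, he⟩ := exists_of_par V (old C.root) p
    -- The new vertex over `c` lies between the old vertices over `C.par c` and over `c`.
    (fun v => 2 * C.ht v.1.1 + if v.1.2 = x then 0 else 1) (fun v hv => by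
      have h1 := C.ht_par fun h => hv (hroot v h)
      by_cases h2 : v.1.2 = x
      · simp only [p, h2, if_true, old, hg.ne_new, if_false]; omega
      · by_cases h3 : f v.1.1 = b ∧ f (C.par v.1.1) ≠ b
        · simp only [p, h2, if_false, dif_pos h3, if_true]; omega
        · simp only [p, h2, if_false, dif_neg h3, old, hg.ne_new]; omega)
  have hpr : p (old C.root) = old C.root := by
    have h3 : ¬ (f C.root = b ∧ f C.root ≠ b) := fun h => h.2 h.1
    simp only [p, old, hg.ne_new, if_false, par_root, dif_neg h3]
  have he' : ∀ v, e (D.par v) = p (e v) := fun v => by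
    by_cases hv : v = D.root
    · rw [hv, par_root, he0, hpr]
    · exact he v hv
  refine ⟨D, fun v => (e v).1.1, fun v => (e v).1.2,
    fun u v h1 h2 => e.injective (Subtype.ext (Prod.ext h1 h2)), fun v => (e v).2,
    fun c => ⟨e.symm (old c), by simp [old], by simp [old]⟩,
    fun c h1 h2 => ⟨e.symm ⟨(c, x), Or.inr ⟨rfl, h1, h2⟩⟩, by simp, by simp⟩,
    by simp [he0, old], by simp [he0, old, hf.map_root, hg.root], fun v h1 => ?_,
    fun v h1 h2 h3 => ?_, fun v h1 h2 => ?_⟩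
  · simp only [he', p, h1, if_true, old, and_self]
  · have h4 : f (e v).1.1 = b ∧ f (C.par (e v).1.1) ≠ b := ⟨h2, h3⟩
    simp only [he', p, h1, if_false, dif_pos h4, and_self]
  · simp only [he', p, h1, if_false, dif_neg h2, old, and_self]

namespace IsSplitPullback

variable {A B C D : FinRootedTree} {f : C.V → A.V} {g : B.V → A.V} {ι : A.V → B.V} {x : B.V}
  {b : A.V} {fst : D.V → C.V} {snd : D.V → B.V}

/-- The projection to `C`, which maps the new vertices according to the type of the splitting. -/
noncomputable def toBase (C : FinRootedTree) (g : B.V → A.V) (x : B.V) (b : A.V) (fst : D.V → C.V)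
    (snd : D.V → B.V) (v : D.V) : C.V :=
  open Classical in if snd v = x ∧ g x = A.par b then C.par (fst v) else fst v

theorem toBase_of_ne {v : D.V} (h : snd v ≠ x) : toBase C g x b fst snd v = fst v := by
  simp [toBase, h]

/-- This is what dictates `toBase`: a new vertex over `c` goes to `c` or to its parent according to
whether `g` sends `x` to the upper or the lower end of its edge. -/
theorem comp_eq (h : IsSplitPullback f ι x b fst snd) (hf : IsEpi f) (hg : SplitData g ι x b) :
    f ∘ toBase C g x b fst snd = g ∘ snd := by
  funext v
  by_cases hv : snd v = x
  · obtain ⟨h1, h2⟩ := ((h.cases v).resolve_left fun h' => hg.ne_new _ (h'.symm.trans hv)).2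
    rw [Function.comp_apply, Function.comp_apply, hv]
    by_cases h3 : g x = A.par b
    · have h4 : toBase C g x b fst snd v = C.par (fst v) := if_pos ⟨hv, h3⟩
      rw [h4, h3, ← h1]
      exact (hf.par_eq_or _).resolve_left fun h' => h2 (h'.trans h1)
    · have h4 : toBase C g x b fst snd v = fst v := if_neg fun h' => h3 h'.2
      rw [h4, h1, hg.map_new.resolve_right h3]
  · have h1 := (h.cases v).resolve_right fun h' => hv h'.1
    rw [Function.comp_apply, toBase_of_ne hv, Function.comp_apply, h1, hg.inv]

theorem snd_eq (h : IsSplitPullback f ι x b fst snd) {v : D.V} (hv : snd v ≠ x) :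
    snd v = ι (f (fst v)) := (h.cases v).resolve_right fun h' => hv h'.1

theorem of_snd_eq (h : IsSplitPullback f ι x b fst snd) (hg : SplitData g ι x b) {v : D.V}
    (hv : snd v = x) : f (fst v) = b ∧ f (C.par (fst v)) ≠ b :=
  ((h.cases v).resolve_left fun h' => hg.ne_new _ (h'.symm.trans hv)).2

theorem injOn_toBase (h : IsSplitPullback f ι x b fst snd) :
    Set.InjOn (toBase C g x b fst snd) {v | snd v = x}ᶜ := by
  intro u hu v hv huv
  rw [toBase_of_ne hu, toBase_of_ne hv] at huv
  exact h.ext _ _ huv (by rw [h.snd_eq hu, h.snd_eq hv, huv])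

theorem eq_root_of_fst (h : IsSplitPullback f ι x b fst snd) (hf : IsEpi f)
    (hg : SplitData g ι x b) {v : D.V} (hv : fst v = C.root) : v = D.root := by
  have h1 : f (fst v) ≠ b := by rw [hv, hf.map_root]; exact hg.ne_root.symm
  refine h.ext _ _ (hv.trans h.fst_root.symm) ?_
  rw [(h.cases v).resolve_right fun h' => h1 h'.2.1, h.snd_root, hv, hf.map_root, hg.root]

/-- The only child of the new vertex over `c` is the old vertex over `c`; off the new vertices
`toBase` is a bijection onto `C`. -/
theorem isLCOff_toBase (h : IsSplitPullback f ι x b fst snd)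
    (hg : SplitData g ι x b) : IsLCOff {v | snd v = x} (toBase C g x b fst snd) := by
  have hparx : ∀ v, snd v = x → snd (D.par v) ≠ x := fun v hv => by
    rw [(h.par_new v hv).2]; exact hg.ne_new _
  have hrx : snd D.root ≠ x := by rw [h.snd_root]; exact hg.new_ne_root.symm
  refine .of_bijOn hrx ?_ hparx ?_ ?_ h.injOn_toBase ?_
  · intro v hv
    have hv : snd v = x := hv
    obtain ⟨h1, h2⟩ := h.of_snd_eq hg hv
    obtain ⟨y, hy1, hy2⟩ := h.exists_old (fst v)
    have hyx : snd y ≠ x := by rw [hy2]; exact hg.ne_new _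
    have hyp := h.par_top y hyx (hy1 ▸ h1) (by rwa [hy1])
    refine ⟨y, hyx, ?_, h.ext _ _ (hyp.1.trans hy1) (hyp.2.trans hv.symm), ?_, ?_⟩
    · rintro rfl
      rw [h.snd_root, h1] at hy2
      exact hg.ι_ne_root hg.ne_root hy2.symm
    · intro w hw hwv
      have hwx : snd w ≠ x := fun h' => hparx w h' (hwv ▸ hv)
      have hw' : f (fst w) = b ∧ f (C.par (fst w)) ≠ b := by
        by_contra h'
        have := (h.par_old w hwx h').2
        rw [hwv, hv] at this
        exact hg.ne_new _ this.symm
      have h3 := (h.par_top w hwx hw'.1 hw'.2).1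
      rw [hwv] at h3
      exact h.ext _ _ (h3.symm.trans hy1.symm) (by rw [h.snd_eq hwx, h.snd_eq hyx, ← h3, hy1])
    · rw [toBase_of_ne hyx, toBase_of_ne (hparx v hv), (h.par_new v hv).1, hy1]
      unfold toBase
      split_ifs <;> simp
  · rw [toBase_of_ne hrx, h.fst_root]
  · intro v hv _
    have hv : snd v ≠ x := hv
    rw [toBase_of_ne hv]
    by_cases h1 : f (fst v) = b ∧ f (C.par (fst v)) ≠ b
    · obtain ⟨h2, h3⟩ := h.par_top v hv h1.1 h1.2
      rw [skip_of_mem _ (X := {v | snd v = x}) h3, toBase_of_ne (hparx _ h3),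
        (h.par_new _ h3).1, h2]
    · obtain ⟨h2, h3⟩ := h.par_old v hv h1
      have h4 : snd (D.par v) ≠ x := by rw [h3]; exact hg.ne_new _
      rw [skip_of_notMem _ (X := {v | snd v = x}) h4, toBase_of_ne h4, h2]
  · intro c
    obtain ⟨v, hv1, hv2⟩ := h.exists_old c
    have hv : snd v ≠ x := by rw [hv2]; exact hg.ne_new _
    exact ⟨v, hv, by rw [toBase_of_ne hv, hv1]⟩

/-- Since `f` collapses no edge, every vertex over `b` enters its fibre from below and so receives a
new vertex. Children over `x` and over `ι b` are therefore lifted just as the children over old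
vertices are. -/
theorem isLC_snd (h : IsSplitPullback f ι x b fst snd) (hf : IsLC f) (hg : SplitData g ι x b) :
    IsLC snd := by
  have hne : ∀ c, f c = b → f (C.par c) ≠ b := fun c hc h' => by
    rw [← hf.map_par', hc] at h'
    exact A.par_ne hg.ne_root h'
  refine ⟨h.snd_root, fun v hv h' => hv ?_, fun v hv => ?_, fun v s hs hsv => ?_⟩
  · have hvx : snd v ≠ x := by rw [h']; exact hg.new_ne_root.symm
    refine h.eq_root_of_fst hf.isEpi hg (hf.eq_root_iff.1 (hg.injective ?_))
    rw [← h.snd_eq hvx, h', hg.root]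
  · by_cases hvx : snd v = x
    · obtain ⟨h1, -⟩ := h.of_snd_eq hg hvx
      rw [hvx, (h.par_new v hvx).2, hg.par_new, ← hf.map_par', h1]
    · by_cases h1 : f (fst v) = b
      · rw [(h.par_top v hvx h1 (hne _ h1)).2, h.snd_eq hvx, h1, hg.par_top]
      · rw [(h.par_old v hvx fun h' => h1 h'.1).2, h.snd_eq hvx, ← hf.map_par',
          hg.par_old _ (fun h' => hv ?_) h1]
        exact h.eq_root_of_fst hf.isEpi hg (hf.eq_root_iff.1 h')
  · have hwr : ∀ w, snd w = s → w ≠ D.root := fun w hw h' => hs (by rw [← hw, h', h.snd_root])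
    by_cases hsx : s = x
    · subst hsx
      rw [hg.par_new] at hsv
      have hv : snd v ≠ s := hsv ▸ hg.ne_new _
      rw [h.snd_eq hv] at hsv
      obtain ⟨c, -, hc2, hc3⟩ := hf.lift (fst v) b hg.ne_root (hg.injective hsv)
      obtain ⟨w, hw1, hw2⟩ := h.exists_new c hc3 (hne c hc3)
      refine ⟨w, hwr w hw2, ?_, hw2⟩
      obtain ⟨h1, h2⟩ := h.par_new w hw2
      rw [hw1, hc2] at h1 h2
      exact h.ext _ _ h1 (h2.trans (h.snd_eq hv).symm)
    · obtain ⟨u, rfl⟩ : ∃ u, ι u = s := ⟨_, hg.eq_of_ne s hsx⟩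
      have hu : u ≠ A.root := fun h' => hs (h' ▸ hg.root)
      by_cases hub : u = b
      · subst hub
        rw [hg.par_top] at hsv
        obtain ⟨h1, h2⟩ := h.of_snd_eq hg hsv.symm
        obtain ⟨w, hw1, hw2⟩ := h.exists_old (fst v)
        rw [h1] at hw2
        refine ⟨w, hwr w hw2, ?_, hw2⟩
        obtain ⟨h3, h4⟩ := h.par_top w (hw2 ▸ hg.ne_new _) (hw1 ▸ h1) (by rwa [hw1])
        exact h.ext _ _ (h3.trans hw1) (h4.trans hsv)
      · rw [hg.par_old u hu hub] at hsv
        have hv : snd v ≠ x := hsv ▸ hg.ne_new _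
        rw [h.snd_eq hv] at hsv
        obtain ⟨c, -, hc2, hc3⟩ := hf.lift (fst v) u hu (hg.injective hsv)
        obtain ⟨w, hw1, hw2⟩ := h.exists_old c
        rw [hc3] at hw2
        refine ⟨w, hwr w hw2, ?_, hw2⟩
        obtain ⟨h1, h2⟩ := h.par_old w (hw2 ▸ hg.ne_new _) (fun h' => hub (by
          rw [← hc3, ← hw1]; exact h'.1))
        rw [hw1, hc2] at h1 h2
        exact h.ext _ _ h1 (h2.trans (h.snd_eq hv).symm)

variable {ιf : A.V → C.V} {xf : C.V} {bf : A.V}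

/-- The fibres of a splitting are connected, so each of them is entered from below at one vertex
only. -/
theorem unique_top (hf : SplitData f ιf xf bf) {b : A.V} {c c' : C.V} (h1 : f c = b)
    (h2 : f (C.par c) ≠ b) (h1' : f c' = b) (h2' : f (C.par c') ≠ b) : c = c' := by
  have key : ∀ c c', f c = b → f (C.par c) ≠ b → f c' = b → f (C.par c') ≠ b → c = xf →
      c' = xf := by
    rintro c c' h1 h2 h1' h2' rfl
    by_contra h
    rw [← hf.eq_of_ne c' h, h1'] at h2'
    rw [hf.par_new, hf.inv] at h2
    have hb : b = bf := by
      rcases hf.map_new with h3 | h3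
      · exact h1.symm.trans h3
      · exact absurd (h3.symm.trans h1) h2
    rw [hb, hf.par_top] at h2'
    exact h2' (h1.trans hb)
  by_cases hc : c = xf
  · rw [hc, key c c' h1 h2 h1' h2' hc]
  · have hc' : c' ≠ xf := fun h => hc (key c' c h1' h2' h1 h2 h)
    rw [← hf.eq_of_ne c hc, ← hf.eq_of_ne c' hc', h1, h1']

theorem isSplittingEdge_toBase (h : IsSplitPullback f ι x b fst snd) (hf : SplitData f ιf xf bf)
    (hg : SplitData g ι x b) : IsSplittingEdge (toBase C g x b fst snd) := by
  obtain ⟨c, hc1, hc2⟩ := hf.isEpi.exists_child hg.ne_root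
  obtain ⟨v, hv1, hv2⟩ := h.exists_new c hc1 hc2
  have hX : {v | snd v = x} = {v} := by
    ext w
    constructor
    · intro hw
      obtain ⟨h1, h2⟩ := h.of_snd_eq hg hw
      exact h.ext _ _ ((unique_top hf h1 h2 hc1 hc2).trans hv1.symm) (hw.trans hv2.symm)
    · rintro rfl; exact hv2
  exact (hX ▸ h.isLCOff_toBase hg :).isSplittingEdge (hX ▸ h.injOn_toBase)

/-- By symmetry, `D` is also `B` with one edge split; the additional vertex `x0` is the old vertex
over the vertex `xf` split off by `f`. The delicate case is that `f` and `g` split the same edge,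
and both vertices have to be placed on it in an order that agrees with both maps. -/
theorem isSplittingEdge_snd (h : IsSplitPullback f ι x b fst snd) (hf : SplitData f ιf xf bf)
    (hg : SplitData g ι x b) : IsSplittingEdge snd := by
  obtain ⟨x0, hx1, hx2⟩ := h.exists_old xf
  have hx0 : snd x0 ≠ x := hx2 ▸ hg.ne_new _
  have hold : ∀ v, v ≠ x0 → snd v ≠ x → fst v ≠ xf := fun v hv hvx h' => hv <|
    h.ext _ _ (h'.trans hx1.symm) (by rw [h.snd_eq hvx, h.snd_eq hx0, h', hx1])
  have hold' : ∀ v, v ≠ x0 → snd v ≠ x → fst v = ιf (f (fst v)) := fun v hv hvx =>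
    (hf.eq_of_ne _ (hold v hv hvx)).symm
  have hchild : ∀ c, c ≠ C.root → C.par c = xf → c = ιf bf := fun c hc hcx => by
    have h1 : c ≠ xf := fun h' => C.par_ne hc (hcx.trans h'.symm)
    obtain ⟨u, rfl⟩ : ∃ u, ιf u = c := ⟨_, hf.eq_of_ne c h1⟩
    by_contra h2
    rw [hf.par_old u (fun h' => hc (h' ▸ hf.root)) fun h' => h2 (h' ▸ rfl)] at hcx
    exact hf.ne_new _ hcx
  have hpb := A.par_ne hf.ne_root
  have hfpx : f (C.par xf) = A.par bf := by rw [hf.par_new, hf.inv]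
  have hparx0 : ¬ (f xf = b ∧ bf = b) → snd (D.par x0) = ι (A.par bf) := fun h' => by
    have h1 : ¬ (f (fst x0) = b ∧ f (C.par (fst x0)) ≠ b) := by
      rw [hx1, hfpx]
      rintro ⟨h1, h2⟩
      rcases hf.map_new with h3 | h3
      · exact h' ⟨h1, h3.symm.trans h1⟩
      · exact h2 (h3.symm.trans h1)
    rw [(h.par_old x0 hx0 h1).2, hx1, hfpx]
  have hinj : Set.InjOn snd {x0}ᶜ := by
    intro u hu v hv huv
    have hu : u ≠ x0 := hu
    have hv : v ≠ x0 := hv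
    by_cases hux : snd u = x
    · obtain ⟨h1, h2⟩ := h.of_snd_eq hg hux
      obtain ⟨h1', h2'⟩ := h.of_snd_eq hg (huv.symm.trans hux)
      exact h.ext _ _ (unique_top hf h1 h2 h1' h2') huv
    · have hvx : snd v ≠ x := huv ▸ hux
      refine h.ext _ _ ?_ huv
      rw [hold' u hu hux, hold' v hv hvx]
      rw [h.snd_eq hux, h.snd_eq hvx] at huv
      rw [hg.injective huv]
  refine IsLCOff.isSplittingEdge (.of_bijOn ?_ ?_ ?_ h.snd_root ?_ hinj ?_) hinj
  · intro h'
    rw [Set.mem_singleton_iff] at h'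
    exact hf.new_ne_root (by rw [← hx1, ← h', h.fst_root])
  · intro v hv
    rw [Set.mem_singleton_iff] at hv
    rw [hv]
    have hx0r : x0 ≠ D.root := fun h' => hf.new_ne_root (by rw [← hx1, h', h.fst_root])
    have huniq : ∀ w, w ≠ D.root → D.par w = x0 → fst w = ιf bf ∧
        (snd w = x ∨ ¬ (f (fst w) = b ∧ f (C.par (fst w)) ≠ b)) := by
      intro w hw hwx
      have hwr : fst w ≠ C.root := fun h' => hw (h.eq_root_of_fst hf.isEpi hg h')
      by_cases hwx' : snd w = x
      · exact ⟨hchild _ hwr (by rw [← (h.par_new w hwx').1, hwx, hx1]), Or.inl hwx'⟩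
      · have h3 : ¬ (f (fst w) = b ∧ f (C.par (fst w)) ≠ b) := fun h' =>
          hx0 (by rw [← hwx, (h.par_top w hwx' h'.1 h'.2).2])
        exact ⟨hchild _ hwr (by rw [← (h.par_old w hwx' h3).1, hwx, hx1]), Or.inr h3⟩
    -- Here both maps split the edge below `b` and `f` sends `xf` to its lower end, so the edge of
    -- `C` over it is the one above `xf`: the child of `x0` is the new vertex. Otherwise the child
    -- is the old vertex over `ιf bf`.
    by_cases hcase : bf = b ∧ f xf ≠ b
    · obtain ⟨rfl, hfx⟩ := hcase
      obtain ⟨y, hy1, hy2⟩ := h.exists_new (ιf bf) (hf.inv _) (by rwa [hf.par_top])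
      have hyp := h.par_new y hy2
      rw [hy1, hf.par_top] at hyp
      have hpy : D.par y = x0 := h.ext _ _ (hyp.1.trans hx1.symm) (hyp.2.trans hx2.symm)
      have hyr : y ≠ D.root := fun h' => hx0r (by rw [← hpy, h', par_root])
      refine ⟨y, fun h' => D.par_ne hyr (hpy.trans h'.symm), hyr, hpy, fun w hw hwx => ?_, ?_⟩
      · obtain ⟨h1, h2⟩ := huniq w hw hwx
        rw [h1, hf.inv, hf.par_top] at h2
        refine h.ext _ _ (h1.trans hy1.symm) ?_
        rw [h2.resolve_right fun h' => h' ⟨rfl, hfx⟩, hy2]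
      · right
        rw [hparx0 fun h' => hfx h'.1, hx2, hf.map_new.resolve_left hfx]
    · obtain ⟨y, hy1, hy2⟩ := h.exists_old (ιf bf)
      rw [hf.inv] at hy2
      have hyx : snd y ≠ x := hy2 ▸ hg.ne_new _
      have hyp := h.par_old y hyx (by rw [hy1, hf.inv, hf.par_top]; exact hcase)
      rw [hy1, hf.par_top] at hyp
      have hpy : D.par y = x0 := h.ext _ _ (hyp.1.trans hx1.symm) (hyp.2.trans hx2.symm)
      have hyr : y ≠ D.root := fun h' => hx0r (by rw [← hpy, h', par_root])
      refine ⟨y, fun h' => D.par_ne hyr (hpy.trans h'.symm), hyr, hpy, fun w hw hwx => ?_, ?_⟩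
      · obtain ⟨h1, h2⟩ := huniq w hw hwx
        have hwx' : snd w ≠ x := fun h' => hcase (by
          have := h.of_snd_eq hg h'
          rwa [h1, hf.inv, hf.par_top] at this)
        exact h.ext _ _ (h1.trans hy1.symm) (by rw [h.snd_eq hwx', h1, hf.inv, hy2])
      · rcases hf.map_new with h3 | h3
        · left; rw [hx2, hy2, h3]
        · right
          rw [hparx0, hx2, h3]
          rintro ⟨h4, h5⟩
          rw [← h5, h3] at h4
          exact hpb h4
  · intro v hv
    rw [Set.mem_singleton_iff] at hv
    rw [hv]
    intro h'
    exact D.par_ne (fun h' => hf.new_ne_root (by rw [← hx1, h', h.fst_root])) h'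
  · intro v hv hvr
    have hv : v ≠ x0 := hv
    have hcr : fst v ≠ C.root := fun h' => hvr (h.eq_root_of_fst hf.isEpi hg h')
    by_cases hvx : snd v = x
    · obtain ⟨h1, h2⟩ := h.of_snd_eq hg hvx
      obtain ⟨h3, h4⟩ := h.par_new v hvx
      have h5 : f (C.par (fst v)) = A.par b := by
        rw [← h1]; exact (hf.isEpi.par_eq_or _).resolve_left (h1 ▸ h2)
      rw [hvx, hg.par_new]
      by_cases h6 : D.par v = x0
      · have h7 : C.par (fst v) = xf := by rw [← h3, h6, hx1]
        have h8 := hchild _ hcr h7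
        have h9 : b = bf := by rw [← h1, h8, hf.inv]
        rw [skip_of_mem _ (X := {x0}) h6, h6, hparx0, h9]
        rintro ⟨h10, -⟩
        rw [h7] at h2
        exact h2 h10
      · rw [skip_of_notMem _ (X := {x0}) h6, h4, h5]
    · have hcx := hold v hv hvx
      obtain ⟨u, hu⟩ : ∃ u, ιf u = fst v := ⟨_, hf.eq_of_ne _ hcx⟩
      have hur : u ≠ A.root := fun h' => hcr (by rw [← hu, h', hf.root])
      have hsv : snd v = ι u := by rw [h.snd_eq hvx, ← hu, hf.inv]
      by_cases h1 : f (fst v) = b ∧ f (C.par (fst v)) ≠ b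
      · obtain ⟨h3, h4⟩ := h.par_top v hvx h1.1 h1.2
        have h5 : D.par v ≠ x0 := fun h' => hx0 (h' ▸ h4)
        rw [skip_of_notMem _ (X := {x0}) h5, h4, hsv, ← hg.par_top]
        rw [← hu, hf.inv] at h1
        rw [h1.1]
      · obtain ⟨h3, h4⟩ := h.par_old v hvx h1
        rw [← hu, hf.inv] at h1
        by_cases hub : u = bf
        · subst hub
          rw [← hu, hf.par_top] at h3 h4
          rw [hf.par_top] at h1
          have h5 : D.par v = x0 := h.ext _ _ (h3.trans hx1.symm) (h4.trans hx2.symm)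
          rw [skip_of_mem _ (X := {x0}) h5, h5, hsv]
          by_cases hb : u = b
          · subst hb
            have h6 : f xf = u := by_contra fun h' => h1 ⟨rfl, h'⟩
            rw [hg.par_top, (h.par_top x0 hx0 (by rw [hx1, h6]) (by rw [hx1, hfpx]; exact hpb)).2]
          · rw [hg.par_old u hur hb, hparx0 fun h' => hb h'.2]
        · rw [hf.par_old u hur hub, hf.inv] at h1
          rw [← hu, hf.par_old u hur hub] at h3 h4
          rw [hf.inv] at h4
          have h5 : D.par v ≠ x0 := fun h' => hf.ne_new _ (by rw [← h3, h', hx1])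
          rw [skip_of_notMem _ (X := {x0}) h5, h4, hsv, hg.par_old u hur]
          rintro rfl
          exact h1 ⟨rfl, A.par_ne hur⟩
  · intro s
    by_cases hs : s = x
    · subst hs
      obtain ⟨c, hc1, hc2⟩ := hf.isEpi.exists_child hg.ne_root
      obtain ⟨v, -, hv2⟩ := h.exists_new c hc1 hc2
      exact ⟨v, fun h' => hx0 (by rw [← Set.mem_singleton_iff.1 h', hv2]), hv2⟩
    · obtain ⟨v, hv1, hv2⟩ := h.exists_old (ιf (g s))
      refine ⟨v, fun h' => hf.ne_new (g s) ?_, by rw [hv2, hf.inv, hg.eq_of_ne s hs]⟩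
      rw [← hv1, Set.mem_singleton_iff.1 h', hx1]

end IsSplitPullback

/-! ### Amalgamation of simple-confluent epimorphisms -/

theorem IsLC.pull_split {A B C : FinRootedTree} {f : C.V → A.V} {g : B.V → A.V} (hf : IsLC f)
    (hg : IsSplittingEdge g) : ∃ (D : FinRootedTree) (g' : D.V → C.V) (f' : D.V → B.V),
      f ∘ g' = g ∘ f' ∧ IsMono g' ∧ IsLC f' := by
  obtain ⟨ι, x, b, hg⟩ := hg.exists_splitData
  obtain ⟨D, fst, snd, h⟩ := hg.exists_isSplitPullback hf.isEpi
  exact ⟨D, _, snd, h.comp_eq hf.isEpi hg, (h.isLCOff_toBase hg).isMono h.injOn_toBase,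
    h.isLC_snd hf hg⟩

/-- The conclusion keeps `g'` a single splitting, not merely a composition of splittings, so that
the next factor of `f` can be treated by the same induction. -/
theorem IsMono.pull_split {A C : FinRootedTree} {f : C.V → A.V} (hf : IsMono f) :
    ∀ {B : FinRootedTree} {g : B.V → A.V}, IsSplittingEdge g →
      ∃ (D : FinRootedTree) (g' : D.V → C.V) (f' : D.V → B.V),
        f ∘ g' = g ∘ f' ∧ IsSplittingEdge g' ∧ IsMono f' := by
  induction hf with
  | split hf =>
    intro B g hg
    obtain ⟨ιf, xf, bf, hf⟩ := hf.exists_splitData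
    obtain ⟨ι, x, b, hg⟩ := hg.exists_splitData
    obtain ⟨D, fst, snd, h⟩ := hg.exists_isSplitPullback hf.isEpi
    exact ⟨D, _, snd, h.comp_eq hf.isEpi hg, h.isSplittingEdge_toBase hf hg,
      .split (h.isSplittingEdge_snd hf hg)⟩
  | iso hf hi =>
    intro B g hg
    obtain ⟨ι, x, b, hg⟩ := hg.exists_splitData
    obtain ⟨e, he1, he2⟩ := hf.exists_inverse hi
    have := hg.comp_iso (hf.of_bijective he1 he2) he2 he1
    exact ⟨B, _, id, by funext v; simp [he2], this.isSplittingEdge,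
      .iso (IsLC.id B) Function.injective_id⟩
  | comp _ _ ih1 ih2 =>
    intro B g hg
    obtain ⟨D1, g1, f1, h1, hg1, hf1⟩ := ih1 hg
    obtain ⟨D2, g2, f2, h2, hg2, hf2⟩ := ih2 hg1
    exact ⟨D2, g2, f1 ∘ f2, by rw [Function.comp_assoc, h2, ← Function.comp_assoc, h1]; rfl, hg2,
      .comp hf1 hf2⟩

theorem IsLC.pull_mono {A B : FinRootedTree} {g : B.V → A.V} (hg : IsMono g) :
    ∀ {C : FinRootedTree} {f : C.V → A.V}, IsLC f →
      ∃ (D : FinRootedTree) (g' : D.V → C.V) (f' : D.V → B.V),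
        f ∘ g' = g ∘ f' ∧ IsMono g' ∧ IsLC f' := by
  induction hg with
  | split hg => exact fun hf => hf.pull_split hg
  | iso hg hi =>
    intro C f hf
    obtain ⟨D, g', f', h, hg', hf', hi'⟩ := hf.exists_pullback hg
    exact ⟨D, g', f', h, .iso hg' (hi' hi), hf'⟩
  | comp _ _ ih1 ih2 =>
    intro C f hf
    obtain ⟨D1, g1, f1, h1, hg1, hf1⟩ := ih1 hf
    obtain ⟨D2, g2, f2, h2, hg2, hf2⟩ := ih2 hf1
    exact ⟨D2, g1 ∘ g2, f2, by
      rw [← Function.comp_assoc, h1, Function.comp_assoc, h2, Function.comp_assoc],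
      .comp hg1 hg2, hf2⟩

theorem IsMono.pull_mono {A B : FinRootedTree} {g : B.V → A.V} (hg : IsMono g) :
    ∀ {C : FinRootedTree} {f : C.V → A.V}, IsMono f →
      ∃ (D : FinRootedTree) (g' : D.V → C.V) (f' : D.V → B.V),
        f ∘ g' = g ∘ f' ∧ IsMono g' ∧ IsMono f' := by
  induction hg with
  | split hg =>
    intro C f hf
    obtain ⟨D, g', f', h, hg', hf'⟩ := hf.pull_split hg
    exact ⟨D, g', f', h, .split hg', hf'⟩
  | iso hg hi =>
    intro C f hf
    obtain ⟨e, he1, he2⟩ := hg.exists_inverse hi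
    refine ⟨C, id, e ∘ f, by funext v; simp [he2], .iso (IsLC.id C) Function.injective_id,
      .comp (.iso (hg.of_bijective he1 he2) (Function.LeftInverse.injective he2)) hf⟩
  | comp _ _ ih1 ih2 =>
    intro C f hf
    obtain ⟨D1, g1, f1, h1, hg1, hf1⟩ := ih1 hf
    obtain ⟨D2, g2, f2, h2, hg2, hf2⟩ := ih2 hf1
    exact ⟨D2, g1 ∘ g2, f2, by
      rw [← Function.comp_assoc, h1, Function.comp_assoc, h2, Function.comp_assoc],
      .comp hg1 hg2, hf2⟩

/-- Amalgamation squares are pasted along a decomposition of `f`; the side opposite to `g` keeps the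
type of `g`. -/
theorem IsSimpleConfluent.pull_mono {A C : FinRootedTree} {f : C.V → A.V}
    (hf : IsSimpleConfluent f) : ∀ {B : FinRootedTree} {g : B.V → A.V}, IsMono g →
      ∃ (D : FinRootedTree) (g' : D.V → C.V) (f' : D.V → B.V),
        f ∘ g' = g ∘ f' ∧ IsMono g' ∧ IsSimpleConfluent f' := by
  refine hf.induction_on' (P := fun C A f => ∀ {B : FinRootedTree} {g : B.V → A.V}, IsMono g →
    ∃ (D : FinRootedTree) (g' : D.V → C.V) (f' : D.V → B.V),
      f ∘ g' = g ∘ f' ∧ IsMono g' ∧ IsSimpleConfluent f') ?_ ?_ ?_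
  · intro _ _ _ hf B g hg
    obtain ⟨D, g', f', h, hg', hf'⟩ := hf.pull_mono hg
    exact ⟨D, g', f', h, hg', hf'.isSimpleConfluent⟩
  · intro _ _ _ hf B g hg
    obtain ⟨D, g', f', h, hg', hf'⟩ := hg.pull_mono hf
    exact ⟨D, g', f', h, hg', hf'.isSimpleConfluent⟩
  · intro _ _ _ _ _ ih1 ih2 B g hg
    obtain ⟨D1, g1, f1, h1, hg1, hf1⟩ := ih1 hg
    obtain ⟨D2, g2, f2, h2, hg2, hf2⟩ := ih2 hg1
    exact ⟨D2, g2, f1 ∘ f2, by rw [Function.comp_assoc, h2, ← Function.comp_assoc, h1]; rfl, hg2,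
      .comp hf1 hf2⟩

/-- As for `pull_mono`, by pasting squares: fibre products serve the light confluent factors of `f`,
and for the simple-monotone ones the mixed square is used with exchanged roles. -/
theorem IsSimpleConfluent.pull_lc {A C : FinRootedTree} {f : C.V → A.V}
    (hf : IsSimpleConfluent f) : ∀ {B : FinRootedTree} {g : B.V → A.V}, IsLC g →
      ∃ (D : FinRootedTree) (g' : D.V → C.V) (f' : D.V → B.V),
        f ∘ g' = g ∘ f' ∧ IsLC g' ∧ IsSimpleConfluent f' := by
  refine hf.induction_on' (P := fun C A f => ∀ {B : FinRootedTree} {g : B.V → A.V}, IsLC g →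
    ∃ (D : FinRootedTree) (g' : D.V → C.V) (f' : D.V → B.V),
      f ∘ g' = g ∘ f' ∧ IsLC g' ∧ IsSimpleConfluent f') ?_ ?_ ?_
  · intro _ _ _ hf B g hg
    obtain ⟨D, g', f', h, hg', hf', -⟩ := hf.exists_pullback hg
    exact ⟨D, g', f', h, hg', hf'.isSimpleConfluent⟩
  · intro _ _ _ hf B g hg
    obtain ⟨D, f', g', h, hf', hg'⟩ := hg.pull_mono hf
    exact ⟨D, g', f', h.symm, hg', hf'.isSimpleConfluent⟩
  · intro _ _ _ _ _ ih1 ih2 B g hg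
    obtain ⟨D1, g1, f1, h1, hg1, hf1⟩ := ih1 hg
    obtain ⟨D2, g2, f2, h2, hg2, hf2⟩ := ih2 hg1
    exact ⟨D2, g2, f1 ∘ f2, by rw [Function.comp_assoc, h2, ← Function.comp_assoc, h1]; rfl, hg2,
      .comp hf1 hf2⟩

end FinRootedTree

/-! ## Lifting along splitting maps and light confluent maps; collapsing a tree to an edge -/

namespace FinRootedTree

theorem IsLCOff.exists_notMem {S T : FinRootedTree} {X : Set S.V} {f : S.V → T.V}
    (h : IsLCOff X f) (b : T.V) : ∃ v, v ∉ X ∧ f v = b := by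
  induction b using T.par_induction with
  | h0 => exact ⟨_, h.root_notMem, h.map_root⟩
  | h1 b hb ih =>
    obtain ⟨v, hv, hvb⟩ := ih
    obtain ⟨w, hw, -, -, hwb⟩ := h.lift v hv b hb hvb.symm
    exact ⟨w, hw, hwb⟩

/-- A map that is a collection of splittings factors through each of them. -/
theorem IsLCOff.exists_lift {S T B : FinRootedTree} {X : Set S.V} {f : S.V → T.V}
    (h : IsLCOff X f) (hi : Set.InjOn f Xᶜ) {g : B.V → T.V} {ι : T.V → B.V} {x : B.V} {b : T.V}
    (hg : SplitData g ι x b) {x₀ y₀ : S.V} (hx₀ : x₀ ∈ X) (hy₀ : y₀ ≠ S.root)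
    (hpar : S.par y₀ = x₀) (hb : f y₀ = b) (hx : f x₀ = g x) :
    ∃ k : S.V → B.V, IsMono k ∧ g ∘ k = f := by
  classical
  obtain ⟨y, hyX, hyr, hyp, huniq, -⟩ := h.child x₀ hx₀
  obtain rfl : y₀ = y := huniq y₀ hy₀ hpar
  -- Letting `x₀` take the place of `x` makes `k` a map of the same kind as `f`, with `x₀` no longer
  -- among the vertices to be removed.
  let k : S.V → B.V := fun v => if v = x₀ then x else ι (f v)
  have hk0 : k x₀ = x := if_pos rfl
  have hk : ∀ v, v ≠ x₀ → k v = ι (f v) := fun v hv => if_neg hv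
  have hX : ∀ v, v ∉ X \ {x₀} → v ≠ x₀ → v ∉ X := fun v hv hv' hvX => hv ⟨hvX, hv'⟩
  have hneX : ∀ v, v ∉ X → v ≠ x₀ := fun v hv h' => hv (h' ▸ hx₀)
  have hinj : Set.InjOn k (X \ {x₀})ᶜ := by
    intro u hu v hv huv
    by_cases h1 : u = x₀ <;> by_cases h2 : v = x₀
    · rw [h1, h2]
    · rw [h1, hk0, hk v h2] at huv; exact absurd huv.symm (hg.ne_new _)
    · rw [h2, hk0, hk u h1] at huv; exact absurd huv (hg.ne_new _)
    · rw [hk u h1, hk v h2] at huv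
      exact hi (hX u hu h1) (hX v hv h2) (hg.injective huv)
  refine ⟨k, (IsLCOff.of_bijOn (fun h' => h.root_notMem h'.1) ?_ ?_ ?_ ?_ hinj ?_).isMono hinj, ?_⟩
  · rintro x' ⟨hx', hne⟩
    obtain ⟨y', h1, h2, h3, h4, h5⟩ := h.child x' hx'
    refine ⟨y', fun h' => h1 h'.1, h2, h3, h4, ?_⟩
    rw [hk x' hne, hk y' (hneX y' h1), hk _ (hneX _ (h.par_notMem x' hx'))]
    exact h5.imp (congrArg ι) (congrArg ι)
  · rintro x' ⟨hx', -⟩ h'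
    exact h.par_notMem x' hx' h'.1
  · rw [hk _ (hneX _ h.root_notMem), h.map_root, hg.root]
  · intro v hv hvr
    by_cases hvx : v = x₀
    · subst hvx
      have h1 := h.par_notMem v hx₀
      have h2 := h.map_par y₀ hyX hyr
      rw [skip_of_mem _ (hpar.symm ▸ hx₀), hpar, hb] at h2
      rw [skip_of_notMem _ fun h' => h1 h'.1, hk0, hk _ (hneX _ h1), ← h2, hg.par_new]
    · have hvX := hX v hv hvx
      rw [hk v hvx]
      by_cases hvb : f v = b
      · obtain rfl : v = y₀ := hi hvX hyX (hvb.trans hb.symm)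
        rw [skip_of_notMem, hpar, hk0, hb, hg.par_top]
        rw [hpar]; exact fun h' => h'.2 rfl
      · have hpv : S.par v ≠ x₀ := fun h' => hvb (by rw [huniq v hvr h', hb])
        rw [hg.par_old _ (h.ne_root v hvX hvr) hvb, h.map_par v hvX hvr]
        by_cases h1 : S.par v ∈ X
        · rw [skip_of_mem _ h1, skip_of_mem _ (X := X \ {x₀}) ⟨h1, hpv⟩,
            hk _ (hneX _ (h.par_notMem _ h1))]
        · rw [skip_of_notMem _ h1, skip_of_notMem _ (X := X \ {x₀}) fun h' => h1 h'.1, hk _ hpv]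
  · intro s
    by_cases hs : s = x
    · exact ⟨x₀, fun h' => h'.2 rfl, hk0.trans hs.symm⟩
    · obtain ⟨v, hv, hvs⟩ := h.exists_notMem (g s)
      exact ⟨v, fun h' => hv h'.1, by rw [hk v (hneX v hv), hvs, hg.eq_of_ne s hs]⟩
  · funext v
    by_cases hv : v = x₀
    · subst hv; rw [Function.comp_apply, hk0, hx]
    · rw [Function.comp_apply, hk v hv, hg.inv]

theorem exists_surjective_of_card_le {α β : Type} [Finite α] [Finite β] [Nonempty β]
    (h : Nat.card β ≤ Nat.card α) : ∃ f : α → β, Function.Surjective f := by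
  classical
  have := Fintype.ofFinite α
  have := Fintype.ofFinite β
  rw [Nat.card_eq_fintype_card, Nat.card_eq_fintype_card] at h
  obtain ⟨e⟩ := Function.Embedding.nonempty_of_card_le h
  exact ⟨Function.invFun e, Function.invFun_surjective e.injective⟩

/-- A light confluent map with large fibres factors through a given light confluent map. -/
theorem IsLC.exists_lift {S T B : FinRootedTree} {p : S.V → T.V} {g : B.V → T.V} (hp : IsLC p)
    (hg : IsLC g) (hcard : ∀ v b, b ≠ T.root → T.par b = p v →
      Nat.card B.V ≤ Nat.card {w : S.V // w ≠ S.root ∧ S.par w = v ∧ p w = b}) :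
    ∃ k : S.V → B.V, IsLC k ∧ g ∘ k = p := by
  classical
  -- Once `v` is sent to `u`, the children of `v` over each `b` can be mapped onto those of `u` over
  -- `b`, since `u` has at most `|B|` of them.
  have h1 : ∀ v u, p v = g u → ∃ κ : S.V → B.V,
      (∀ w, w ≠ S.root → S.par w = v → κ w ≠ B.root ∧ B.par (κ w) = u ∧ g (κ w) = p w) ∧
      ∀ u', u' ≠ B.root → B.par u' = u → ∃ w, w ≠ S.root ∧ S.par w = v ∧ κ w = u' := by
    intro v u hvu
    have h2 : ∀ b, b ≠ T.root → T.par b = p v →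
        ∃ σ : {w : S.V // w ≠ S.root ∧ S.par w = v ∧ p w = b} →
          {u' : B.V // u' ≠ B.root ∧ B.par u' = u ∧ g u' = b}, Function.Surjective σ := by
      intro b hb hbv
      obtain ⟨u', hu'⟩ := hg.lift u b hb (hbv.trans hvu)
      have : Nonempty {u' : B.V // u' ≠ B.root ∧ B.par u' = u ∧ g u' = b} := ⟨⟨u', hu'⟩⟩
      exact exists_surjective_of_card_le
        ((Nat.card_le_card_of_injective _ Subtype.val_injective).trans (hcard v b hb hbv))
    choose σ hσ using h2
    refine ⟨fun w => if h : w ≠ S.root ∧ S.par w = v then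
      (σ (p w) (hp.ne_root w h.1) (by rw [hp.map_par w h.1, h.2]) ⟨w, h.1, h.2, rfl⟩).1 else u,
      fun w hw hwv => ?_, fun u' hu' hu'u => ?_⟩
    · have h3 : w ≠ S.root ∧ S.par w = v := ⟨hw, hwv⟩
      simp only [dif_pos h3]
      exact (σ (p w) (hp.ne_root w h3.1) (by rw [hp.map_par w h3.1, h3.2])
        ⟨w, h3.1, h3.2, rfl⟩).2
    · obtain ⟨⟨w, hw1, hw2, hw3⟩, hw⟩ := hσ (g u') (hg.ne_root u' hu')
        (by rw [hg.map_par u' hu', hu'u, hvu]) ⟨u', hu', hu'u, rfl⟩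
      refine ⟨w, hw1, hw2, ?_⟩
      have h3 : w ≠ S.root ∧ S.par w = v := ⟨hw1, hw2⟩
      simp only [dif_pos h3]
      have key : ∀ b (hb : b = p w) h4 h5 h6,
          (σ b h4 h5 ⟨w, hw1, hw2, hb.symm⟩).1 = u' →
          (σ (p w) (hb ▸ h4) (hb ▸ h5) ⟨w, h6⟩).1 = u' := by
        rintro b rfl h4 h5 h6 h7; exact h7
      exact key _ hw3.symm _ _ _ (congrArg Subtype.val hw)
  choose! κ hκ1 hκ2 using h1
  -- The local choices are assembled by recursion on the height: the image of the parent determines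
  -- which `κ` is used at `v`.
  let aux : ℕ → S.V → B.V := fun n => Nat.rec (fun _ => B.root)
    (fun _ ih v => if v = S.root then B.root else κ (S.par v) (ih (S.par v)) v) n
  let k : S.V → B.V := fun v => aux (S.ht v) v
  have hk0 : k S.root = B.root := by simp only [k, ht_root]; rfl
  have hk : ∀ v, v ≠ S.root → k v = κ (S.par v) (k (S.par v)) v := by
    intro v hv
    simp only [k]
    rw [← S.ht_par hv]
    exact if_neg hv
  have hgk : ∀ v, p v = g (k v) := by
    intro v
    induction v using S.par_induction with
    | h0 => rw [hk0, hp.map_root, hg.map_root]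
    | h1 v hv ih => rw [hk v hv]; exact (hκ1 _ _ ih v hv rfl).2.2.symm
  refine ⟨k, ⟨hk0, fun v hv => ?_, fun v hv => ?_, fun v u hu huv => ?_⟩,
    funext fun v => (hgk v).symm⟩
  · rw [hk v hv]; exact (hκ1 _ _ (hgk _) v hv rfl).1
  · conv_lhs => rw [hk v hv]
    exact (hκ1 _ _ (hgk _) v hv rfl).2.1
  · obtain ⟨w, hw1, rfl, hw3⟩ := hκ2 v (k v) (hgk v) u hu huv
    exact ⟨w, hw1, rfl, by rw [hk w hw1, hw3]⟩

/-- The map to a tree with two vertices that maps only the root to the root. -/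
noncomputable def toEdge (A T : FinRootedTree) (a : T.V) (v : A.V) : T.V :=
  open Classical in if v = A.root then T.root else a

theorem toEdge_root (A T : FinRootedTree) (a : T.V) : toEdge A T a A.root = T.root := if_pos rfl

theorem toEdge_of_ne (A T : FinRootedTree) (a : T.V) {v : A.V} (hv : v ≠ A.root) :
    toEdge A T a v = a := if_neg hv

theorem toEdge_comp_removeVal (A T : FinRootedTree) (a : T.V) (x : A.V) (hx : x ≠ A.root)
    (hy : ∃ y, y ≠ x ∧ y ≠ A.root) :
    toEdge A T a ∘ A.removeVal x hx hy = toEdge (A.remove x hx hy) T a := by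
  funext v
  by_cases hv : v = (A.remove x hx hy).root
  · rw [hv, toEdge_root]; exact toEdge_root A T a
  · rw [toEdge_of_ne _ _ _ hv]
    exact toEdge_of_ne _ _ _ fun h => hv ((A.removeVal_eq_root x hx hy).1 h)

/-- Folding a leaf onto another leaf with the same parent. -/
theorem isLC_retract (A : FinRootedTree) {w x : A.V} (hx : x ≠ A.root) (hw : w ≠ A.root)
    (hwx : w ≠ x) (hpar : A.par w = A.par x) (hlx : ∀ u, u ≠ A.root → A.par u ≠ x)
    (hlw : ∀ u, u ≠ A.root → A.par u ≠ w) :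
    IsLC (A.retract x hx ⟨w, hwx, hw⟩ w hwx) := by
  have hlx' : ∀ u, A.par u ≠ x := fun u => by
    by_cases hu : u = A.root
    · rw [hu, par_root]; exact hx.symm
    · exact hlx u hu
  have hval : ∀ u, A.removeVal x hx ⟨w, hwx, hw⟩ ((A.remove x hx ⟨w, hwx, hw⟩).par u) =
      A.par (A.removeVal x hx ⟨w, hwx, hw⟩ u) := fun u =>
    A.removeVal_par_of_ne x hx _ u (hlx' _)
  have hroot : ∀ {u}, A.removeVal x hx ⟨w, hwx, hw⟩ u = A.root ↔
    u = (A.remove x hx ⟨w, hwx, hw⟩).root := A.removeVal_eq_root x hx _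
  refine ⟨A.retract_of_ne x hx _ w hwx hx.symm, fun u hu h => ?_, fun u hu => ?_,
    fun u b hb hbu => ?_⟩
  · rw [← hroot] at h
    by_cases hux : u = x
    · subst hux; rw [retract_self] at h; exact hw h
    · rw [A.retract_of_ne x hx _ w hwx hux] at h; exact hu h
  · apply A.removeVal_injective x hx ⟨w, hwx, hw⟩
    rw [hval, A.retract_of_ne x hx _ w hwx (hlx' u)]
    by_cases hux : u = x
    · subst hux; rw [retract_self]; exact hpar
    · rw [A.retract_of_ne x hx _ w hwx hux]; rfl
  · have hb' : A.removeVal x hx ⟨w, hwx, hw⟩ b ≠ A.root := fun h => hb (hroot.1 h)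
    have h1 := congrArg (A.removeVal x hx ⟨w, hwx, hw⟩) hbu
    rw [hval] at h1
    by_cases hux : u = x
    · subst hux
      rw [retract_self] at h1
      exact absurd h1 (hlw _ hb')
    · rw [A.retract_of_ne x hx _ w hwx hux] at h1
      refine ⟨_, hb', h1, ?_⟩
      rw [A.retract_of_ne x hx _ w hwx (A.removeVal_ne x hx _ b)]
      rfl

/-- Induct on the number of vertices, looking at a vertex `w` of maximal height. All siblings of `w`
are leaves, so a second one can be folded onto `w` by a light confluent map. If `w` is an only child
and its parent is not the root, that parent is the midpoint of a split edge and can be removed. -/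
theorem isSimpleConfluent_toEdge (A T : FinRootedTree) (a : T.V) (ha : a ≠ T.root)
    (hT : ∀ v, v = T.root ∨ v = a) : IsSimpleConfluent (toEdge A T a) := by
  induction hn : Nat.card A.V using Nat.strong_induction_on generalizing A with
  | _ n ih =>
  have : Nonempty A.V := ⟨A.root⟩
  obtain ⟨w, hw⟩ := Finite.exists_max A.ht
  have := A.nontrivial
  obtain ⟨v, hv⟩ := exists_ne A.root
  have hwr : w ≠ A.root := by
    rintro rfl
    have := hw v
    have := A.ht_par hv
    rw [ht_root] at *
    omega
  have hleaf : ∀ w', A.par w' = A.par w → w' ≠ A.root → ∀ u, u ≠ A.root → A.par u ≠ w' := by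
    intro w' hw' hw'r u hu huw
    have h1 := A.ht_par hu
    have h2 := A.ht_par hw'r
    have h3 := A.ht_par hwr
    have h4 := hw u
    rw [huw] at h1
    rw [hw'] at h2
    omega
  by_cases hpw : A.par w = A.root
  -- All non-root vertices have height one, and the map to the edge is itself light confluent.
  · have hpa : T.par a = T.root := (hT _).resolve_right (T.par_ne ha)
    refine IsLC.isSimpleConfluent ⟨toEdge_root A T a, fun v hv => ?_, fun v hv => ?_,
      fun v b hb hbv => ?_⟩
    · rwa [toEdge_of_ne _ _ _ hv]
    · have h1 : A.par v = A.root := by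
        by_contra h1
        have h2 := A.ht_par hv
        have h3 := A.ht_par h1
        have h4 := A.ht_par hwr
        have h5 := hw v
        rw [hpw, ht_root] at h4
        omega
      rw [toEdge_of_ne _ _ _ hv, h1, toEdge_root, hpa]
    · obtain rfl := (hT b).resolve_left hb
      have hvr : v = A.root := by
        by_contra h
        rw [toEdge_of_ne _ _ _ h, hpa] at hbv
        exact ha hbv.symm
      exact ⟨w, hwr, by rw [hpw, hvr], toEdge_of_ne _ _ _ hwr⟩
  · by_cases huniq : ∀ w', w' ≠ A.root → A.par w' = A.par w → w' = w
    · have hz : w ≠ A.par w := (A.par_ne hwr).symm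
      have hy : ∃ y, y ≠ A.par w ∧ y ≠ A.root := ⟨w, hz, hwr⟩
      rw [A.comp_retract (A.par w) hpw hy hz (f := toEdge A T a)
        (by rw [toEdge_of_ne _ _ _ hpw, toEdge_of_ne _ _ _ hwr]), toEdge_comp_removeVal]
      refine .comp (ih _ (hn ▸ A.card_remove _ hpw hy) _ rfl) (.mono (.split ?_))
      exact (A.splitData_retract _ hpw hy rfl hwr huniq w hz (Or.inl rfl)).isSplittingEdge
    · push Not at huniq
      obtain ⟨x, hxr, hxp, hxw⟩ := huniq
      have hy : ∃ y, y ≠ x ∧ y ≠ A.root := ⟨w, hxw.symm, hwr⟩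
      rw [A.comp_retract x hxr hy hxw.symm (f := toEdge A T a)
        (by rw [toEdge_of_ne _ _ _ hxr, toEdge_of_ne _ _ _ hwr]), toEdge_comp_removeVal]
      exact .comp (ih _ (hn ▸ A.card_remove _ hxr hy) _ rfl) (A.isLC_retract hxr hwr hxw.symm
        hxp.symm (hleaf x hxp hxr) (hleaf w rfl hwr)).isSimpleConfluent

end FinRootedTree

/-! ## The trees of a grid -/

/-- The largest element of `insert 0 C` below `t`. -/
noncomputable def cutPred (C : Finset ℝ) (t : ℝ) : ℝ :=
  (insert 0 (C.filter (· < t))).max' (Finset.insert_nonempty _ _)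

/-- The largest element of `insert 0 C` that is at most `t`. -/
noncomputable def cutFloor (C : Finset ℝ) (t : ℝ) : ℝ :=
  (insert 0 (C.filter (· ≤ t))).max' (Finset.insert_nonempty _ _)

section Cuts

variable {C : Finset ℝ} {t m : ℝ}

theorem cutPred_spec (C : Finset ℝ) (t : ℝ) :
    cutPred C t = 0 ∨ (cutPred C t ∈ C ∧ cutPred C t < t) := by
  have := Finset.max'_mem (insert 0 (C.filter (· < t))) (Finset.insert_nonempty _ _)
  rw [Finset.mem_insert, Finset.mem_filter] at this
  exact this

theorem cutPred_nonneg (C : Finset ℝ) (t : ℝ) : 0 ≤ cutPred C t :=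
  Finset.le_max' _ _ (Finset.mem_insert_self _ _)

theorem cutPred_lt (h : 0 < t) : cutPred C t < t := by
  rcases cutPred_spec C t with h' | h'
  · rwa [h']
  · exact h'.2

theorem le_cutPred (hm : m ∈ C) (h : m < t) : m ≤ cutPred C t :=
  Finset.le_max' _ _ (Finset.mem_insert_of_mem (Finset.mem_filter.2 ⟨hm, h⟩))

theorem cutPred_mem (C : Finset ℝ) (t : ℝ) : cutPred C t = 0 ∨ cutPred C t ∈ C :=
  (cutPred_spec C t).imp id And.left

theorem cutPred_eq (hm : m = 0 ∨ m ∈ C) (h0 : 0 ≤ m) (h1 : m < t) (h2 : ∀ e ∈ C, e < t → e ≤ m) :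
    cutPred C t = m := by
  refine le_antisymm ?_ (hm.elim (fun h => h ▸ cutPred_nonneg C t) fun h => le_cutPred h h1)
  rcases cutPred_spec C t with h' | h'
  · rwa [h']
  · exact h2 _ h'.1 h'.2

theorem cutFloor_spec (C : Finset ℝ) (t : ℝ) :
    cutFloor C t = 0 ∨ (cutFloor C t ∈ C ∧ cutFloor C t ≤ t) := by
  have := Finset.max'_mem (insert 0 (C.filter (· ≤ t))) (Finset.insert_nonempty _ _)
  rw [Finset.mem_insert, Finset.mem_filter] at this
  exact this

theorem cutFloor_nonneg (C : Finset ℝ) (t : ℝ) : 0 ≤ cutFloor C t :=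
  Finset.le_max' _ _ (Finset.mem_insert_self _ _)

theorem cutFloor_le (h : 0 ≤ t) : cutFloor C t ≤ t := by
  rcases cutFloor_spec C t with h' | h'
  · rwa [h']
  · exact h'.2

theorem le_cutFloor (hm : m ∈ C) (h : m ≤ t) : m ≤ cutFloor C t :=
  Finset.le_max' _ _ (Finset.mem_insert_of_mem (Finset.mem_filter.2 ⟨hm, h⟩))

theorem cutFloor_mem (C : Finset ℝ) (t : ℝ) : cutFloor C t = 0 ∨ cutFloor C t ∈ C :=
  (cutFloor_spec C t).imp id And.left

theorem cutFloor_eq (hm : m = 0 ∨ m ∈ C) (h0 : 0 ≤ m) (h1 : m ≤ t) (h2 : ∀ e ∈ C, e ≤ t → e ≤ m) :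
    cutFloor C t = m := by
  refine le_antisymm ?_ (hm.elim (fun h => h ▸ cutFloor_nonneg C t) fun h => le_cutFloor h h1)
  rcases cutFloor_spec C t with h' | h'
  · rwa [h']
  · exact h2 _ h'.1 h'.2

theorem cutFloor_self (hm : t = 0 ∨ t ∈ C) (h0 : 0 ≤ t) : cutFloor C t = t :=
  cutFloor_eq hm h0 le_rfl fun _ _ h => h

theorem cutFloor_cutFloor {C' : Finset ℝ} (h : C ⊆ C') (ht : 0 ≤ t) :
    cutFloor C (cutFloor C' t) = cutFloor C t :=
  cutFloor_eq (cutFloor_mem C t) (cutFloor_nonneg C t)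
    ((cutFloor_mem C t).elim (fun h' => h' ▸ cutFloor_nonneg C' t)
      fun h' => le_cutFloor (h h') (cutFloor_le ht))
    fun _ he h' => le_cutFloor he (h'.trans (cutFloor_le ht))

end Cuts

/-- A finite set `C ⊆ Q` of heights at which the unit interval is cut, and a finite set `J` of
indices of ramification heights, such that every piece of the interval contains at most one
ramification height, the first piece at most the height `0`, and the last piece none. -/
structure Grid (d : ℕ → ℝ) (Q : Set ℝ) where
  C : Finset ℝ
  J : Finset ℕ
  nonempty : C.Nonempty
  mem : ∀ c ∈ C, c ∈ Q
  pos : ∀ c ∈ C, 0 < c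
  nonneg : ∀ j ∈ J, 0 ≤ d j
  sep : ∀ i ∈ J, ∀ j ∈ J, d i < d j → ∃ c ∈ C, d i < c ∧ c < d j
  sep_zero : ∀ j ∈ J, 0 < d j → ∃ c ∈ C, c < d j
  sep_one : ∀ j ∈ J, ∃ c ∈ C, d j < c

namespace Grid

open FinRootedTree

variable {d : ℕ → ℝ} {Q : Set ℝ} (G G' : Grid d Q)

/-- The vertices of the tree of a grid: a lower endpoint `t` of a piece, and a choice of branches
at the ramification heights below `t`. -/
def Vert : Type :=
  {p : ℝ × Finset ℕ // (p.1 = 0 ∨ p.1 ∈ G.C) ∧ ∀ j ∈ p.2, j ∈ G.J ∧ d j < p.1}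

instance : Finite G.Vert := by
  refine Finite.of_injective (β := ((insert 0 G.C ×ˢ G.J.powerset : Finset (ℝ × Finset ℕ))))
    (fun p => ⟨p.1, ?_⟩) fun p q h => Subtype.ext (congrArg (fun x => x.1) h)
  rw [Finset.mem_product, Finset.mem_insert, Finset.mem_powerset]
  exact ⟨p.2.1, fun j hj => (p.2.2 j hj).1⟩

instance : Nontrivial G.Vert :=
  ⟨⟨⟨(0, ∅), Or.inl rfl, by simp⟩, ⟨(G.nonempty.choose, ∅), Or.inr G.nonempty.choose_spec, by simp⟩,
    fun h => (G.pos _ G.nonempty.choose_spec).ne (congrArg (fun p : G.Vert => p.1.1) h)⟩⟩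

variable {G} in
theorem Vert.eq_root (v : G.Vert) (h : v.1.1 = 0) : v = ⟨(0, ∅), Or.inl rfl, by simp⟩ := by
  refine Subtype.ext (Prod.ext h (Finset.eq_empty_of_forall_notMem fun j hj => ?_))
  obtain ⟨h1, h2⟩ := v.2.2 j hj
  have := G.nonneg j h1
  rw [h] at h2
  linarith

/-- The parent function of the tree of a grid. -/
noncomputable def parFun (v : G.Vert) : G.Vert :=
  ⟨(cutPred G.C v.1.1, v.1.2.filter (d · < cutPred G.C v.1.1)), cutPred_mem _ _, fun j hj =>
    ⟨(v.2.2 j (Finset.mem_filter.1 hj).1).1, (Finset.mem_filter.1 hj).2⟩⟩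

theorem parFun_lt (v : G.Vert) (hv : v ≠ ⟨(0, ∅), Or.inl rfl, by simp⟩) :
    (G.C.filter (· ≤ (G.parFun v).1.1)).card < (G.C.filter (· ≤ v.1.1)).card := by
  have h1 : v.1.1 ≠ 0 := fun h => hv (v.eq_root h)
  have h2 := v.2.1.resolve_left h1
  have h3 : cutPred G.C v.1.1 < v.1.1 := cutPred_lt (G.pos _ h2)
  refine Finset.card_lt_card (Finset.ssubset_iff_of_subset ?_ |>.2 ⟨v.1.1, ?_, ?_⟩)
  · exact Finset.monotone_filter_right _ fun e _ he => le_trans he h3.le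
  · exact Finset.mem_filter.2 ⟨h2, le_rfl⟩
  · exact fun h => absurd (Finset.mem_filter.1 h).2 (not_le.2 h3)

/-- The tree of a grid. -/
noncomputable def tree : FinRootedTree :=
  ofPar G.Vert ⟨(0, ∅), Or.inl rfl, by simp⟩ G.parFun
    (fun v => (G.C.filter (· ≤ v.1.1)).card) G.parFun_lt

/-- The lower endpoint of the piece of a vertex. -/
def lev (v : G.tree.V) : ℝ := Subtype.val (α := ℝ × Finset ℕ) v |>.1

/-- The choice of branches of a vertex. -/
def br (v : G.tree.V) : Finset ℕ := Subtype.val (α := ℝ × Finset ℕ) v |>.2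

/-- The vertex with a given lower endpoint and choice of branches. -/
def vert (t : ℝ) (σ : Finset ℕ) (ht : t = 0 ∨ t ∈ G.C) (hσ : ∀ j ∈ σ, j ∈ G.J ∧ d j < t) :
    G.tree.V := (⟨(t, σ), ht, hσ⟩ : G.Vert)

variable {G G'}

@[simp] theorem lev_vert {t σ ht hσ} : G.lev (G.vert t σ ht hσ) = t := rfl

@[simp] theorem br_vert {t σ ht hσ} : G.br (G.vert t σ ht hσ) = σ := rfl

theorem ext {u v : G.tree.V} (h1 : G.lev u = G.lev v) (h2 : ∀ j, j ∈ G.br u ↔ j ∈ G.br v) :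
    u = v := Subtype.ext (Prod.ext h1 (Finset.ext h2))

theorem lev_mem (v : G.tree.V) : G.lev v = 0 ∨ G.lev v ∈ G.C :=
  Subtype.prop (p := fun p : ℝ × Finset ℕ =>
    (p.1 = 0 ∨ p.1 ∈ G.C) ∧ ∀ j ∈ p.2, j ∈ G.J ∧ d j < p.1) v |>.1

theorem of_mem_br {v : G.tree.V} {j : ℕ} (hj : j ∈ G.br v) : j ∈ G.J ∧ d j < G.lev v :=
  (Subtype.prop (p := fun p : ℝ × Finset ℕ =>
    (p.1 = 0 ∨ p.1 ∈ G.C) ∧ ∀ j ∈ p.2, j ∈ G.J ∧ d j < p.1) v).2 j hj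

theorem lev_nonneg (v : G.tree.V) : 0 ≤ G.lev v :=
  (lev_mem v).elim (fun h => h.ge) fun h => (G.pos _ h).le

@[simp] theorem lev_root : G.lev G.tree.root = 0 := rfl

theorem eq_root {v : G.tree.V} (h : G.lev v = 0) : v = G.tree.root := Vert.eq_root v h

theorem lev_pos {v : G.tree.V} (h : v ≠ G.tree.root) : 0 < G.lev v :=
  (lev_nonneg v).lt_of_ne fun h' => h (eq_root h'.symm)

theorem lev_mem_C {v : G.tree.V} (h : v ≠ G.tree.root) : G.lev v ∈ G.C :=
  (lev_mem v).resolve_left (lev_pos h).ne'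

theorem ne_root {v : G.tree.V} (h : 0 < G.lev v) : v ≠ G.tree.root := fun h' => by
  rw [h', lev_root] at h; exact lt_irrefl _ h

theorem par_eq_parFun {v : G.tree.V} (hv : v ≠ G.tree.root) : G.tree.par v = G.parFun v :=
  ofPar_par G.Vert ⟨(0, ∅), Or.inl rfl, by simp⟩ G.parFun
    (fun v => (G.C.filter (· ≤ v.1.1)).card) G.parFun_lt hv

theorem lev_par {v : G.tree.V} (hv : v ≠ G.tree.root) :
    G.lev (G.tree.par v) = cutPred G.C (G.lev v) := by
  rw [par_eq_parFun hv]; rfl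

theorem mem_br_par {v : G.tree.V} (hv : v ≠ G.tree.root) {j : ℕ} :
    j ∈ G.br (G.tree.par v) ↔ j ∈ G.br v ∧ d j < cutPred G.C (G.lev v) := by
  rw [par_eq_parFun hv]; exact Finset.mem_filter

/-- The projection to the tree of a coarser grid. -/
noncomputable def proj (G' G : Grid d Q) (v : G'.tree.V) : G.tree.V :=
  G.vert (cutFloor G.C (G'.lev v))
    ((G'.br v).filter fun j => j ∈ G.J ∧ d j < cutFloor G.C (G'.lev v))
    (cutFloor_mem _ _) fun _ hj => (Finset.mem_filter.1 hj).2

@[simp] theorem lev_proj (v : G'.tree.V) : G.lev (proj G' G v) = cutFloor G.C (G'.lev v) := rfl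

theorem mem_br_proj {v : G'.tree.V} {j : ℕ} : j ∈ G.br (proj G' G v) ↔
    j ∈ G'.br v ∧ j ∈ G.J ∧ d j < cutFloor G.C (G'.lev v) := Finset.mem_filter

theorem proj_root : proj G' G G'.tree.root = G.tree.root :=
  eq_root (by rw [lev_proj, lev_root, cutFloor_self (Or.inl rfl) le_rfl])

theorem proj_comp_proj {G'' : Grid d Q} (hC : G.C ⊆ G'.C) (hJ : G.J ⊆ G'.J) :
    proj G' G ∘ proj G'' G' = proj G'' G := by
  funext v
  have h1 : cutFloor G.C (cutFloor G'.C (G''.lev v)) = cutFloor G.C (G''.lev v) :=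
    cutFloor_cutFloor hC (lev_nonneg v)
  have h2 : cutFloor G.C (cutFloor G'.C (G''.lev v)) ≤ cutFloor G'.C (G''.lev v) :=
    cutFloor_le (cutFloor_nonneg _ _)
  refine ext (by simpa using h1) fun j => ?_
  simp only [Function.comp_apply, mem_br_proj, lev_proj, h1]
  rw [h1] at h2
  constructor
  · rintro ⟨⟨h3, -, -⟩, h4, h5⟩; exact ⟨h3, h4, h5⟩
  · rintro ⟨h3, h4, h5⟩; exact ⟨⟨h3, hJ h4, h5.trans_le h2⟩, h4, h5⟩

theorem proj_self : proj G G = id := by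
  funext v
  have h1 := cutFloor_self (lev_mem v) (lev_nonneg v)
  refine ext h1 fun j => ?_
  rw [mem_br_proj, h1]
  exact ⟨fun h => h.1, fun h => ⟨h, of_mem_br h⟩⟩

/-- With the cuts unchanged, levels are preserved and only choices at the additional indices are
forgotten. A child `b` of the image of `v` is lifted by uniting the choices made at `v` and at `b`.
-/
theorem isLC_proj (hC : G'.C = G.C) (hJ : G.J ⊆ G'.J) : IsLC (proj G' G) := by
  have hlev : ∀ v, G.lev (proj G' G v) = G'.lev v := fun v => by
    rw [lev_proj, cutFloor_self (hC ▸ lev_mem v) (lev_nonneg v)]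
  have hbr : ∀ v j, j ∈ G.br (proj G' G v) ↔ j ∈ G'.br v ∧ j ∈ G.J := fun v j => by
    rw [mem_br_proj, ← lev_proj, hlev]
    exact ⟨fun h => ⟨h.1, h.2.1⟩, fun h => ⟨h.1, h.2, (of_mem_br h.1).2⟩⟩
  have hne : ∀ v, v ≠ G'.tree.root → proj G' G v ≠ G.tree.root := fun v hv =>
    ne_root (by rw [hlev]; exact lev_pos hv)
  refine ⟨proj_root, hne, fun v hv => ?_, fun v b hb hbv => ?_⟩
  · refine ext (by rw [lev_par (hne v hv), hlev, hlev, lev_par hv, hC]) fun j => ?_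
    rw [mem_br_par (hne v hv), hbr, hbr, mem_br_par hv, hlev, hC]
    tauto
  · have h1 := lev_par hb
    have h2 := lev_pos hb
    have h3 : cutPred G.C (G.lev b) < G.lev b := cutPred_lt h2
    rw [hbv, hlev] at h1
    have h4 : ∀ j ∈ G'.br v ∪ G.br b, j ∈ G'.J ∧ d j < G.lev b := by
      intro j hj
      rcases Finset.mem_union.1 hj with hj | hj
      · exact ⟨(of_mem_br hj).1, (of_mem_br hj).2.trans (h1 ▸ h3)⟩
      · exact ⟨hJ (of_mem_br hj).1, (of_mem_br hj).2⟩
    have h5 : ∀ j, j ∈ G.br b → d j < G'.lev v → j ∈ G'.br v := fun j hj hjv => by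
      have : j ∈ G.br (G.tree.par b) := (mem_br_par hb).2 ⟨hj, h1 ▸ hjv⟩
      rw [hbv, hbr] at this
      exact this.1
    have h6 : ∀ j, j ∈ G'.br v → j ∈ G.J → j ∈ G.br b := fun j hj hjv => by
      have : j ∈ G.br (G.tree.par b) := by rw [hbv, hbr]; exact ⟨hj, hjv⟩
      exact ((mem_br_par hb).1 this).1
    have hw : G'.vert (G.lev b) (G'.br v ∪ G.br b) (hC ▸ lev_mem b) h4 ≠ G'.tree.root :=
      ne_root h2
    refine ⟨_, hw, ext ?_ fun j => ?_, ext ?_ fun j => ?_⟩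
    · rw [lev_par hw, lev_vert, hC, h1]
    · rw [mem_br_par hw, br_vert, lev_vert, hC, ← h1, Finset.mem_union]
      have := @of_mem_br _ _ G' v j
      have := h5 j
      tauto
    · rw [hlev, lev_vert]
    · rw [hbr, br_vert, Finset.mem_union]
      have := @of_mem_br _ _ G b j
      have := h6 j
      tauto

/-! ### Adding a cut -/

section AddCut

variable {c : ℝ}

theorem par_ext {H : Grid d Q} {u v : H.tree.V} (hu : u ≠ H.tree.root)
    (h1 : cutPred H.C (H.lev u) = H.lev v)
    (h2 : ∀ j, j ∈ H.br v ↔ j ∈ H.br u ∧ d j < H.lev v) : H.tree.par u = v :=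
  ext ((lev_par hu).trans h1) fun j => by rw [mem_br_par hu, h2, h1]

theorem lev_proj_insert (hC : G'.C = insert c G.C) {v : G'.tree.V} (hv : G'.lev v ≠ c) :
    G.lev (proj G' G v) = G'.lev v := by
  have := lev_mem v
  rw [hC, Finset.mem_insert] at this
  rw [lev_proj, cutFloor_self (by tauto) (lev_nonneg v)]

theorem mem_br_proj_insert (hJ : G'.J = G.J) {v : G'.tree.V} {j : ℕ} :
    j ∈ G.br (proj G' G v) ↔ j ∈ G'.br v ∧ d j < G.lev (proj G' G v) := by
  rw [mem_br_proj, lev_proj]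
  have := @of_mem_br _ _ G' v j
  rw [hJ] at this
  tauto

/-- The cut `c` is just below the cut `c₁`. -/
theorem isLCOff_proj_below (hC : G'.C = insert c G.C) (hJ : G'.J = G.J) (hc : c ∉ G.C) {c₁ : ℝ}
    (hc₁ : c₁ ∈ G.C) (hcc₁ : c < c₁) (h1 : ∀ e ∈ G.C, e < c₁ → e < c)
    (h2 : ∀ j ∈ G.J, d j < c₁ → d j < c) :
    IsLCOff {v | G'.lev v = c} (proj G' G) ∧ Set.InjOn (proj G' G) {v | G'.lev v = c}ᶜ := by
  have hcC : c ∈ G'.C := by simp [hC]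
  have hc0 : 0 < c := G'.pos c hcC
  have hsub : ∀ {e}, e ∈ G.C → e ∈ G'.C := fun he => by rw [hC]; exact Finset.mem_insert_of_mem he
  have hC' : ∀ {e}, e ∈ G'.C → e ≠ c → e ∈ G.C := fun he hec => by
    rw [hC, Finset.mem_insert] at he; tauto
  have hpred : cutPred G'.C c₁ = c := cutPred_eq (Or.inr hcC) hc0.le hcc₁ fun e he hec => by
    by_cases h : e = c
    · exact h.le
    · exact (h1 e (hC' he h) hec).le
  have hpred' : ∀ {t}, t ∈ G'.C → t ≠ c → t ≠ c₁ → cutPred G'.C t = cutPred G.C t := by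
    intro t ht htc htc₁
    refine cutPred_eq ((cutPred_mem _ _).imp id hsub) (cutPred_nonneg _ _)
      (cutPred_lt (G'.pos t ht)) fun e he het => ?_
    by_cases h : e = c
    · subst h
      have h3 : c₁ < t := lt_of_le_of_ne (by
        by_contra h3
        exact absurd (h1 t (hC' ht htc) (not_le.1 h3)) (not_lt.2 het.le)) htc₁.symm
      exact hcc₁.le.trans (le_cutPred hc₁ h3)
    · exact le_cutPred (hC' he h) het
  have hpredc : cutPred G.C c₁ = cutPred G'.C c := by
    have h3 : cutPred G'.C c < c := cutPred_lt hc0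
    refine cutPred_eq ((cutPred_mem _ _).imp id fun h => hC' h h3.ne) (cutPred_nonneg _ _)
      (h3.trans hcc₁) fun e he hec => le_cutPred (hsub he) (h1 e he hec)
  have hfloorc : cutFloor G.C c = cutPred G'.C c := by
    have h3 : cutPred G'.C c < c := cutPred_lt hc0
    refine cutFloor_eq ((cutPred_mem _ _).imp id fun h => hC' h h3.ne) (cutPred_nonneg _ _)
      h3.le fun e he hec => le_cutPred (hsub he) (lt_of_le_of_ne hec fun h => hc (h ▸ he))
  have hbr : ∀ v, G'.lev v ≠ c → ∀ j, j ∈ G.br (proj G' G v) ↔ j ∈ G'.br v := fun v hv j => by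
    rw [mem_br_proj_insert hJ, lev_proj_insert hC hv]
    exact ⟨fun h => h.1, fun h => ⟨h, (of_mem_br h).2⟩⟩
  have hinj : Set.InjOn (proj G' G) {v | G'.lev v = c}ᶜ := by
    intro u hu v hv huv
    refine ext ?_ fun j => ?_
    · rw [← lev_proj_insert hC hu, ← lev_proj_insert hC hv, huv]
    · rw [← hbr u hu, ← hbr v hv, huv]
  have hpar : ∀ v, G'.lev v = c → G'.lev (G'.tree.par v) < c := fun v hv => by
    have : v ≠ G'.tree.root := ne_root (hv ▸ hc0)
    rw [lev_par this, hv]; exact cutPred_lt hc0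
  -- No kept ramification height lies in `[c, c₁)`, so a vertex at level `c` has one child, at level
  -- `c₁` and with the same choices. It is projected to the image of its parent.
  refine ⟨.of_bijOn (fun h => hc0.ne (by simpa using h)) ?_ (fun v hv => (hpar v hv).ne) proj_root
    ?_ hinj ?_, hinj⟩
  · intro v hv
    have hv : G'.lev v = c := hv
    have hvr : v ≠ G'.tree.root := ne_root (hv ▸ hc0)
    have hyr : G'.vert c₁ (G'.br v) (Or.inr (hsub hc₁)) (fun j hj =>
        ⟨(of_mem_br hj).1, (of_mem_br hj).2.trans (hv ▸ hcc₁)⟩) ≠ G'.tree.root :=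
      ne_root (hc0.trans hcc₁)
    refine ⟨_, hcc₁.ne', hyr, par_ext hyr (by rw [lev_vert, hpred, hv]) fun j => ?_,
      fun w hw hwv => ?_, Or.inr (ext ?_ fun j => ?_)⟩
    · exact ⟨fun h => ⟨h, (of_mem_br h).2⟩, fun h => h.1⟩
    · have h3 := lev_par hw
      rw [hwv, hv] at h3
      have h4 : cutPred G'.C (G'.lev w) < G'.lev w := cutPred_lt (lev_pos hw)
      have h5 : G'.lev w = c₁ := by
        by_contra h5
        have h6 := hpred' (lev_mem_C hw) (h3 ▸ h4.ne') h5
        rcases cutPred_mem G.C (G'.lev w) with h7 | h7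
        · rw [h7, ← h3] at h6; exact hc0.ne' h6
        · rw [← h6, ← h3] at h7; exact hc h7
      refine ext h5 fun j => ?_
      rw [br_vert, ← hwv, mem_br_par hw, ← h3]
      refine ⟨fun h => ⟨h, h2 j (hJ ▸ (of_mem_br h).1) (h5 ▸ (of_mem_br h).2)⟩, fun h => h.1⟩
    · rw [lev_proj_insert hC (hpar v hv).ne, lev_proj, hv, hfloorc, lev_par hvr, hv]
    · rw [hbr _ (hpar v hv).ne, mem_br_proj_insert hJ, lev_proj, hv, hfloorc, mem_br_par hvr, hv]
  · intro v hv hvr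
    have hv : G'.lev v ≠ c := hv
    have hpr : proj G' G v ≠ G.tree.root := ne_root (by
      rw [lev_proj_insert hC hv]; exact lev_pos hvr)
    by_cases hv1 : G'.lev v = c₁
    · have h3 : G'.lev (G'.tree.par v) = c := by rw [lev_par hvr, hv1, hpred]
      have h4 : G'.tree.par v ≠ G'.tree.root := ne_root (h3 ▸ hc0)
      have h5 := hpar _ h3
      rw [skip_of_mem _ (X := {v | G'.lev v = c}) h3]
      have h6 : G'.lev (G'.tree.par (G'.tree.par v)) = cutPred G'.C c := by rw [lev_par h4, h3]
      refine par_ext hpr ?_ fun j => ?_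
      · rw [lev_proj_insert hC hv, lev_proj_insert hC h5.ne, h6, hv1, hpredc]
      · rw [hbr _ h5.ne, hbr _ hv, lev_proj_insert hC h5.ne, h6, mem_br_par h4, h3, mem_br_par hvr,
          hv1, hpred]
        have : d j < cutPred G'.C c → d j < c := fun h => h.trans (cutPred_lt hc0)
        tauto
    · have h3 := hpred' (lev_mem_C hvr) hv hv1
      have h4 : G'.lev (G'.tree.par v) ≠ c := by
        rw [lev_par hvr, h3]
        rintro rfl
        rcases cutPred_mem G.C (G'.lev v) with h7 | h7
        · exact hc0.ne' h7
        · exact hc h7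
      rw [skip_of_notMem _ (X := {v | G'.lev v = c}) h4]
      refine par_ext hpr ?_ fun j => ?_
      · rw [lev_proj_insert hC hv, lev_proj_insert hC h4, lev_par hvr, h3]
      · rw [hbr _ h4, hbr _ hv, lev_proj_insert hC h4, mem_br_par hvr, lev_par hvr]
  · intro b
    have hbc : G.lev b ≠ c := fun h => by
      rcases lev_mem b with h3 | h3
      · exact hc0.ne' (h.symm.trans h3)
      · exact hc (h ▸ h3)
    refine ⟨G'.vert (G.lev b) (G.br b) ((lev_mem b).imp id hsub) (fun j hj => by
      rw [hJ]; exact of_mem_br hj), hbc, ext ?_ fun j => ?_⟩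
    · exact lev_proj_insert hC hbc
    · rw [hbr, br_vert]; exact hbc

/-- The cut `c` is just above the cut `c₀`. -/
theorem isLCOff_proj_above (hC : G'.C = insert c G.C) (hJ : G'.J = G.J) (hc : c ∉ G.C) {c₀ : ℝ}
    (hc₀ : c₀ ∈ G.C) (hcc₀ : c₀ < c) (h1 : ∀ e ∈ G.C, c₀ < e → c < e)
    (h2 : ∀ j ∈ G.J, d j < c → d j < c₀) :
    IsLCOff {v | G'.lev v = c₀} (proj G' G) ∧ Set.InjOn (proj G' G) {v | G'.lev v = c₀}ᶜ := by
  have hcC : c ∈ G'.C := by simp [hC]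
  have hc0 : 0 < c := G'.pos c hcC
  have hc00 : 0 < c₀ := G.pos _ hc₀
  have hsub : ∀ {e}, e ∈ G.C → e ∈ G'.C := fun he => by rw [hC]; exact Finset.mem_insert_of_mem he
  have hC' : ∀ {e}, e ∈ G'.C → e ≠ c → e ∈ G.C := fun he hec => by
    rw [hC, Finset.mem_insert] at he; tauto
  have hpredc : cutPred G'.C c = c₀ :=
    cutPred_eq (Or.inr (hsub hc₀)) hc00.le hcc₀ fun e he hec => by
      by_contra h
      exact absurd (h1 e (hC' he hec.ne) (not_le.1 h)) (not_lt.2 hec.le)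
  have hfloorc : cutFloor G.C c = c₀ :=
    cutFloor_eq (Or.inr hc₀) hc00.le hcc₀.le fun e he hec => by
      by_contra h
      exact absurd (h1 e he (not_le.1 h)) (not_lt.2 hec)
  have hpred : ∀ {t}, 0 < t → cutPred G'.C t ≠ c → cutPred G'.C t = cutPred G.C t := by
    intro t ht htc
    exact (cutPred_eq ((cutPred_mem _ _).imp id fun h => hC' h htc) (cutPred_nonneg _ _)
      (cutPred_lt ht) fun e he het => le_cutPred (hsub he) het).symm
  have hpred' : ∀ {t}, 0 < t → cutPred G'.C t = c → cutPred G.C t = c₀ := by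
    intro t ht htc
    have h3 : cutPred G'.C t < t := cutPred_lt ht
    refine cutPred_eq (Or.inr hc₀) hc00.le (hcc₀.trans (htc ▸ h3)) fun e he het => ?_
    by_contra h
    exact absurd (h1 e he (not_le.1 h)) (not_lt.2 (htc ▸ le_cutPred (hsub he) het))
  have hpred₀ : ∀ {t}, t ∈ G'.C → cutPred G'.C t = c₀ → t = c := by
    intro t ht htc
    have h3 : cutPred G'.C t < t := cutPred_lt (G'.pos t ht)
    by_contra h
    exact absurd (htc ▸ le_cutPred hcC (h1 t (hC' ht h) (htc ▸ h3))) (not_le.2 hcc₀)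
  have hlevc : ∀ v, G'.lev v = c → G.lev (proj G' G v) = c₀ := fun v hv => by
    rw [lev_proj, hv, hfloorc]
  have hbr : ∀ v j, j ∈ G.br (proj G' G v) ↔ j ∈ G'.br v := fun v j => by
    rw [mem_br_proj_insert hJ]
    refine ⟨fun h => h.1, fun h => ⟨h, ?_⟩⟩
    by_cases hv : G'.lev v = c
    · rw [hlevc v hv]; exact h2 j (hJ ▸ (of_mem_br h).1) (hv ▸ (of_mem_br h).2)
    · rw [lev_proj_insert hC hv]; exact (of_mem_br h).2
  have hlev : ∀ u v, G'.lev u ≠ c₀ → G'.lev v ≠ c₀ →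
      G.lev (proj G' G u) = G.lev (proj G' G v) → G'.lev u = G'.lev v := by
    intro u v hu hv huv
    by_cases hu' : G'.lev u = c <;> by_cases hv' : G'.lev v = c
    · rw [hu', hv']
    · rw [hlevc u hu', lev_proj_insert hC hv'] at huv; exact absurd huv.symm hv
    · rw [hlevc v hv', lev_proj_insert hC hu'] at huv; exact absurd huv hu
    · rwa [lev_proj_insert hC hu', lev_proj_insert hC hv'] at huv
  have hinj : Set.InjOn (proj G' G) {v | G'.lev v = c₀}ᶜ := by
    intro u hu v hv huv
    refine ext (hlev u v hu hv (by rw [huv])) fun j => ?_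
    rw [← hbr u, ← hbr v, huv]
  have hpar : ∀ v, G'.lev v = c₀ → G'.lev (G'.tree.par v) < c₀ := fun v hv => by
    have : v ≠ G'.tree.root := ne_root (hv ▸ hc00)
    rw [lev_par this, hv]; exact cutPred_lt hc00
  -- Levels `c₀` and `c` both project to `c₀`. The vertices to be removed are those at level `c₀`:
  -- they have one child each, whereas there may be ramification above `c`.
  refine ⟨.of_bijOn (fun h => hc00.ne (by simpa using h)) ?_ (fun v hv => (hpar v hv).ne) proj_root
    ?_ hinj ?_, hinj⟩
  · intro v hv
    have hv : G'.lev v = c₀ := hv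
    have hvr : v ≠ G'.tree.root := ne_root (hv ▸ hc00)
    have hyr : G'.vert c (G'.br v) (Or.inr hcC) (fun j hj =>
        ⟨(of_mem_br hj).1, (of_mem_br hj).2.trans (hv ▸ hcc₀)⟩) ≠ G'.tree.root := ne_root hc0
    refine ⟨_, hcc₀.ne', hyr, par_ext hyr (by rw [lev_vert, hpredc, hv]) fun j => ?_,
      fun w hw hwv => ?_, Or.inl (ext ?_ fun j => ?_)⟩
    · exact ⟨fun h => ⟨h, (of_mem_br h).2⟩, fun h => h.1⟩
    · have h3 := lev_par hw
      rw [hwv, hv] at h3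
      have h5 := hpred₀ (lev_mem_C hw) h3.symm
      refine ext h5 fun j => ?_
      rw [br_vert, ← hwv, mem_br_par hw, ← h3]
      exact ⟨fun h => ⟨h, h2 j (hJ ▸ (of_mem_br h).1) (h5 ▸ (of_mem_br h).2)⟩, fun h => h.1⟩
    · rw [lev_proj_insert hC (hv ▸ hcc₀.ne), hlevc _ lev_vert, hv]
    · rw [hbr, hbr, br_vert]
  · intro v hv hvr
    have hv : G'.lev v ≠ c₀ := hv
    by_cases hvc : G'.lev v = c
    · have h3 : G'.lev (G'.tree.par v) = c₀ := by rw [lev_par hvr, hvc, hpredc]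
      have h4 : G'.tree.par v ≠ G'.tree.root := ne_root (h3 ▸ hc00)
      have h5 := hpar _ h3
      have h6 : G'.lev (G'.tree.par (G'.tree.par v)) = cutPred G'.C c₀ := by rw [lev_par h4, h3]
      have h7 : cutPred G'.C c₀ = cutPred G.C c₀ := hpred hc00 fun h =>
        absurd (cutPred_lt hc00) (not_lt.2 (h ▸ hcc₀.le))
      have hpr : proj G' G v ≠ G.tree.root := ne_root (by rw [hlevc v hvc]; exact hc00)
      have h8 : G.lev (proj G' G (G'.tree.par (G'.tree.par v))) = cutPred G.C c₀ := by
        rw [lev_proj_insert hC (h5.trans hcc₀).ne, h6, h7]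
      rw [skip_of_mem _ (X := {v | G'.lev v = c₀}) h3]
      refine par_ext hpr ?_ fun j => ?_
      · rw [hlevc v hvc, h8]
      · rw [hbr, hbr, h8, mem_br_par h4, h3, mem_br_par hvr, hvc, hpredc, h7]
        have : d j < cutPred G.C c₀ → d j < c₀ := fun h => h.trans (cutPred_lt hc00)
        tauto
    · have hpr : proj G' G v ≠ G.tree.root := ne_root (by
        rw [lev_proj_insert hC hvc]; exact lev_pos hvr)
      have h3 : G'.lev (G'.tree.par v) ≠ c₀ := by
        rw [lev_par hvr]; exact fun h => hvc (hpred₀ (lev_mem_C hvr) h)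
      have h4 : cutPred G.C (G'.lev v) = G.lev (proj G' G (G'.tree.par v)) := by
        by_cases h5 : cutPred G'.C (G'.lev v) = c
        · rw [hpred' (lev_pos hvr) h5, hlevc]
          rw [lev_par hvr, h5]
        · rw [lev_proj_insert hC, lev_par hvr, hpred (lev_pos hvr) h5]
          rwa [lev_par hvr]
      rw [skip_of_notMem _ (X := {v | G'.lev v = c₀}) h3]
      refine par_ext hpr ?_ fun j => ?_
      · rw [lev_proj_insert hC hvc, h4]
      · rw [mem_br_proj_insert hJ, hbr, mem_br_par hvr, ← h4]
        refine ⟨fun h => ⟨h.1.1, h.2⟩, fun h => ⟨⟨h.1, h.2.trans_le ?_⟩, h.2⟩⟩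
        rcases cutPred_spec G.C (G'.lev v) with h5 | h5
        · rw [h5]; exact cutPred_nonneg _ _
        · exact le_cutPred (hsub h5.1) h5.2
  · intro b
    by_cases hb : G.lev b = c₀
    · refine ⟨G'.vert c (G.br b) (Or.inr hcC) (fun j hj => by
        rw [hJ]; exact ⟨(of_mem_br hj).1, (of_mem_br hj).2.trans (hb ▸ hcc₀)⟩), hcc₀.ne',
        ext ?_ fun j => ?_⟩
      · rw [hlevc _ lev_vert, hb]
      · rw [hbr, br_vert]
    · have hbc : G.lev b ≠ c := fun h => by
        rcases lev_mem b with h3 | h3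
        · exact hc0.ne' (h.symm.trans h3)
        · exact hc (h ▸ h3)
      refine ⟨G'.vert (G.lev b) (G.br b) ((lev_mem b).imp id hsub) (fun j hj => by
        rw [hJ]; exact of_mem_br hj), hb, ext ?_ fun j => ?_⟩
      · exact lev_proj_insert hC hbc
      · rw [hbr, br_vert]

end AddCut

end Grid

/-! ### Cut sets and refinement of grids -/

/-- A dense set of heights that avoids the ramification heights. -/
structure IsCutSet (d : ℕ → ℝ) (Q : Set ℝ) : Prop where
  pos : ∀ c ∈ Q, 0 < c
  lt_one : ∀ c ∈ Q, c < 1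
  ne : ∀ c ∈ Q, ∀ j, d j ≠ c
  dense : ∀ a b : ℝ, 0 ≤ a → a < b → b ≤ 1 → ∃ c ∈ Q, a < c ∧ c < b

namespace IsCutSet

variable {d : ℕ → ℝ} {Q : Set ℝ}

theorem exists_below (h : IsCutSet d Q) (F : Finset ℝ) {t : ℝ} (h0 : 0 < t) (h1 : t ≤ 1) :
    ∃ c ∈ Q, c < t ∧ ∀ e ∈ F, e < t → e < c := by
  obtain ⟨c, hc, h2, h3⟩ := h.dense (cutPred F t) t (cutPred_nonneg _ _) (cutPred_lt h0) h1
  exact ⟨c, hc, h3, fun e he het => (le_cutPred he het).trans_lt h2⟩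

theorem exists_above (h : IsCutSet d Q) (F : Finset ℝ) {t : ℝ} (h0 : 0 ≤ t) (h1 : t < 1) :
    ∃ c ∈ Q, t < c ∧ ∀ e ∈ F, t < e → c < e := by
  set b := (insert 1 (F.filter (t < ·))).min' (Finset.insert_nonempty _ _) with hb
  have h2 : t < b := by
    rw [hb, Finset.lt_min'_iff]
    intro e he
    rcases Finset.mem_insert.1 he with rfl | he
    · exact h1
    · exact (Finset.mem_filter.1 he).2
  obtain ⟨c, hc, h3, h4⟩ := h.dense t b h0 h2 (Finset.min'_le _ _ (Finset.mem_insert_self _ _))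
  exact ⟨c, hc, h3, fun e he het => h4.trans_le
    (Finset.min'_le _ _ (Finset.mem_insert_of_mem (Finset.mem_filter.2 ⟨he, het⟩)))⟩

end IsCutSet

namespace Grid

open FinRootedTree

variable {d : ℕ → ℝ} {Q : Set ℝ} {G G' G'' : Grid d Q}

/-- The grid with more cuts. -/
noncomputable def addCuts (h : IsCutSet d Q) (G : Grid d Q) (E : Finset ℝ) (hE : ∀ c ∈ E, c ∈ Q) :
    Grid d Q where
  C := E ∪ G.C
  J := G.J
  nonempty := G.nonempty.mono Finset.subset_union_right
  mem c hc := (Finset.mem_union.1 hc).elim (hE c) (G.mem c)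
  pos c hc := (Finset.mem_union.1 hc).elim (fun hc => h.pos c (hE c hc)) (G.pos c)
  nonneg := G.nonneg
  sep i hi j hj hij := (G.sep i hi j hj hij).imp fun _ h => ⟨Finset.mem_union_right _ h.1, h.2⟩
  sep_zero j hj h0 := (G.sep_zero j hj h0).imp fun _ h => ⟨Finset.mem_union_right _ h.1, h.2⟩
  sep_one j hj := (G.sep_one j hj).imp fun _ h => ⟨Finset.mem_union_right _ h.1, h.2⟩

/-- The piece containing `c` has at most one ramification height. If that height is below `c`, there
is no ramification up to the next cut, and `c` may be regarded as just below that cut; otherwise `c`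
may be regarded as just above the preceding cut. The conditions at both ends of the interval provide
the cut that is needed. -/
theorem isMono_proj_insert (h : IsCutSet d Q) {c : ℝ} (hc : c ∈ Q) (hcG : c ∉ G.C)
    (hC : G'.C = insert c G.C) (hJ : G'.J = G.J) : IsMono (proj G' G) := by
  have hc0 := h.pos c hc
  set c₀ := cutFloor G.C c with hc₀
  -- The hypothesis says that no ramification height lies between `c` and the first cut above it,
  -- without naming that cut.
  have below : ∀ c₁' ∈ G.C, c < c₁' → (∀ e ∈ G.C, c < e → ∀ j ∈ G.J, d j < e →
      (∃ e' ∈ G.C, c < e' ∧ e' < d j) ∨ d j < c) → IsMono (proj G' G) := by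
    intro c₁' hc₁' hcc₁' hj
    have hne : (G.C.filter (c < ·)).Nonempty := ⟨c₁', Finset.mem_filter.2 ⟨hc₁', hcc₁'⟩⟩
    obtain ⟨hc₁, hcc₁⟩ := Finset.mem_filter.1 (Finset.min'_mem _ hne)
    have hmin : ∀ e ∈ G.C, c < e → (G.C.filter (c < ·)).min' hne ≤ e := fun e he hce =>
      Finset.min'_le _ _ (Finset.mem_filter.2 ⟨he, hce⟩)
    obtain ⟨h1, h2⟩ := isLCOff_proj_below hC hJ hcG hc₁ hcc₁ (fun e he hec => by
      by_contra h3
      have h4 : c < e := lt_of_le_of_ne (not_lt.1 h3) fun h4 => hcG (h4 ▸ he)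
      exact absurd (hmin e he h4) (not_le.2 hec)) (fun j hj' hjc => by
      rcases hj _ hc₁ hcc₁ j hj' hjc with ⟨e, he, h3, h4⟩ | h3
      · exact absurd (hmin e he h3) (not_le.2 (h4.trans hjc))
      · exact h3)
    exact h1.isMono h2
  have hgt : ∀ e ∈ G.C, c₀ < e → c < e := fun e he h1 => by
    by_contra h2
    exact absurd (le_cutFloor he (not_lt.1 h2)) (not_le.2 h1)
  by_cases hA : ∃ j ∈ G.J, c₀ ≤ d j ∧ d j < c
  · obtain ⟨j, hj, h1, h2⟩ := hA
    obtain ⟨e, he, h3⟩ := G.sep_one j hj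
    refine below e he (hgt e he (h1.trans_lt h3)) fun e he hce i hi hie => ?_
    by_cases h4 : d i < c
    · exact Or.inr h4
    · obtain ⟨e', he', h5, h6⟩ := G.sep j hj i hi (h2.trans_le (not_lt.1 h4))
      exact Or.inl ⟨e', he', hgt e' he' (h1.trans_lt h5), h6⟩
  · push Not at hA
    -- In the first piece there is no positive cut below `c`, but its only possible ramification
    -- height is `0`, so the argument from below applies.
    rcases cutFloor_mem G.C c with h0 | h0
    · obtain ⟨e, he⟩ := G.nonempty
      have hgt' : ∀ e ∈ G.C, c < e := fun e he => hgt e he (by rw [hc₀, h0]; exact G.pos e he)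
      refine below e he (hgt' e he) fun e he hce i hi hie => ?_
      by_cases h4 : d i < c
      · exact Or.inr h4
      · obtain ⟨e', he', h6⟩ := G.sep_zero i hi (hc0.trans_le (not_lt.1 h4))
        exact Or.inl ⟨e', he', hgt' e' he', h6⟩
    · have h1 : c₀ < c := lt_of_le_of_ne (cutFloor_le hc0.le) fun h1 => hcG (h1 ▸ h0)
      obtain ⟨h1, h2⟩ := isLCOff_proj_above hC hJ hcG h0 h1 hgt fun j hj hjc => by
        by_contra h2
        exact absurd hjc (not_lt.2 (hA j hj (not_lt.1 h2)))
      exact h1.isMono h2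

theorem isMono_proj_addCuts (h : IsCutSet d Q) (G : Grid d Q) (E : Finset ℝ)
    (hE : ∀ c ∈ E, c ∈ Q) : IsMono (proj (G.addCuts h E hE) G) := by
  induction E using Finset.induction_on with
  | empty =>
    have h1 : G.addCuts h ∅ hE = G := by
      cases G; simp [addCuts]
    rw [h1, proj_self]
    exact .iso (IsLC.id _) Function.injective_id
  | insert c E hc ih =>
    have hE' : ∀ c ∈ E, c ∈ Q := fun e he => hE e (Finset.mem_insert_of_mem he)
    by_cases hcC : c ∈ (G.addCuts h E hE').C
    · have h1 : G.addCuts h (insert c E) hE = G.addCuts h E hE' := by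
        simp only [addCuts, mk.injEq, and_true]
        rw [Finset.insert_union]
        exact Finset.insert_eq_of_mem hcC
      rw [h1]
      exact ih hE'
    · rw [← proj_comp_proj (G' := G.addCuts h E hE') (G'' := G.addCuts h (insert c E) hE)
        Finset.subset_union_right subset_rfl]
      refine .comp (ih hE') (isMono_proj_insert h (hE c (Finset.mem_insert_self _ _)) hcC ?_ rfl)
      exact Finset.insert_union _ _ _

/-- Factor the projection through the grid with all the cuts of `G'` and only the indices of `G`:
forgetting indices is light confluent, forgetting cuts is a composition of splittings and
isomorphisms. -/
theorem isSimpleConfluent_proj (h : IsCutSet d Q) (hC : G.C ⊆ G'.C) (hJ : G.J ⊆ G'.J) :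
    IsSimpleConfluent (proj G' G) := by
  rw [← proj_comp_proj (G' := G.addCuts h G'.C G'.mem) (G'' := G') Finset.subset_union_right
    subset_rfl]
  exact .comp (isMono_proj_addCuts h G _ _).isSimpleConfluent
    (isLC_proj (G := G.addCuts h G'.C G'.mem) (Finset.union_eq_left.2 hC).symm hJ).isSimpleConfluent

/-! ### The extension property for the trees of grids -/

/-- The vertices at levels `t` and `y` with the choices of `b` are a split vertex and its child over
`b`; the former can take the role of `x`. -/
theorem exists_lift_of_isLCOff {B : FinRootedTree} {g : B.V → G.tree.V}
    {ι : G.tree.V → B.V} {x : B.V} {b : G.tree.V} (hg : SplitData g ι x b) (hJ : G'.J = G.J)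
    {t y : ℝ} (hLC : IsLCOff {v | G'.lev v = t} (proj G' G))
    (hi : Set.InjOn (proj G' G) {v | G'.lev v = t}ᶜ) (ht : t ∈ G'.C) (hy : y ∈ G'.C)
    (hty : t < y) (hpred : cutPred G'.C y = t) (hfloor : cutFloor G.C y = G.lev b)
    (hbt : ∀ j ∈ G.br b, d j < t)
    (hx : ∀ x₀, G'.lev x₀ = t → (∀ j, j ∈ G'.br x₀ ↔ j ∈ G.br b) → proj G' G x₀ = g x) :
    ∃ k : G'.tree.V → B.V, IsMono k ∧ g ∘ k = proj G' G := by
  let y₀ : G'.tree.V := G'.vert y (G.br b) (Or.inr hy) fun j hj =>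
    ⟨hJ ▸ (of_mem_br hj).1, (hbt j hj).trans hty⟩
  let x₀ : G'.tree.V := G'.vert t (G.br b) (Or.inr ht) fun j hj =>
    ⟨hJ ▸ (of_mem_br hj).1, hbt j hj⟩
  have hy₀ : y₀ ≠ G'.tree.root := ne_root ((G'.pos t ht).trans hty)
  refine hLC.exists_lift hi hg (x₀ := x₀) (y₀ := y₀) rfl hy₀ (par_ext hy₀ hpred fun j => ?_)
    (ext hfloor fun j => ?_) (hx x₀ rfl fun j => Iff.rfl)
  · exact ⟨fun h => ⟨h, hbt j h⟩, fun h => h.1⟩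
  · rw [mem_br_proj, lev_vert, hfloor]
    exact ⟨fun h => h.1, fun h => ⟨h, (of_mem_br h).1, (of_mem_br h).2⟩⟩

/-- A splitting edge map onto the tree of a grid is dominated by a grid with one more cut. -/
theorem exists_lift_split (h : IsCutSet d Q) (G : Grid d Q) {B : FinRootedTree}
    {g : B.V → G.tree.V} (hg : IsSplittingEdge g) : ∃ G' : Grid d Q, G.C ⊆ G'.C ∧ G.J = G'.J ∧
      ∃ k : G'.tree.V → B.V, IsMono k ∧ g ∘ k = proj G' G := by
  classical
  obtain ⟨ι, x, b, hg⟩ := hg.exists_splitData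
  have hb0 := lev_pos hg.ne_root
  have hbC := lev_mem_C hg.ne_root
  have hbQ := G.mem _ hbC
  have hins : ∀ c (hc : c ∈ Q), ∃ G' : Grid d Q, G'.C = insert c G.C ∧ G'.J = G.J := fun c hc =>
    ⟨G.addCuts h {c} (by simpa using hc), (Finset.insert_eq _ _).symm, rfl⟩
  rcases hg.map_new with hx | hx
  -- Here `x` is mapped to `b`, so the piece of `b` is divided just above its lower endpoint and its
  -- lower part plays `x`.
  · obtain ⟨c, hc, hbc, hF⟩ := h.exists_above (G.C ∪ G.J.image d) (lev_nonneg b)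
      (h.lt_one _ hbQ)
    obtain ⟨G', hC', hJ'⟩ := hins c hc
    have hcG : c ∉ G.C := fun hcG => lt_irrefl _ (hF c (Finset.mem_union_left _ hcG) hbc)
    have hJ : ∀ j ∈ G.J, d j < c → d j < G.lev b := fun j hj hjc => by
      by_contra h1
      have h2 : G.lev b < d j := lt_of_le_of_ne (not_lt.1 h1) (h.ne _ hbQ j).symm
      exact absurd (hF _ (Finset.mem_union_right _ (Finset.mem_image_of_mem d hj)) h2)
        (not_lt.2 hjc.le)
    have hC : ∀ e ∈ G.C, G.lev b < e → c < e := fun e he => hF e (Finset.mem_union_left _ he)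
    have hle : ∀ e ∈ G.C, e ≤ c → e ≤ G.lev b := fun e he hec => by
      by_contra h1
      exact absurd (hC e he (not_le.1 h1)) (not_lt.2 hec)
    have hbC' : G.lev b ∈ G'.C := hC' ▸ Finset.mem_insert_of_mem hbC
    obtain ⟨h1, h2⟩ := isLCOff_proj_above hC' hJ' hcG hbC hbc hC hJ
    refine ⟨G', hC' ▸ Finset.subset_insert _ _, hJ'.symm,
      exists_lift_of_isLCOff hg hJ' h1 h2 hbC' (hC' ▸ Finset.mem_insert_self _ _) hbc
      (cutPred_eq (Or.inr hbC') (lev_nonneg b) hbc fun e he hec => ?_)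
      (cutFloor_eq (Or.inr hbC) (lev_nonneg b) hbc.le hle) (fun j hj => (of_mem_br hj).2)
      fun x₀ h3 h4 => ?_⟩
    · rw [hC'] at he
      rcases Finset.mem_insert.1 he with rfl | he
      · exact absurd hec (lt_irrefl _)
      · exact hle e he hec.le
    · rw [hx]
      refine ext ?_ fun j => ?_
      · rw [lev_proj, h3, cutFloor_self (lev_mem b) (lev_nonneg b)]
      · rw [mem_br_proj, h3, cutFloor_self (lev_mem b) (lev_nonneg b), h4]
        have := @of_mem_br _ _ G b j
        tauto
  -- Here `x` is mapped to the parent of `b`, so that parent's piece is divided just below its upper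
  -- end and its top part plays `x`.
  · obtain ⟨c, hc, hcb, hF⟩ := h.exists_below (G.C ∪ G.J.image d) hb0 (h.lt_one _ hbQ).le
    obtain ⟨G', hC', hJ'⟩ := hins c hc
    have hc0 := h.pos c hc
    have hcG : c ∉ G.C := fun hcG => lt_irrefl _ (hF c (Finset.mem_union_left _ hcG) hcb)
    have hJ : ∀ j ∈ G.J, d j < G.lev b → d j < c := fun j hj =>
      hF _ (Finset.mem_union_right _ (Finset.mem_image_of_mem d hj))
    have hC : ∀ e ∈ G.C, e < G.lev b → e < c := fun e he => hF e (Finset.mem_union_left _ he)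
    have hfl : cutFloor G.C c = cutPred G.C (G.lev b) := by
      refine (cutPred_eq (cutFloor_mem _ _) (cutFloor_nonneg _ _)
        ((cutFloor_le hc0.le).trans_lt hcb) fun e he heb => le_cutFloor he (hC e he heb).le).symm
    have hpr : cutPred G.C (G.lev b) < c := by
      rcases cutPred_spec G.C (G.lev b) with h1 | h1
      · rw [h1]; exact hc0
      · exact hC _ h1.1 h1.2
    have hcC' : c ∈ G'.C := hC' ▸ Finset.mem_insert_self _ _
    obtain ⟨h1, h2⟩ := isLCOff_proj_below hC' hJ' hcG hbC hcb hC hJ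
    refine ⟨G', hC' ▸ Finset.subset_insert _ _, hJ'.symm,
      exists_lift_of_isLCOff hg hJ' h1 h2 hcC' (hC' ▸ Finset.mem_insert_of_mem hbC) hcb
      (cutPred_eq (Or.inr hcC') hc0.le hcb fun e he heb => ?_)
      (cutFloor_self (lev_mem b) (lev_nonneg b)) (fun j hj => hJ j (of_mem_br hj).1 (of_mem_br hj).2)
      fun x₀ h3 h4 => ?_⟩
    · rw [hC'] at he
      rcases Finset.mem_insert.1 he with rfl | he
      · exact le_rfl
      · exact (hC e he heb).le
    · rw [hx]
      refine ext ?_ fun j => ?_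
      · rw [lev_proj, h3, hfl, lev_par hg.ne_root]
      · rw [mem_br_proj, h3, hfl, mem_br_par hg.ne_root, h4]
        have := @of_mem_br _ _ G b j
        tauto

/-- A light confluent map onto the tree of a grid is dominated by a grid with more ramification. -/
theorem exists_lift_lc (h : IsCutSet d Q) (hd : IsMNSequence d) (G : Grid d Q) {B : FinRootedTree}
    {g : B.V → G.tree.V} (hg : IsLC g) : ∃ G' : Grid d Q, G.C = G'.C ∧ G.J ⊆ G'.J ∧
      ∃ k : G'.tree.V → B.V, IsLC k ∧ g ∘ k = proj G' G := by
  classical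
  obtain ⟨hd1, hd2, ⟨n₀, hn₀⟩, hd3⟩ := hd
  have hpl : ∀ t ∈ G.C, cutPred G.C t < t := fun t ht => cutPred_lt (G.pos t ht)
  -- Choose one admissible height for the piece that ends at `t`: the one already present if there
  -- is any, otherwise `0` in the first piece, and elsewhere any value of `d` in the piece, by
  -- density.
  have hval : ∀ t ∈ G.C, ∃ i, cutPred G.C t ≤ d i ∧ d i < t ∧ (cutPred G.C t = 0 → d i = 0) ∧
      ∀ j ∈ G.J, cutPred G.C t ≤ d j → d j < t → d j = d i := by
    intro t ht
    by_cases h1 : ∃ i ∈ G.J, cutPred G.C t ≤ d i ∧ d i < t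
    · obtain ⟨i, hi, h2, h3⟩ := h1
      have key : ∀ i ∈ G.J, ∀ j ∈ G.J, cutPred G.C t ≤ d i → d j < t → ¬ d i < d j := by
        intro i hi j hj h2 h4 h5
        obtain ⟨e, he, h6, h7⟩ := G.sep i hi j hj h5
        exact absurd (le_cutPred he (h7.trans h4)) (not_le.2 (h2.trans_lt h6))
      refine ⟨i, h2, h3, fun h4 => ?_, fun j hj h4 h5 => ?_⟩
      · by_contra h5
        obtain ⟨e, he, h6⟩ := G.sep_zero i hi ((G.nonneg i hi).lt_of_ne (Ne.symm h5))
        have := le_cutPred he (h6.trans h3)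
        have := G.pos e he
        linarith
      · exact le_antisymm (not_lt.1 (key i hi j hj h2 h5)) (not_lt.1 (key j hj i hi h4 h3))
    · push Not at h1
      by_cases h2 : cutPred G.C t = 0
      · exact ⟨n₀, by rw [h2, hn₀], by rw [hn₀]; exact G.pos t ht, fun _ => hn₀,
          fun j hj h3 h4 => absurd h4 (not_lt.2 (h1 j hj h3))⟩
      · have h3 : (cutPred G.C t + t) / 2 ∈ Set.Ico (0 : ℝ) 1 := by
          have := cutPred_nonneg G.C t
          have := hpl t ht
          have := h.lt_one t (G.mem t ht)
          constructor <;> linarith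
        obtain ⟨_, ⟨h4, h5⟩, i, rfl⟩ := mem_closure_iff.1 (hd2 h3) (Set.Ioo (cutPred G.C t) t)
          isOpen_Ioo ⟨by linarith [hpl t ht], by linarith [hpl t ht]⟩
        exact ⟨i, h4.le, h5, fun h => absurd h h2,
          fun j hj h3 h4 => absurd h4 (not_lt.2 (h1 j hj h3))⟩
  choose! i hi1 hi2 hi3 hi4 using hval
  -- Each value of `d` has infinitely many indices, so `|B|` unused ones are available; this is the
  -- number of children that `IsLC.exists_lift` asks for.
  have hN : ∀ t, ∃ N : Finset ℕ, N.card = Nat.card B.V ∧ ∀ m ∈ N, m ∉ G.J ∧ d m = d (i t) := by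
    intro t
    have hinf : {m | d m = d (i t)}.Infinite := by
      refine Set.infinite_of_not_bddAbove ?_
      rintro ⟨M, hM⟩
      have : ∃ m, d m = d (i t) ∧ ∀ m', d m' = d (i t) → m' ≤ m := by
        have hbdd : BddAbove {m | d m = d (i t)} := ⟨M, hM⟩
        exact ⟨_, Nat.sSup_mem (s := {m | d m = d (i t)}) ⟨i t, rfl⟩ hbdd, fun m' hm' => le_csSup hbdd hm'⟩
      obtain ⟨m, hm, hmax⟩ := this
      obtain ⟨m', h1, h2⟩ := hd3 m
      exact absurd (hmax m' (h2.trans hm)) (not_le.2 h1)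
    obtain ⟨N, hN1, hN2⟩ := (hinf.sdiff G.J.finite_toSet).exists_subset_card_eq (Nat.card B.V)
    exact ⟨N, hN2, fun m hm => ⟨(hN1 hm).2, (hN1 hm).1⟩⟩
  choose N hN1 hN2 using hN
  -- All indices that are now kept in one piece share its chosen height, which gives the separation
  -- conditions of the new grid.
  have hJ' : ∀ j ∈ G.J ∪ G.C.biUnion N, ∃ t ∈ G.C, cutPred G.C t ≤ d j ∧ d j < t ∧
      d j = d (i t) := by
    intro j hj
    rcases Finset.mem_union.1 hj with hj | hj
    · have hne : (G.C.filter (d j < ·)).Nonempty := (G.sep_one j hj).imp fun e he =>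
        Finset.mem_filter.2 he
      obtain ⟨h1, h2⟩ := Finset.mem_filter.1 (Finset.min'_mem _ hne)
      have h3 : cutPred G.C ((G.C.filter (d j < ·)).min' hne) ≤ d j := by
        rcases cutPred_spec G.C ((G.C.filter (d j < ·)).min' hne) with h3 | h3
        · rw [h3]; exact G.nonneg j hj
        · by_contra h4
          exact absurd h3.2 (not_lt.2 (Finset.min'_le _ _ (Finset.mem_filter.2
            ⟨h3.1, not_le.1 h4⟩)))
      exact ⟨_, h1, h3, h2, hi4 _ h1 j hj h3 h2⟩
    · obtain ⟨t, ht, hjt⟩ := Finset.mem_biUnion.1 hj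
      have h1 := (hN2 t j hjt).2
      exact ⟨t, ht, h1 ▸ hi1 t ht, h1 ▸ hi2 t ht, h1⟩
  let G' : Grid d Q :=
    { C := G.C
      J := G.J ∪ G.C.biUnion N
      nonempty := G.nonempty
      mem := G.mem
      pos := G.pos
      nonneg := fun j _ => (hd1 j).1
      sep := by
        intro j hj k hk hjk
        obtain ⟨t, ht, h1, h2, h3⟩ := hJ' j hj
        obtain ⟨s, hs, h4, h5, h6⟩ := hJ' k hk
        have h7 : ¬ s ≤ t := fun h7 => by
          rcases h7.lt_or_eq with h7 | h7
          · exact absurd ((h5.trans_le (le_cutPred hs h7)).trans_le h1) (not_lt.2 hjk.le)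
          · rw [h3, h6, h7] at hjk; exact lt_irrefl _ hjk
        exact ⟨t, ht, h2, lt_of_le_of_ne ((le_cutPred ht (not_le.1 h7)).trans h4)
          (h.ne t (G.mem t ht) k).symm⟩
      sep_zero := by
        intro j hj h0
        obtain ⟨t, ht, h1, h2, h3⟩ := hJ' j hj
        rcases cutPred_mem G.C t with h4 | h4
        · rw [h3, hi3 t ht h4] at h0; exact absurd h0 (lt_irrefl _)
        · exact ⟨_, h4, lt_of_le_of_ne h1 (h.ne _ (G.mem _ h4) j).symm⟩
      sep_one := fun j hj => by
        obtain ⟨t, ht, -, h2, -⟩ := hJ' j hj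
        exact ⟨t, ht, h2⟩ }
  have hJsub : G.J ⊆ G'.J := Finset.subset_union_left
  refine ⟨G', rfl, hJsub, (isLC_proj (G := G) (G' := G') rfl hJsub).exists_lift hg fun v b hb hbv => ?_⟩
  have hbC := lev_mem_C hb
  have hlev : ∀ v, G.lev (proj G' G v) = G'.lev v := fun v =>
    cutFloor_self (lev_mem v) (lev_nonneg v)
  have h1 := lev_par hb
  rw [hbv, hlev] at h1
  have h2 := hpl _ hbC
  have h3 : ∀ j, j ∈ G.br b → d j < G'.lev v → j ∈ G'.br v := fun j hj hjv => by
    have : j ∈ G.br (G.tree.par b) := (mem_br_par hb).2 ⟨hj, h1 ▸ hjv⟩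
    rw [hbv] at this
    exact (mem_br_proj.1 this).1
  have h4 : ∀ j, j ∈ G'.br v → j ∈ G.J → j ∈ G.br b := fun j hj hjv => by
    have : j ∈ G.br (G.tree.par b) := by
      rw [hbv, mem_br_proj, ← lev_proj, hlev]
      exact ⟨hj, hjv, (of_mem_br hj).2⟩
    exact ((mem_br_par hb).1 this).1
  have hNv : ∀ m ∈ N (G.lev b), m ∉ G.J ∧ m ∈ G'.J ∧ d m < G.lev b ∧ ¬ d m < G'.lev v := by
    intro m hm
    obtain ⟨h5, h6⟩ := hN2 _ m hm
    rw [h6, h1]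
    exact ⟨h5, Finset.mem_union_right _ (Finset.mem_biUnion.2 ⟨_, hbC, hm⟩), hi2 _ hbC,
      not_lt.2 (hi1 _ hbC)⟩
  have hw : ∀ m ∈ N (G.lev b), ∀ j ∈ insert m (G'.br v ∪ G.br b), j ∈ G'.J ∧ d j < G.lev b := by
    intro m hm j hj
    rcases Finset.mem_insert.1 hj with rfl | hj
    · exact ⟨(hNv j hm).2.1, (hNv j hm).2.2.1⟩
    rcases Finset.mem_union.1 hj with hj | hj
    · exact ⟨(of_mem_br hj).1, (of_mem_br hj).2.trans (h1 ▸ h2)⟩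
    · exact ⟨hJsub (of_mem_br hj).1, (of_mem_br hj).2⟩
  -- Choosing the second copy at a single new index `m` gives a child of `v` over `b`, and different
  -- `m` give different children.
  let w : N (G.lev b) → G'.tree.V := fun m =>
    G'.vert (G.lev b) (insert m.1 (G'.br v ∪ G.br b)) (Or.inr hbC) (hw m.1 m.2)
  have hwr : ∀ m, w m ≠ G'.tree.root := fun m => ne_root (G.pos _ hbC)
  have hwp : ∀ m, w m ≠ G'.tree.root ∧ G'.tree.par (w m) = v ∧ proj G' G (w m) = b := by
    intro m
    have h5 := hNv m.1 m.2
    refine ⟨hwr m, par_ext (hwr m) h1.symm fun j => ?_, ext (hlev _) fun j => ?_⟩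
    · rw [br_vert, Finset.mem_insert, Finset.mem_union]
      have := @of_mem_br _ _ G' v j
      have := h3 j
      by_cases h6 : j = m.1
      · subst h6; tauto
      · tauto
    · rw [mem_br_proj, br_vert, Finset.mem_insert, Finset.mem_union, ← lev_proj, hlev, lev_vert]
      have := @of_mem_br _ _ G b j
      have := h4 j
      by_cases h6 : j = m.1
      · subst h6; tauto
      · tauto
  have hinj : Function.Injective (fun m : N (G.lev b) => (⟨w m, hwp m⟩ :
      {u : G'.tree.V // u ≠ G'.tree.root ∧ G'.tree.par u = v ∧ proj G' G u = b})) := by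
    intro m m' hmm
    have h5 : m.1 ∈ G'.br (w m') := by
      have h6 : w m = w m' := congrArg Subtype.val hmm
      rw [← h6]; exact Finset.mem_insert_self _ _
    rw [br_vert, Finset.mem_insert, Finset.mem_union] at h5
    have h6 := hNv m.1 m.2
    have := @of_mem_br _ _ G' v m.1
    have := @of_mem_br _ _ G b m.1
    exact Subtype.ext (by tauto)
  have := Nat.card_le_card_of_injective _ hinj
  rwa [Nat.card_eq_finsetCard, hN1] at this

/-- A splitting of `A` pulled back along `f` is a single splitting of `G.tree`, which one new cut
dominates. Composites are treated by iterating on finer grids. -/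
theorem exists_lift_mono (h : IsCutSet d Q) {A B : FinRootedTree} {g : B.V → A.V}
    (hg : IsMono g) : ∀ (G : Grid d Q) {f : G.tree.V → A.V}, IsMono f →
      ∃ G' : Grid d Q, G.C ⊆ G'.C ∧ G.J = G'.J ∧
        ∃ k : G'.tree.V → B.V, IsMono k ∧ g ∘ k = f ∘ proj G' G := by
  induction hg with
  | split hg =>
    intro G f hf
    obtain ⟨D, g', f', h1, hg', hf'⟩ := hf.pull_split hg
    obtain ⟨G', hC, hJ, k, hk1, hk2⟩ := exists_lift_split h G hg'
    exact ⟨G', hC, hJ, f' ∘ k, .comp hf' hk1, by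
      rw [← hk2, ← Function.comp_assoc, ← h1, Function.comp_assoc]⟩
  | iso hg hi =>
    intro G f hf
    obtain ⟨e, he1, he2⟩ := hg.exists_inverse hi
    refine ⟨G, subset_rfl, rfl, e ∘ f,
      .comp (.iso (hg.of_bijective he1 he2) (Function.LeftInverse.injective he2)) hf, ?_⟩
    funext v
    simp [he2, proj_self]
  | comp _ _ ih1 ih2 =>
    intro G f hf
    obtain ⟨G1, hC1, hJ1, k1, hk1, h1⟩ := ih1 G hf
    obtain ⟨G2, hC2, hJ2, k2, hk2, h2⟩ := ih2 G1 hk1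
    refine ⟨G2, hC1.trans hC2, hJ1.trans hJ2, k2, hk2, ?_⟩
    rw [Function.comp_assoc, h2, ← Function.comp_assoc, h1, Function.comp_assoc,
      proj_comp_proj hC1 hJ1.subset]

/-- The extension property for the trees of grids. -/
theorem exists_lift (h : IsCutSet d Q) (hd : IsMNSequence d) {A B : FinRootedTree}
    {g : B.V → A.V} (hg : IsSimpleConfluent g) : ∀ (G : Grid d Q) {f : G.tree.V → A.V},
      IsSimpleConfluent f → ∃ G' : Grid d Q, G.C ⊆ G'.C ∧ G.J ⊆ G'.J ∧
        ∃ k : G'.tree.V → B.V, IsSimpleConfluent k ∧ g ∘ k = f ∘ proj G' G := by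
  refine hg.induction_on' (P := fun B A g => ∀ (G : Grid d Q) {f : G.tree.V → A.V},
      IsSimpleConfluent f → ∃ G' : Grid d Q, G.C ⊆ G'.C ∧ G.J ⊆ G'.J ∧
        ∃ k : G'.tree.V → B.V, IsSimpleConfluent k ∧ g ∘ k = f ∘ proj G' G) ?_ ?_ ?_
  · intro _ _ _ hg G f hf
    obtain ⟨D, g', f', h1, hg', hf'⟩ := hf.pull_lc hg
    obtain ⟨G', hC, hJ, k, hk1, hk2⟩ := exists_lift_lc h hd G hg'
    exact ⟨G', hC.subset, hJ, f' ∘ k, .comp hf' hk1.isSimpleConfluent, by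
      rw [← hk2, ← Function.comp_assoc, ← h1, Function.comp_assoc]⟩
  · intro _ _ _ hg G f hf
    obtain ⟨D, g', f', h1, hg', hf'⟩ := hf.pull_mono hg
    -- The pullback has already moved the problem to `G.tree`, so the map from the grid is the
    -- identity here.
    obtain ⟨G', hC, hJ, k, hk1, hk2⟩ := exists_lift_mono h hg' G
      (.iso (IsLC.id _) Function.injective_id)
    refine ⟨G', hC, hJ.subset, f' ∘ k, .comp hf' hk1.isSimpleConfluent, ?_⟩
    rw [Function.id_comp] at hk2
    rw [← hk2, ← Function.comp_assoc, ← h1, Function.comp_assoc]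
  · intro _ _ _ _ _ ih1 ih2 G f hf
    obtain ⟨G1, hC1, hJ1, k1, hk1, h1⟩ := ih1 G hf
    obtain ⟨G2, hC2, hJ2, k2, hk2, h2⟩ := ih2 G1 hk1
    refine ⟨G2, hC1.trans hC2, hJ1.trans hJ2, k2, hk2, ?_⟩
    rw [Function.comp_assoc, h2, ← Function.comp_assoc, h1, Function.comp_assoc,
      proj_comp_proj hC1 hJ1]

/-- Every tree is the image of the tree of a grid. -/
theorem exists_onto (h : IsCutSet d Q) (hd : IsMNSequence d) (A : FinRootedTree) :
    ∃ (G : Grid d Q) (k : G.tree.V → A.V), IsSimpleConfluent k := by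
  obtain ⟨c, hc, -, -⟩ := h.dense 0 1 le_rfl one_pos le_rfl
  let G : Grid d Q :=
    { C := {c}
      J := ∅
      nonempty := ⟨c, Finset.mem_singleton_self c⟩
      mem := fun e he => Finset.mem_singleton.1 he ▸ hc
      pos := fun e he => Finset.mem_singleton.1 he ▸ h.pos c hc
      nonneg := by simp
      sep := by simp
      sep_zero := by simp
      sep_one := by simp }
  have hbr : ∀ (v : G.tree.V) j, j ∉ G.br v := fun v j hj => Finset.notMem_empty j (of_mem_br hj).1
  let a : G.tree.V := G.vert c ∅ (Or.inr (Finset.mem_singleton_self c)) (by simp)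
  have ha : a ≠ G.tree.root := ne_root (h.pos c hc)
  -- With one cut and no indices the tree of the grid is an edge, onto which `A` maps; lifting the
  -- identity of that edge yields a map onto `A`.
  obtain ⟨G', -, -, k, hk, -⟩ := exists_lift h hd (isSimpleConfluent_toEdge A G.tree a ha fun v => by
    rcases lev_mem v with hv | hv
    · exact Or.inl (eq_root hv)
    · exact Or.inr (ext (Finset.mem_singleton.1 hv) fun j => by simp [hbr v j, a])) G
    (IsLC.id _).isSimpleConfluent
  exact ⟨G', k, hk⟩

end Grid

/-! ## Uniqueness of the projective Fraïssé limit -/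

/-- Points at which compatible coordinates have prescribed values exist by compactness. -/
theorem exists_forall_of_compact {X : Type*} [TopologicalSpace X] [CompactSpace X]
    (s : ℕ → Set X) (hclosed : ∀ n, IsClosed (s n)) (hne : ∀ n, (s n).Nonempty)
    (hanti : ∀ n, s (n + 1) ⊆ s n) : ∃ x, ∀ n, x ∈ s n := by
  obtain ⟨x, hx⟩ := IsCompact.nonempty_iInter_of_sequence_nonempty_isCompact_isClosed s hanti hne
    (hclosed 0).isCompact hclosed
  exact ⟨x, Set.mem_iInter.1 hx⟩

namespace InvSeq

section General

variable {𝓕 : TreeFamily}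

/-- The sequence without its first term. -/
def tail (S : InvSeq 𝓕) : InvSeq 𝓕 where
  obj n := S.obj (n + 1)
  map n := S.map (n + 1)
  mem n := S.mem (n + 1)

/-- Dropping the first term reduces to coordinate `0`, from which preimages are chosen recursively.
-/
theorem proj_surjective (S : InvSeq 𝓕) (n : ℕ) : Function.Surjective (S.proj n) := by
  intro v
  induction n generalizing S with
  | zero =>
    have hs : ∀ n, Function.Surjective (S.map n) := fun n => (𝓕.isEpi (S.mem n)).surj
    let x : ∀ n, (S.obj n).V := fun n =>
      Nat.rec (motive := fun n => (S.obj n).V) v (fun n w => (hs n w).choose) n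
    exact ⟨⟨x, fun n => (hs n (x n)).choose_spec⟩, rfl⟩
  | succ n ih =>
    obtain ⟨y, hy⟩ := ih S.tail v
    let x : ∀ n, (S.obj n).V := fun n =>
      Nat.casesOn (motive := fun n => (S.obj n).V) n (S.map 0 (y.1 0)) y.1
    refine ⟨⟨x, fun n => ?_⟩, hy⟩
    cases n with
    | zero => rfl
    | succ n => exact y.2 n

theorem map_proj (S : InvSeq 𝓕) (n : ℕ) (x : S.lim.V) :
    S.map n (S.proj (n + 1) x) = S.proj n x := x.2 n

theorem lim_ext (S : InvSeq 𝓕) {x y : S.lim.V} (h : ∀ n, S.proj n x = S.proj n y) : x = y :=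
  Subtype.ext (funext h)

theorem continuous_proj (S : InvSeq 𝓕) (n : ℕ) : Continuous (S.proj n) :=
  (continuous_apply n).comp continuous_subtype_val

theorem surjective_of_forall_proj (S : InvSeq 𝓕) {X : Type*} [TopologicalSpace X] [CompactSpace X]
    {f : X → S.lim.V} (hf : Continuous f) (h : ∀ n, Function.Surjective fun x => S.proj n (f x)) :
    Function.Surjective f := by
  intro y
  obtain ⟨x, hx⟩ := exists_forall_of_compact (fun n => {x | S.proj n (f x) = S.proj n y})
    (fun n => (isClosed_discrete {S.proj n y}).preimage ((S.continuous_proj n).comp hf))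
    (fun n => h n _) (fun n x hx => by
      have hx : S.proj (n + 1) (f x) = S.proj (n + 1) y := hx
      exact (S.map_proj n (f x)).symm.trans ((congrArg _ hx).trans (S.map_proj n y)))
  exact ⟨x, S.lim_ext hx⟩

end General

open FinRootedTree

variable {S S' : InvSeq TCE}

theorem exists_bond (S : InvSeq TCE) {m n : ℕ} (h : m ≤ n) :
    ∃ β : (S.obj n).V → (S.obj m).V, IsSimpleConfluent β ∧
      ∀ x, β (S.proj n x) = S.proj m x := by
  induction n, h using Nat.le_induction with
  | base => exact ⟨id, (IsLC.id _).isSimpleConfluent, fun _ => rfl⟩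
  | succ n _ ih =>
    obtain ⟨β, hβ, h⟩ := ih
    exact ⟨β ∘ S.map n, .comp hβ (S.mem n), fun x => by
      rw [Function.comp_apply, S.map_proj, h]⟩

/-- The properties of a sequence whose limit is a projective Fraïssé limit. -/
structure IsFraisse (S : InvSeq TCE) : Prop where
  onto : ∀ A : FinRootedTree, ∃ (n : ℕ) (k : (S.obj n).V → A.V), IsSimpleConfluent k
  ext : ∀ (m : ℕ) (B : FinRootedTree) (g : B.V → (S.obj m).V), IsSimpleConfluent g →
    ∃ (n : ℕ) (k : (S.obj n).V → B.V), IsSimpleConfluent k ∧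
      ∀ x, g (k (S.proj n x)) = S.proj m x

/-- Maps on `K` are replaced by maps on finite stages: applied to the projection to a stage, the
extension property becomes a lifting statement about the sequence itself. -/
theorem isFraisse_of_isProjFraisseLimit {K : RootedTopGraph} (e : K.Iso S.lim)
    (h1 : ∀ A : FinRootedTree, ∃ h : K.V → A.V, S.MemLim e h)
    (h2 : ∀ (A B : FinRootedTree) (f : K.V → A.V) (g : B.V → A.V), S.MemLim e f → TCE.Mem g →
      ∃ h : K.V → B.V, S.MemLim e h ∧ f = g ∘ h) : S.IsFraisse where
  onto A := by
    obtain ⟨-, n, k, hk, -⟩ := h1 A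
    exact ⟨n, k, hk⟩
  ext m B g hg := by
    obtain ⟨h, ⟨n, k, hk, hh⟩, hf⟩ := h2 (S.obj m) B (fun x => S.proj m (e.toHomeo x)) g
      ⟨m, id, (IsLC.id _).isSimpleConfluent, fun _ => rfl⟩ hg
    refine ⟨n, k, hk, fun x => ?_⟩
    have h3 := congrFun hf (e.toHomeo.symm x)
    rw [Function.comp_apply, hh, Homeomorph.apply_symm_apply] at h3
    exact h3.symm

/-- Composition with a bonding map makes the stage as late as desired, which keeps the indices of
the back-and-forth unbounded. -/
theorem IsFraisse.ext_ge (hS : S.IsFraisse) (m l : ℕ) {B : FinRootedTree}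
    {g : B.V → (S.obj m).V} (hg : IsSimpleConfluent g) :
    ∃ (n : ℕ) (k : (S.obj n).V → B.V), l < n ∧ IsSimpleConfluent k ∧
      ∀ x, g (k (S.proj n x)) = S.proj m x := by
  obtain ⟨n, k, hk, h⟩ := hS.ext m B g hg
  obtain ⟨β, hβ, h'⟩ := S.exists_bond (le_max_left n (l + 1))
  refine ⟨_, k ∘ β, (Nat.lt_succ_self l).trans_le (le_max_right n (l + 1)), .comp hk hβ,
    fun x => ?_⟩
  rw [Function.comp_apply, h', h]

/-- A stage of the back-and-forth construction. -/
structure Stage (S S' : InvSeq TCE) where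
  m : ℕ
  n : ℕ
  f : (S'.obj n).V → (S.obj m).V
  mem : IsSimpleConfluent f

/-- Lift through `s.f` on one side, then through the resulting `g` on the other; both triangles
commute on points of the limits. -/
theorem Stage.exists_next (hS : S.IsFraisse) (hS' : S'.IsFraisse) (s : Stage S S') :
    ∃ (t : Stage S S') (g : (S.obj t.m).V → (S'.obj s.n).V), IsSimpleConfluent g ∧ s.m < t.m ∧
      s.n < t.n ∧ (∀ x, s.f (g (S.proj t.m x)) = S.proj s.m x) ∧
      ∀ y, g (t.f (S'.proj t.n y)) = S'.proj s.n y := by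
  obtain ⟨m, g, hm, hg, h1⟩ := hS.ext_ge s.m s.m s.mem
  obtain ⟨n, f, hn, hf, h2⟩ := hS'.ext_ge s.n s.n hg
  exact ⟨⟨m, n, f, hf⟩, g, hg, hm, hn, h1, h2⟩

theorem exists_stages (hS : S.IsFraisse) (hS' : S'.IsFraisse) :
    ∃ (s : ℕ → Stage S S') (g : ∀ k, (S.obj (s (k + 1)).m).V → (S'.obj (s k).n).V),
      (∀ k, IsSimpleConfluent (g k)) ∧ (∀ k, k ≤ (s k).m) ∧ (∀ k, k ≤ (s k).n) ∧
      (∀ k x, (s k).f (g k (S.proj (s (k + 1)).m x)) = S.proj (s k).m x) ∧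
      ∀ k y, g k ((s (k + 1)).f (S'.proj (s (k + 1)).n y)) = S'.proj (s k).n y := by
  obtain ⟨n, f, hf⟩ := hS'.onto (S.obj 0)
  choose next g hg hm hn h1 h2 using Stage.exists_next hS hS'
  let s : ℕ → Stage S S' := fun k => Nat.rec ⟨0, n, f, hf⟩ (fun _ t => next t) k
  have hs : ∀ k, s (k + 1) = next (s k) := fun _ => rfl
  refine ⟨s, fun k => g (s k), fun k => hg _, fun k => ?_, fun k => ?_, fun k => h1 _,
    fun k => h2 _⟩
  · induction k with
    | zero => exact Nat.zero_le _
    | succ k ih => exact Nat.succ_le_of_lt (ih.trans_lt (hm _))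
  · induction k with
    | zero => exact Nat.zero_le _
    | succ k ih => exact Nat.succ_le_of_lt (ih.trans_lt (hn _))

/-- The maps `f` of the zigzag induce `F` between the limits, and the maps `g` recover the
coordinates of `y` from `F y`. So `F` is injective and reflects edges, while its surjectivity comes
from compactness. -/
theorem IsFraisse.nonempty_iso (hS : S.IsFraisse) (hS' : S'.IsFraisse) :
    Nonempty (S'.lim.Iso S.lim) := by
  obtain ⟨s, g, hg, hm, hn, h1, h2⟩ := exists_stages hS hS'
  choose β hβ hβ' using fun k => S.exists_bond (hm k)
  choose γ hγ hγ' using fun k => S'.exists_bond (hn k)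
  -- If `x` agrees with the image of `y` at a later stage, it does so at all earlier ones. Coherence
  -- of the coordinates of `F y` can thus be read off from a point `x` of the limit.
  have hback : ∀ (y : S'.lim.V) (x : S.lim.V) (k i : ℕ),
      S.proj (s (k + i)).m x = (s (k + i)).f (S'.proj (s (k + i)).n y) →
      S.proj (s k).m x = (s k).f (S'.proj (s k).n y) := by
    intro y x k i
    induction i with
    | zero => exact id
    | succ i ih =>
      intro h
      refine ih ?_
      rw [← h1 (k + i) x]
      have h : S.proj (s (k + i + 1)).m x = (s (k + i + 1)).f (S'.proj (s (k + i + 1)).n y) := h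
      rw [h, h2]
  have hpt : ∀ y k, ∃ x : S.lim.V, S.proj (s k).m x = (s k).f (S'.proj (s k).n y) :=
    fun y k => S.proj_surjective _ _
  let F : S'.lim.V → S.lim.V := fun y => ⟨fun k => β k ((s k).f (S'.proj (s k).n y)), fun k => by
    obtain ⟨x, hx⟩ := hpt y (k + 1)
    change S.map k (β (k + 1) ((s (k + 1)).f _)) = β k ((s k).f _)
    rw [← hx, ← hback y x k 1 hx, hβ', hβ', S.map_proj]⟩
  have hF : ∀ y k, S.proj (s k).m (F y) = (s k).f (S'.proj (s k).n y) := by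
    intro y k
    obtain ⟨x, hx⟩ := hpt y (s k).m
    obtain ⟨i, hi⟩ := Nat.exists_eq_add_of_le (hm k)
    have h3 : S.proj (s k).m (F y) = S.proj (s k).m x := by
      have h4 : S.proj (s k).m (F y) = β (s k).m ((s (s k).m).f (S'.proj (s (s k).m).n y)) := rfl
      rw [h4, ← hx, hβ']
    rw [h3]
    refine hback y x k i ?_
    rw [← hi]
    exact hx
  have hFg : ∀ y k, g k (S.proj (s (k + 1)).m (F y)) = S'.proj (s k).n y := fun y k => by
    rw [hF, h2]
  have hinj : Function.Injective F := fun y y' h => S'.lim_ext fun k => by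
    rw [← hγ' k y, ← hγ' k y', ← hFg y k, ← hFg y' k, h]
  have hcont : Continuous F := by
    refine Continuous.subtype_mk (continuous_pi fun k => ?_) _
    exact (continuous_of_discreteTopology (f := fun v => β k ((s k).f v))).comp
      (S'.continuous_proj _)
  have := S'.lim.compact
  have := S.lim.t2
  have hsurj : Function.Surjective F := S.surjective_of_forall_proj hcont fun k v => by
    obtain ⟨w, hw⟩ := (hβ k).isEpi.surj v
    obtain ⟨u, rfl⟩ := (s k).mem.isEpi.surj w
    obtain ⟨y, rfl⟩ := S'.proj_surjective _ u
    exact ⟨y, hw⟩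
  refine ⟨⟨hcont.homeoOfEquivCompactToT2 (f := Equiv.ofBijective F ⟨hinj, hsurj⟩),
    fun y y' => ⟨fun h k => ?_, fun h k => ?_⟩, S.lim_ext fun k => ?_⟩⟩
  · exact (hβ k).isEpi.map_edge _ _ ((s k).mem.isEpi.map_edge _ _ (h _))
  · have h3 := (hγ k).isEpi.map_edge _ _ ((hg k).isEpi.map_edge _ _ (h (s (k + 1)).m))
    have h4 : ∀ y, γ k (g k ((F y).1 (s (k + 1)).m)) = y.1 k := fun y =>
      (congrArg (γ k) (hFg y k)).trans (hγ' k y)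
    have h5 : (S'.obj k).E (γ k (g k ((F y).1 (s (k + 1)).m)))
      (γ k (g k ((F y').1 (s (k + 1)).m))) := h3
    rwa [h4, h4] at h5
  · have h3 : S.proj k (F S'.lim.root) = β k ((s k).f (S'.obj (s k).n).root) := rfl
    have h4 : S.proj k S.lim.root = (S.obj k).root := rfl
    rw [h4, ← (hβ k).isEpi.map_root, ← (s k).mem.isEpi.map_root]
    exact h3

end InvSeq

namespace RootedTopGraph

/-- The composition of isomorphisms. -/
def Iso.trans {K L M : RootedTopGraph} (e : K.Iso L) (f : L.Iso M) : K.Iso M where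
  toHomeo := e.toHomeo.trans f.toHomeo
  edge_iff a b := (e.edge_iff a b).trans (f.edge_iff _ _)
  map_root := by
    rw [Homeomorph.trans_apply, e.map_root, f.map_root]

/-- If a compact space maps onto a graph and onto a Hausdorff space with the same identifications,
then the graph is a prespace whose realization is that Hausdorff space. -/
theorem isPrespace_and_nonempty_homeomorph {X Y : Type} [TopologicalSpace X] [CompactSpace X]
    [TopologicalSpace Y] [T2Space Y] {K : RootedTopGraph} {a : X → K.V} {b : X → Y}
    (ha : Continuous a) (hb : Continuous b) (ha' : Function.Surjective a)
    (hb' : Function.Surjective b) (h : ∀ x x', K.E (a x) (a x') ↔ b x = b x') :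
    K.IsPrespace ∧ Nonempty (K.Realization ≃ₜ Y) := by
  refine ⟨fun u v w huv hvw => ?_, ?_⟩
  · obtain ⟨x, rfl⟩ := ha' u
    obtain ⟨y, rfl⟩ := ha' v
    obtain ⟨z, rfl⟩ := ha' w
    rw [h] at *
    exact huv.trans hvw
  · have := K.compact
    have := K.t2
    have hqa : Topology.IsQuotientMap a := IsClosedMap.isQuotientMap ha.isClosedMap ha ha'
    let φ : K.V → Y := fun v => b (ha' v).choose
    have hφ : ∀ x, φ (a x) = b x := fun x => by
      rw [← h, (ha' (a x)).choose_spec]; exact K.refl _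
    have hφc : Continuous φ := by
      rw [hqa.continuous_iff]
      exact hb.congr fun x => (hφ x).symm
    have hE : ∀ u v, K.E u v ↔ φ u = φ v := fun u v => by
      obtain ⟨x, rfl⟩ := ha' u
      obtain ⟨y, rfl⟩ := ha' v
      rw [hφ, hφ, h]
    let ψ : K.Realization → Y := Quot.lift φ fun u v huv => (hE u v).1 huv
    have hψc : Continuous ψ := continuous_quot_lift _ hφc
    have hψ : Function.Bijective ψ := by
      constructor
      · intro u v
        induction u using Quot.ind
        induction v using Quot.ind
        exact fun huv => Quot.sound ((hE _ _).2 huv)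
      · intro y
        obtain ⟨x, rfl⟩ := hb' y
        exact ⟨Quot.mk _ (a x), hφ x⟩
    have : CompactSpace K.Realization := Quot.compactSpace
    exact ⟨hψc.homeoOfEquivCompactToT2 (f := Equiv.ofBijective ψ hψ)⟩

end RootedTopGraph

/-! ## Points of the Mohler–Nikiel dendroid -/

namespace MNStage

theorem continuous_bond (Y : MNStage) (t : ℝ) : Continuous (Y.bond t) :=
  continuous_fst.quotient_lift _

theorem continuous_ht_double {Y : MNStage} (h : Continuous Y.ht) (t : ℝ) :
    Continuous (Y.double t).ht :=
  (h.comp continuous_fst).quotient_lift _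

/-- The bonding map together with the excess of the height over `t`, signed by the copy, is a
continuous injection into `Y.Y × ℝ`; the sign is lost exactly where the copies are glued. -/
theorem t2Space_double {Y : MNStage} (h : Continuous Y.ht) [T2Space Y.Y] (t : ℝ) :
    T2Space (Y.double t).Y := by
  let φ : Y.Y × Bool → ℝ := fun p => (if p.2 then 1 else -1) * max ((Y.ht p.1 : ℝ) - t) 0
  have hφ : Continuous φ := by
    refine Continuous.mul ?_ ?_
    · exact (continuous_of_discreteTopology (f := fun b : Bool => if b then (1 : ℝ) else -1)).comp
        continuous_snd
    · exact ((continuous_subtype_val.comp (h.comp continuous_fst)).sub continuous_const).max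
        continuous_const
  have hφ' : ∀ p q, (Y.glue t).r p q → φ p = φ q := by
    rintro ⟨y, i⟩ ⟨y', j⟩ ⟨rfl : y = y', h'⟩
    rcases h' with h' | h'
    · rw [show i = j from h']
    · have h0 : max ((Y.ht y : ℝ) - t) 0 = 0 := max_eq_right (sub_nonpos.2 h')
      simp only [φ, h0, mul_zero]
  let ψ : (Y.double t).Y → Y.Y × ℝ := fun y => (Y.bond t y, Quotient.lift φ hφ' y)
  have hψ : Continuous ψ := (Y.continuous_bond t).prodMk (hφ.quotient_lift _)
  refine T2Space.of_injective_continuous (f := ψ) (fun y y' => ?_) hψ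
  induction y using Quotient.ind with | _ p
  induction y' using Quotient.ind with | _ q
  obtain ⟨y, i⟩ := p
  obtain ⟨y', j⟩ := q
  intro hyy
  obtain ⟨h1, h2⟩ := Prod.ext_iff.1 hyy
  obtain rfl : y = y' := h1
  have h2 : φ (y, i) = φ (y, j) := h2
  refine Quotient.sound ⟨rfl, ?_⟩
  by_contra! hij
  obtain ⟨h3, h4⟩ := hij
  have h5 : 0 < max ((Y.ht y : ℝ) - t) 0 := lt_max_of_lt_left (sub_pos.2 h4)
  cases i <;> cases j <;> simp [φ] at h2 h3 <;> linarith

end MNStage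

section MN

variable (d : ℕ → ℝ)

theorem continuous_ht_mnStage : ∀ n, Continuous (mnStage d n).ht
  | 0 => continuous_id
  | n + 1 => MNStage.continuous_ht_double (continuous_ht_mnStage n) (d n)

theorem t2Space_mnStage : ∀ n, T2Space (mnStage d n).Y
  | 0 => inferInstanceAs (T2Space unitInterval)
  | n + 1 =>
    have := t2Space_mnStage n
    MNStage.t2Space_double (continuous_ht_mnStage d n) (d n)

theorem t2Space_mnDendroid : T2Space (MNDendroid d) := by
  have := t2Space_mnStage d
  infer_instance

/-- The point of a stage at a given height and with a given choice of branches. -/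
def mnPoint : ∀ n, unitInterval × (ℕ → Bool) → (mnStage d n).Y
  | 0, p => p.1
  | n + 1, p => Quotient.mk ((mnStage d n).glue (d n)) (mnPoint n p, p.2 n)

theorem continuous_mnPoint : ∀ n, Continuous (mnPoint d n)
  | 0 => continuous_fst
  | n + 1 => continuous_quotient_mk'.comp
      ((continuous_mnPoint n).prodMk ((continuous_apply n).comp continuous_snd))

theorem ht_mnPoint (p : unitInterval × (ℕ → Bool)) : ∀ n, (mnStage d n).ht (mnPoint d n p) = p.1
  | 0 => rfl
  | n + 1 => ht_mnPoint p n

theorem mnBond_mnPoint (n : ℕ) (p : unitInterval × (ℕ → Bool)) :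
    mnBond d n (mnPoint d (n + 1) p) = mnPoint d n p := rfl

/-- At a step with `d j` at or above the height both copies are glued, so only the choices with `d
j` below the height matter. -/
theorem mnPoint_eq_iff (p q : unitInterval × (ℕ → Bool)) (n : ℕ) :
    mnPoint d n p = mnPoint d n q ↔ p.1 = q.1 ∧ ∀ j < n, d j < p.1 → p.2 j = q.2 j := by
  induction n with
  | zero => exact ⟨fun h => ⟨h, fun j hj => (Nat.not_lt_zero j hj).elim⟩, And.left⟩
  | succ n ih =>
    have h1 : mnPoint d (n + 1) p = mnPoint d (n + 1) q ↔
        mnPoint d n p = mnPoint d n q ∧ (p.2 n = q.2 n ∨ ((mnStage d n).ht (mnPoint d n p) : ℝ) ≤ d n) :=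
      Quotient.eq (r := (mnStage d n).glue (d n))
    rw [h1, ih, ht_mnPoint]
    constructor
    · rintro ⟨⟨h2, h3⟩, h4⟩
      refine ⟨h2, fun j hj hjp => ?_⟩
      rcases Nat.lt_succ_iff_lt_or_eq.1 hj with hj | rfl
      · exact h3 j hj hjp
      · exact h4.resolve_right (not_le.2 hjp)
    · rintro ⟨h2, h3⟩
      refine ⟨⟨h2, fun j hj => h3 j (hj.trans n.lt_succ_self)⟩, ?_⟩
      exact (le_or_gt (p.1 : ℝ) (d n)).symm.imp (h3 n n.lt_succ_self) id

theorem surjective_mnPoint (n : ℕ) : Function.Surjective (mnPoint d n) := by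
  induction n with
  | zero => exact fun t => ⟨(t, fun _ => true), rfl⟩
  | succ n ih =>
    intro y
    induction y using Quotient.ind with | _ y
    obtain ⟨y, i⟩ := y
    obtain ⟨p, hp⟩ := ih y
    refine ⟨(p.1, Function.update p.2 n i), ?_⟩
    have h : mnPoint d n (p.1, Function.update p.2 n i) = y := by
      rw [← hp, mnPoint_eq_iff]
      exact ⟨rfl, fun j hj _ => Function.update_of_ne hj.ne _ _⟩
    change Quotient.mk _ _ = Quotient.mk _ _
    rw [h]
    simp

/-- The point of the dendroid at a given height and with a given choice of branches. -/
def mnLimPoint (p : unitInterval × (ℕ → Bool)) : MNDendroid d :=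
  ⟨fun n => mnPoint d n p, fun n => mnBond_mnPoint d n p⟩

theorem continuous_mnLimPoint : Continuous (mnLimPoint d) :=
  (continuous_pi (continuous_mnPoint d)).subtype_mk _

theorem mnLimPoint_eq_iff (p q : unitInterval × (ℕ → Bool)) :
    mnLimPoint d p = mnLimPoint d q ↔ p.1 = q.1 ∧ ∀ j, d j < p.1 → p.2 j = q.2 j := by
  have h : mnLimPoint d p = mnLimPoint d q ↔ ∀ n, mnPoint d n p = mnPoint d n q :=
    Subtype.ext_iff.trans funext_iff
  simp only [h, mnPoint_eq_iff]
  exact ⟨fun h => ⟨(h 0).1, fun j => (h (j + 1)).2 j j.lt_succ_self⟩,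
    fun h n => ⟨h.1, fun j _ => h.2 j⟩⟩

theorem surjective_mnLimPoint : Function.Surjective (mnLimPoint d) := by
  intro y
  have := t2Space_mnStage d
  obtain ⟨p, hp⟩ := exists_forall_of_compact (fun n => {p | mnPoint d n p = y.1 n})
    (fun n => isClosed_eq (continuous_mnPoint d n) continuous_const)
    (fun n => surjective_mnPoint d n _) (fun n p hp => by
      have hp : mnPoint d (n + 1) p = y.1 (n + 1) := hp
      exact (congrArg (mnBond d n) hp).trans (y.2 n))
  exact ⟨p, Subtype.ext (funext hp)⟩

end MN

/-- Mohler–Nikiel sequences exist. -/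
theorem exists_isMNSequence : ∃ d, IsMNSequence d := by
  have hne : Nonempty {q : ℚ // 0 ≤ q ∧ q < 1} := ⟨⟨0, le_rfl, one_pos⟩⟩
  obtain ⟨e, he⟩ := exists_surjective_nat {q : ℚ // 0 ≤ q ∧ q < 1}
  -- Enumerate the rationals of `[0, 1)` through the first component of the pairing function; the
  -- second one makes every value recur.
  refine ⟨fun n => ((e n.unpair.1 : ℚ) : ℝ), fun n => ?_, fun t ht => ?_, ?_, fun n => ?_⟩
  · exact ⟨Rat.cast_nonneg.2 (e n.unpair.1).2.1, by
      have := (e n.unpair.1).2.2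
      beta_reduce
      exact_mod_cast this⟩
  · rw [Metric.mem_closure_iff]
    intro ε hε
    obtain ⟨q, h1, h2⟩ := exists_rat_btwn (lt_min ht.2 (lt_add_of_pos_right t hε))
    obtain ⟨m, hm⟩ := he ⟨q, by exact_mod_cast (ht.1.trans_lt h1).le,
      by exact_mod_cast (lt_min_iff.1 h2).1⟩
    refine ⟨q, ⟨Nat.pair m 0, by simp [hm]⟩, ?_⟩
    rw [Real.dist_eq, abs_sub_lt_iff]
    have := (lt_min_iff.1 h2).2
    constructor <;> linarith
  · obtain ⟨m, hm⟩ := he ⟨0, le_rfl, one_pos⟩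
    exact ⟨Nat.pair m 0, by simp [hm]⟩
  · refine ⟨Nat.pair n.unpair.1 (n + 1), ?_, by simp⟩
    exact n.lt_succ_self.trans_le (Nat.right_le_pair _ _)

/-- Countable sets of cuts exist. -/
theorem exists_isCutSet (d : ℕ → ℝ) : ∃ Q : Set ℝ, IsCutSet d Q ∧ Q.Countable := by
  -- The complement of the countably many ramification heights is dense.
  obtain ⟨t, ht, htc, htd⟩ := ((Set.countable_range d).dense_compl ℝ).exists_countable_dense_subset
  refine ⟨t ∩ Set.Ioo 0 1, ⟨fun c hc => hc.2.1, fun c hc => hc.2.2, fun c hc j hj =>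
    ht hc.1 ⟨j, hj⟩, fun a b ha hab hb => ?_⟩, htc.mono Set.inter_subset_left⟩
  obtain ⟨c, hc, h1, h2⟩ := htd.exists_between hab
  exact ⟨c, ⟨hc, ha.trans_lt h1, h2.trans_le hb⟩, h1, h2⟩

/-! ## A sequence with limit the projective Fraïssé limit -/

/-- An increasing sequence of grids that exhausts the ramification heights and the cuts. -/
structure GridSeq (d : ℕ → ℝ) (Q : Set ℝ) where
  grid : ℕ → Grid d Q
  J_eq : ∀ n, (grid n).J = Finset.range n
  C_mono : Monotone fun n => (grid n).C
  exists_mem : ∀ c ∈ Q, ∃ n, c ∈ (grid n).C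

/-- The `n`-th grid has the first `n + 1` cuts of an enumeration of `Q` and, for the indices below
`n`, cuts that separate distinct heights from one another, from `0` and from `1`. -/
theorem IsCutSet.nonempty_gridSeq {d : ℕ → ℝ} {Q : Set ℝ} (h : IsCutSet d Q) (hd : IsMNSequence d)
    (hQ : Q.Countable) : Nonempty (GridSeq d Q) := by
  classical
  obtain ⟨c₀, hc₀, -, -⟩ := h.dense 0 1 le_rfl one_pos le_rfl
  obtain ⟨q, rfl⟩ := hQ.exists_eq_range ⟨c₀, hc₀⟩
  -- Stated for all pairs, with the default `c₀`, so that the chosen cut `m a b` is a total function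
  -- and always lies in `Q`.
  have h1 : ∀ a b : ℝ, ∃ c ∈ Set.range q, 0 ≤ a → a < b → b ≤ 1 → a < c ∧ c < b := fun a b => by
    by_cases hab : 0 ≤ a ∧ a < b ∧ b ≤ 1
    · obtain ⟨c, hc, hc'⟩ := h.dense a b hab.1 hab.2.1 hab.2.2
      exact ⟨c, hc, fun _ _ _ => hc'⟩
    · exact ⟨c₀, hc₀, fun h1 h2 h3 => (hab ⟨h1, h2, h3⟩).elim⟩
  choose m hmQ hm using h1
  let C : ℕ → Finset ℝ := fun n => (Finset.range (n + 1)).image q ∪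
    (((Finset.range n ×ˢ Finset.range n).image fun p => m (d p.1) (d p.2)) ∪
      (((Finset.range n).image fun j => m 0 (d j)) ∪ (Finset.range n).image fun j => m (d j) 1))
  have hCQ : ∀ n, ∀ c ∈ C n, c ∈ Set.range q := by
    intro n c hc
    simp only [C, Finset.mem_union, Finset.mem_image] at hc
    rcases hc with ⟨i, -, rfl⟩ | ⟨p, -, rfl⟩ | ⟨j, -, rfl⟩ | ⟨j, -, rfl⟩
    · exact ⟨i, rfl⟩
    all_goals exact hmQ _ _
  refine ⟨⟨fun n => ⟨C n, Finset.range n, ⟨q 0, ?_⟩, hCQ n, fun c hc => h.pos c (hCQ n c hc),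
    fun j _ => (hd.1 j).1, fun i hi j hj hij => ⟨m (d i) (d j), ?_, hm _ _ (hd.1 i).1 hij
      (hd.1 j).2.le⟩, fun j hj h0 => ⟨m 0 (d j), ?_, (hm _ _ le_rfl h0 (hd.1 j).2.le).2⟩,
    fun j hj => ⟨m (d j) 1, ?_, (hm _ _ (hd.1 j).1 (hd.1 j).2 le_rfl).1⟩⟩, fun n => rfl, ?_, ?_⟩⟩
  · exact Finset.mem_union_left _ (Finset.mem_image_of_mem _ (Finset.mem_range.2 n.succ_pos))
  · exact Finset.mem_union_right _ (Finset.mem_union_left _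
      (Finset.mem_image.2 ⟨(i, j), Finset.mem_product.2 ⟨hi, hj⟩, rfl⟩))
  · exact Finset.mem_union_right _ (Finset.mem_union_right _ (Finset.mem_union_left _
      (Finset.mem_image.2 ⟨j, hj, rfl⟩)))
  · exact Finset.mem_union_right _ (Finset.mem_union_right _ (Finset.mem_union_right _
      (Finset.mem_image.2 ⟨j, hj, rfl⟩)))
  · intro n n' hn
    have h2 := Finset.range_subset_range.2 hn
    exact Finset.union_subset_union
      (Finset.image_subset_image (Finset.range_subset_range.2 (Nat.succ_le_succ hn)))
      (Finset.union_subset_union (Finset.image_subset_image (Finset.product_subset_product h2 h2))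
        (Finset.union_subset_union (Finset.image_subset_image h2) (Finset.image_subset_image h2)))
  · rintro _ ⟨i, rfl⟩
    exact ⟨i, Finset.mem_union_left _ (Finset.mem_image_of_mem _ (Finset.self_mem_range_succ i))⟩

namespace GridSeq

open FinRootedTree

variable {d : ℕ → ℝ} {Q : Set ℝ} (Γ : GridSeq d Q) (h : IsCutSet d Q)

theorem J_mono {m n : ℕ} (hmn : m ≤ n) : (Γ.grid m).J ⊆ (Γ.grid n).J := by
  rw [Γ.J_eq, Γ.J_eq]
  exact Finset.range_subset_range.2 hmn

/-- Cofinality of the sequence: it carries the extension property over from arbitrary grids to the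
stages of the sequence. -/
theorem exists_le (H : Grid d Q) : ∃ n, H.C ⊆ (Γ.grid n).C ∧ H.J ⊆ (Γ.grid n).J := by
  have h1 : ∀ F : Finset ℝ, (∀ c ∈ F, c ∈ Q) → ∃ n, F ⊆ (Γ.grid n).C := by
    classical
    intro F
    induction F using Finset.induction_on with
    | empty => exact fun _ => ⟨0, Finset.empty_subset _⟩
    | insert c F hc ih =>
      intro hF
      obtain ⟨n, hn⟩ := ih fun e he => hF e (Finset.mem_insert_of_mem he)
      obtain ⟨m, hm⟩ := Γ.exists_mem c (hF c (Finset.mem_insert_self _ _))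
      exact ⟨max m n, Finset.insert_subset (Γ.C_mono (le_max_left _ _) hm)
        (hn.trans (Γ.C_mono (le_max_right _ _)))⟩
  obtain ⟨n, hn⟩ := h1 H.C H.mem
  obtain ⟨m, hm⟩ := H.J.exists_nat_subset_range
  refine ⟨max m n, hn.trans (Γ.C_mono (le_max_right _ _)), ?_⟩
  rw [Γ.J_eq]
  exact hm.trans (Finset.range_subset_range.2 (le_max_left _ _))

/-- The inverse sequence of the trees of the grids. -/
noncomputable def invSeq : InvSeq TCE where
  obj n := (Γ.grid n).tree
  map n := Grid.proj (Γ.grid (n + 1)) (Γ.grid n)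
  mem n := Grid.isSimpleConfluent_proj h (Γ.C_mono n.le_succ) (Γ.J_mono n.le_succ)

theorem proj_proj {m n : ℕ} (hmn : m ≤ n) (x : (Γ.invSeq h).lim.V) :
    Grid.proj (Γ.grid n) (Γ.grid m) ((Γ.invSeq h).proj n x) = (Γ.invSeq h).proj m x := by
  induction n, hmn using Nat.le_induction with
  | base => exact congrFun Grid.proj_self _
  | succ n hmn ih =>
    rw [← ih, ← (Γ.invSeq h).map_proj n]
    exact (congrFun (Grid.proj_comp_proj (G'' := Γ.grid (n + 1)) (Γ.C_mono hmn) (Γ.J_mono hmn))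
      _).symm

theorem exists_onto (hd : IsMNSequence d) (A : FinRootedTree) :
    ∃ (n : ℕ) (k : ((Γ.invSeq h).obj n).V → A.V), IsSimpleConfluent k := by
  obtain ⟨G, k, hk⟩ := Grid.exists_onto h hd A
  obtain ⟨n, hC, hJ⟩ := Γ.exists_le G
  exact ⟨n, k ∘ Grid.proj (Γ.grid n) G, .comp hk (Grid.isSimpleConfluent_proj h hC hJ)⟩

theorem exists_lift (hd : IsMNSequence d) {A B : FinRootedTree} {g : B.V → A.V}
    (hg : IsSimpleConfluent g) {m : ℕ} {f : ((Γ.invSeq h).obj m).V → A.V}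
    (hf : IsSimpleConfluent f) : ∃ (n : ℕ) (k : ((Γ.invSeq h).obj n).V → B.V),
      IsSimpleConfluent k ∧ ∀ x, g (k ((Γ.invSeq h).proj n x)) = f ((Γ.invSeq h).proj m x) := by
  obtain ⟨G, hmC, hmJ, k, hk, hgk⟩ := Grid.exists_lift h hd hg (Γ.grid m) hf
  obtain ⟨n, hC, hJ⟩ := Γ.exists_le G
  have hC' := hC.trans (Γ.C_mono (le_max_right m n))
  have hJ' := hJ.trans (Γ.J_mono (le_max_right m n))
  refine ⟨max m n, k ∘ Grid.proj (Γ.grid (max m n)) G,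
    .comp hk (Grid.isSimpleConfluent_proj h hC' hJ'), fun x => ?_⟩
  rw [← Γ.proj_proj h (le_max_left m n), ← Grid.proj_comp_proj (G' := G) hmC hmJ]
  exact congrFun hgk _

end GridSeq

/-- A sequence of finer and finer continuous maps to discrete spaces that separates the points of a
compact metric space has small fibres. -/
theorem exists_diam_fiber_lt {X : Type*} [m : MetricSpace X] [CompactSpace X] {Y : ℕ → Type*}
    [∀ n, TopologicalSpace (Y n)] [∀ n, DiscreteTopology (Y n)] {p : ∀ n, X → Y n}
    (hp : ∀ n, Continuous (p n)) (hinj : ∀ x y, (∀ n, p n x = p n y) → x = y)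
    (hanti : ∀ n x y, p (n + 1) x = p (n + 1) y → p n x = p n y) {ε : ℝ} (hε : 0 < ε) :
    ∃ n, ∀ a, Metric.diam (p n ⁻¹' {a}) < ε := by
  by_contra! hcon
  -- Pairs in a common fibre at distance at least `ε / 2` would exist at every stage; by compactness
  -- some pair is never separated, so its points coincide.
  obtain ⟨z, hz⟩ := exists_forall_of_compact
    (fun n => {z : X × X | p n z.1 = p n z.2 ∧ ε / 2 ≤ dist z.1 z.2})
    (fun n => (isClosed_eq ((hp n).comp continuous_fst) ((hp n).comp continuous_snd)).inter
      (isClosed_le continuous_const continuous_dist))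
    (fun n => by
      by_contra hne
      rw [Set.not_nonempty_iff_eq_empty] at hne
      obtain ⟨a, ha⟩ := hcon n
      refine absurd (Metric.diam_le_of_forall_dist_le (half_pos hε).le fun x hx y hy => ?_)
        (not_le.2 ((half_lt_self hε).trans_le ha))
      by_contra! hxy
      exact (hne ▸ (⟨Eq.trans hx (Eq.symm hy), hxy.le⟩ : (x, y) ∈
        {z : X × X | p n z.1 = p n z.2 ∧ ε / 2 ≤ dist z.1 z.2}) : (x, y) ∈ (∅ : Set (X × X))))
    (fun n z hz => ⟨hanti n _ _ hz.1, hz.2⟩)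
  have h1 := (hz 0).2
  rw [hinj _ _ fun n => (hz n).1, dist_self] at h1
  linarith

theorem InvSeq.exists_diam_proj_lt {𝓕 : TreeFamily} (S : InvSeq 𝓕) (m : MetricSpace S.lim.V)
    (hm : m.toUniformSpace.toTopologicalSpace = S.lim.top) {ε : ℝ} (hε : 0 < ε) :
    ∃ n, ∀ a, @Metric.diam S.lim.V m.toPseudoMetricSpace (S.proj n ⁻¹' {a}) < ε := by
  have hc := S.lim.compact
  have hproj := S.continuous_proj
  rw [RootedTopGraph.instTopologicalSpaceV, ← hm] at hproj
  rw [← hm] at hc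
  exact exists_diam_fiber_lt hproj (fun x y => S.lim_ext) (fun n x y h => by
    rw [← S.map_proj, h, S.map_proj]) hε

/-- The identity isomorphism. -/
def RootedTopGraph.Iso.refl (K : RootedTopGraph) : K.Iso K where
  toHomeo := Homeomorph.refl _
  edge_iff _ _ := Iff.rfl
  map_root := rfl

theorem GridSeq.isProjFraisseLimit {d : ℕ → ℝ} {Q : Set ℝ} (Γ : GridSeq d Q) (h : IsCutSet d Q)
    (hd : IsMNSequence d) : IsProjFraisseLimit TCE (Γ.invSeq h).lim := by
  refine ⟨Γ.invSeq h, .refl _, fun A => ?_, fun A B f g hf hg => ?_, fun m hm ε hε => ?_⟩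
  · obtain ⟨n, k, hk⟩ := Γ.exists_onto h hd A
    exact ⟨fun x => k ((Γ.invSeq h).proj n x), n, k, hk, fun _ => rfl⟩
  · obtain ⟨m, f', hf', hff⟩ := hf
    obtain ⟨n, k, hk, hgk⟩ := Γ.exists_lift h hd hg hf'
    exact ⟨fun x => k ((Γ.invSeq h).proj n x), ⟨n, k, hk, fun _ => rfl⟩,
      funext fun x => (hff x).trans (hgk x).symm⟩
  · obtain ⟨n, hn⟩ := (Γ.invSeq h).exists_diam_proj_lt m hm hε
    exact ⟨_, (Γ.invSeq h).proj n, ⟨n, id, (FinRootedTree.IsLC.id _).isSimpleConfluent,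
      fun _ => rfl⟩, hn⟩

/-! ## The realization of the limit -/

/-- A height, a lower cut for each cut (the cuts being doubled), and a choice of branches. -/
abbrev CutPoint (Q : Set ℝ) : Type :=
  {x : (unitInterval × (ℕ → Bool)) × (ℝ → Bool) //
    ∀ c ∈ Q, (x.2 c = true → c ≤ x.1.1) ∧ (x.2 c = false → (x.1.1 : ℝ) ≤ c)}

/-- For each cut both conditions are implications from an open premise to a closed conclusion, hence
closed in a compact product. -/
instance (Q : Set ℝ) : CompactSpace (CutPoint Q) := by
  refine isCompact_iff_compactSpace.mp (IsClosed.isCompact ?_)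
  have h1 : Continuous fun x : (unitInterval × (ℕ → Bool)) × (ℝ → Bool) => (x.1.1 : ℝ) :=
    continuous_subtype_val.comp (continuous_fst.comp continuous_fst)
  have h2 : ∀ c b, IsOpen {x : (unitInterval × (ℕ → Bool)) × (ℝ → Bool) | x.2 c = b} :=
    fun c b => by
      have hc : Continuous fun x : (unitInterval × (ℕ → Bool)) × (ℝ → Bool) => x.2 c :=
        (continuous_apply c).comp continuous_snd
      exact (isOpen_discrete {b}).preimage hc
  change IsClosed {x : (unitInterval × (ℕ → Bool)) × (ℝ → Bool) |
    ∀ c ∈ Q, (x.2 c = true → c ≤ x.1.1) ∧ (x.2 c = false → (x.1.1 : ℝ) ≤ c)}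
  simp only [Set.ofPred_forall]
  exact isClosed_iInter fun c => isClosed_iInter fun _ =>
    (isClosed_imp (h2 c true) (isClosed_le continuous_const h1)).inter
      (isClosed_imp (h2 c false) (isClosed_le h1 continuous_const))

namespace GridSeq

open FinRootedTree

variable {d : ℕ → ℝ} {Q : Set ℝ} (Γ : GridSeq d Q) (h : IsCutSet d Q)

/-- The largest cut of the `n`-th grid below a point. -/
noncomputable def floor (n : ℕ) (x : CutPoint Q) : ℝ :=
  (insert 0 ((Γ.grid n).C.filter (x.1.2 · = true))).max' (Finset.insert_nonempty _ _)

theorem floor_spec (n : ℕ) (x : CutPoint Q) :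
    Γ.floor n x = 0 ∨ (Γ.floor n x ∈ (Γ.grid n).C ∧ x.1.2 (Γ.floor n x) = true) := by
  have := Finset.max'_mem (insert 0 ((Γ.grid n).C.filter (x.1.2 · = true)))
    (Finset.insert_nonempty _ _)
  rw [Finset.mem_insert, Finset.mem_filter] at this
  exact this

theorem floor_nonneg (n : ℕ) (x : CutPoint Q) : 0 ≤ Γ.floor n x :=
  Finset.le_max' _ _ (Finset.mem_insert_self _ _)

theorem le_floor {n : ℕ} {x : CutPoint Q} {c : ℝ} (hc : c ∈ (Γ.grid n).C) (hx : x.1.2 c = true) :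
    c ≤ Γ.floor n x :=
  Finset.le_max' _ _ (Finset.mem_insert_of_mem (Finset.mem_filter.2 ⟨hc, hx⟩))

theorem floor_le (n : ℕ) (x : CutPoint Q) : Γ.floor n x ≤ x.1.1.1 := by
  rcases Γ.floor_spec n x with h | h
  · rw [h]; exact x.1.1.1.2.1
  · exact (x.2 _ ((Γ.grid n).mem _ h.1)).1 h.2

theorem le_floor_of_lt {n : ℕ} {x : CutPoint Q} {c : ℝ} (hc : c ∈ (Γ.grid n).C)
    (hx : c < x.1.1.1) : c ≤ Γ.floor n x := by
  refine Γ.le_floor hc ?_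
  by_contra hw
  exact (not_lt.2 ((x.2 c ((Γ.grid n).mem c hc)).2 (Bool.eq_false_of_not_eq_true hw))) hx

/-- Doubling matters only at a height that is itself a cut: there the point lies either in the piece
above or in the piece below. -/
theorem floor_eq (n : ℕ) (x : CutPoint Q) :
    Γ.floor n x = cutPred (Γ.grid n).C x.1.1.1 ∨ Γ.floor n x = x.1.1.1 := by
  refine (Γ.floor_le n x).lt_or_eq.imp (fun hlt => ?_) id
  exact (cutPred_eq ((Γ.floor_spec n x).imp id And.left) (Γ.floor_nonneg n x) hlt
    fun e he het => Γ.le_floor_of_lt he het).symm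

theorem cutFloor_floor {m n : ℕ} (hmn : m ≤ n) (x : CutPoint Q) :
    cutFloor (Γ.grid m).C (Γ.floor n x) = Γ.floor m x := by
  refine cutFloor_eq ((Γ.floor_spec m x).imp id And.left) (Γ.floor_nonneg m x) ?_ ?_
  · rcases Γ.floor_spec m x with h | h
    · rw [h]; exact Γ.floor_nonneg n x
    · exact Γ.le_floor (Γ.C_mono hmn h.1) h.2
  · intro e he hen
    rcases hen.lt_or_eq with hlt | rfl
    · exact Γ.le_floor_of_lt he (hlt.trans_le (Γ.floor_le n x))
    · refine Γ.le_floor he ((Γ.floor_spec n x).resolve_left ?_).2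
      exact ((Γ.grid m).pos _ he).ne'

/-- The vertex of the `n`-th tree below a point. -/
noncomputable def vert (n : ℕ) (x : CutPoint Q) : (Γ.grid n).tree.V :=
  (Γ.grid n).vert (Γ.floor n x)
    ((Γ.grid n).J.filter fun j => x.1.1.2 j = true ∧ d j < Γ.floor n x)
    ((Γ.floor_spec n x).imp id And.left) fun _ hj =>
      ⟨(Finset.mem_filter.1 hj).1, (Finset.mem_filter.1 hj).2.2⟩

theorem lev_vert (n : ℕ) (x : CutPoint Q) : (Γ.grid n).lev (Γ.vert n x) = Γ.floor n x := rfl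

theorem mem_br_vert {n : ℕ} {x : CutPoint Q} {j : ℕ} :
    j ∈ (Γ.grid n).br (Γ.vert n x) ↔ j < n ∧ x.1.1.2 j = true ∧ d j < Γ.floor n x := by
  refine Finset.mem_filter.trans ?_
  rw [Γ.J_eq, Finset.mem_range]

theorem proj_vert (n : ℕ) (x : CutPoint Q) :
    Grid.proj (Γ.grid (n + 1)) (Γ.grid n) (Γ.vert (n + 1) x) = Γ.vert n x := by
  have h1 := Γ.cutFloor_floor n.le_succ x
  refine Grid.ext h1 fun j => ?_
  rw [Grid.mem_br_proj, lev_vert, h1, mem_br_vert, mem_br_vert, Γ.J_eq, Finset.mem_range]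
  have h2 : Γ.floor n x ≤ Γ.floor (n + 1) x := by
    rw [← h1]; exact cutFloor_le (Γ.floor_nonneg _ _)
  exact ⟨fun ⟨⟨_, h3, _⟩, h4, h5⟩ => ⟨h4, h3, h5⟩,
    fun ⟨h3, h4, h5⟩ => ⟨⟨h3.trans n.lt_succ_self, h4, h5.trans_le h2⟩, h3, h5⟩⟩

/-- The vertex of the limit below a point. -/
noncomputable def limVert (x : CutPoint Q) : (Γ.invSeq h).lim.V :=
  ⟨fun n => Γ.vert n x, fun n => Γ.proj_vert n x⟩

theorem continuous_vert (n : ℕ) : Continuous (Γ.vert n) := by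
  refine IsLocallyConstant.continuous ((IsLocallyConstant.iff_eventually_eq _).2 fun x => ?_)
  have h1 : ∀ᶠ y in nhds x, ∀ c ∈ (Γ.grid n).C, y.1.2 c = x.1.2 c := by
    rw [Finset.eventually_all]
    exact fun c _ => ((continuous_apply c).comp
      (continuous_snd.comp continuous_subtype_val)).continuousAt
        ((isOpen_discrete {x.1.2 c}).mem_nhds rfl)
  have h2 : ∀ᶠ y in nhds x, ∀ j ∈ (Γ.grid n).J, y.1.1.2 j = x.1.1.2 j := by
    rw [Finset.eventually_all]
    exact fun j _ => ((continuous_apply j).comp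
      (continuous_snd.comp (continuous_fst.comp continuous_subtype_val))).continuousAt
        ((isOpen_discrete {x.1.1.2 j}).mem_nhds rfl)
  filter_upwards [h1, h2] with y hy1 hy2
  have h3 : Γ.floor n y = Γ.floor n x := by
    unfold floor
    congr 2
    exact Finset.filter_congr fun c hc => by rw [hy1 c hc]
  refine Grid.ext h3 fun j => ?_
  rw [mem_br_vert, mem_br_vert, h3]
  refine and_congr_right fun hj => ?_
  rw [hy2 j (by rwa [Γ.J_eq, Finset.mem_range])]

theorem continuous_limVert : Continuous (Γ.limVert h) :=
  (continuous_pi Γ.continuous_vert).subtype_mk _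

theorem surjective_vert (h : IsCutSet d Q) (n : ℕ) : Function.Surjective (Γ.vert n) := by
  intro v
  have hv : (Γ.grid n).lev v ≤ 1 := (Grid.lev_mem v).elim (fun h => h ▸ zero_le_one)
    fun hC => (h.lt_one _ ((Γ.grid n).mem _ hC)).le
  -- The lower endpoint of the piece of `v`, on its upper side, with the choices recorded in `v`.
  let x : CutPoint Q := ⟨((⟨(Γ.grid n).lev v, Grid.lev_nonneg v, hv⟩,
    fun j => decide (j ∈ (Γ.grid n).br v)), fun c => decide (c ≤ (Γ.grid n).lev v)),
    fun c _ => ⟨fun hc => of_decide_eq_true hc, fun hc => (not_le.1 (of_decide_eq_false hc)).le⟩⟩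
  have hx : Γ.floor n x = (Γ.grid n).lev v := by
    refine (Γ.floor_le n x).antisymm ?_
    change (Γ.grid n).lev v ≤ _
    rcases Grid.lev_mem v with h0 | h0
    · rw [h0]; exact Γ.floor_nonneg n x
    · exact Γ.le_floor h0 (decide_eq_true le_rfl)
  refine ⟨x, Grid.ext hx fun j => ?_⟩
  rw [mem_br_vert, hx]
  refine ⟨fun hj => of_decide_eq_true hj.2.1, fun hj => ?_⟩
  have h3 := Grid.of_mem_br hj
  rw [Γ.J_eq, Finset.mem_range] at h3
  exact ⟨h3.1, decide_eq_true hj, h3.2⟩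

theorem surjective_limVert : Function.Surjective (Γ.limVert h) :=
  (Γ.invSeq h).surjective_of_forall_proj (Γ.continuous_limVert h) fun n => Γ.surjective_vert h n

/-- Two points that differ only in the sides of cuts and in irrelevant choices lie in the same piece
or in the two pieces that meet at their height, so one vertex equals or is the parent of the other.
-/
theorem E_vert {x y : CutPoint Q} (hxy : x.1.1.1 = y.1.1.1)
    (hs : ∀ j, d j < x.1.1.1 → x.1.1.2 j = y.1.1.2 j) (n : ℕ) :
    (Γ.grid n).tree.E (Γ.vert n x) (Γ.vert n y) := by
  have key : ∀ {x y : CutPoint Q}, x.1.1.1 = y.1.1.1 →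
      (∀ j, d j < x.1.1.1 → x.1.1.2 j = y.1.1.2 j) → Γ.floor n x < Γ.floor n y →
      (Γ.grid n).tree.par (Γ.vert n y) = Γ.vert n x := by
    intro x y hxy hs hlt
    have hy : Γ.floor n y = y.1.1.1 := by
      refine (Γ.floor_eq n y).resolve_left fun h1 => ?_
      rcases Γ.floor_eq n x with h2 | h2
      · rw [h1, h2, hxy] at hlt
        exact lt_irrefl _ hlt
      · rw [h2, hxy] at hlt
        exact not_lt.2 (Γ.floor_le n y) hlt
    have hx : Γ.floor n x = cutPred (Γ.grid n).C x.1.1.1 := by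
      refine (Γ.floor_eq n x).resolve_right fun h1 => ?_
      rw [h1, hy, hxy] at hlt
      exact lt_irrefl _ hlt
    refine Grid.par_ext (Grid.ne_root ((Γ.floor_nonneg n x).trans_lt hlt)) ?_ fun j => ?_
    · rw [lev_vert, lev_vert, hy, hx, hxy]
    · rw [mem_br_vert, mem_br_vert, lev_vert]
      constructor
      · rintro ⟨h1, h2, h3⟩
        exact ⟨⟨h1, by rw [← hs j (h3.trans_le (Γ.floor_le n x)), h2], h3.trans hlt⟩, h3⟩
      · rintro ⟨⟨h1, h2, -⟩, h3⟩
        exact ⟨h1, by rw [hs j (h3.trans_le (Γ.floor_le n x)), h2], h3⟩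
  rw [E_iff]
  rcases lt_trichotomy (Γ.floor n x) (Γ.floor n y) with hlt | heq | hlt
  · exact Or.inr (Or.inl (key hxy hs hlt))
  · refine Or.inl (Grid.ext heq fun j => ?_)
    rw [mem_br_vert, mem_br_vert, heq]
    refine and_congr_right fun _ => and_congr_left fun hj => ?_
    rw [hs j ((heq ▸ hj).trans_le (Γ.floor_le n x))]
  · exact Or.inr (Or.inr (key hxy.symm (fun j hj => (hs j (hxy ▸ hj)).symm) hlt))

/-- Two cuts strictly between the heights leave a whole piece between those of `x` and `y`; a single
cut would still allow adjacency. -/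
theorem not_E_of_cut_between {n : ℕ} {x y : CutPoint Q} {c c' : ℝ} (hc : c ∈ (Γ.grid n).C)
    (hc' : c' ∈ (Γ.grid n).C) (h1 : x.1.1.1 < c) (h2 : c < c') (h3 : c' < y.1.1.1) :
    ¬ (Γ.grid n).tree.E (Γ.vert n x) (Γ.vert n y) := by
  have hx := (Γ.floor_le n x).trans_lt h1
  have hy := h2.trans_le (Γ.le_floor_of_lt hc' h3)
  have hy0 : Γ.vert n y ≠ (Γ.grid n).tree.root :=
    Grid.ne_root (((Γ.grid n).pos c hc).trans hy)
  rw [E_iff]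
  rintro (h4 | h4 | h4)
  · have := congrArg (Γ.grid n).lev h4
    rw [lev_vert, lev_vert] at this
    linarith
  · have := congrArg (Γ.grid n).lev h4
    rw [Grid.lev_par hy0, lev_vert, lev_vert] at this
    have := le_cutPred hc hy
    linarith
  · have hx0 : Γ.vert n x ≠ (Γ.grid n).tree.root := fun h0 => by
      rw [h0, par_root] at h4
      exact hy0 h4.symm
    have := congrArg (Γ.grid n).lev h4
    rw [Grid.lev_par hx0, lev_vert, lev_vert] at this
    have := cutPred_lt (C := (Γ.grid n).C) (Grid.lev_pos hx0)
    rw [lev_vert] at this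
    linarith

/-- Passing to the parent forgets only choices at or above the level of the parent, so adjacent
vertices agree at every index below both levels. -/
theorem branch_iff_of_E {n : ℕ} {x y : CutPoint Q} {j : ℕ} (hj : j < n)
    (hx : d j < Γ.floor n x) (hy : d j < Γ.floor n y)
    (hE : (Γ.grid n).tree.E (Γ.vert n x) (Γ.vert n y)) :
    x.1.1.2 j = true ↔ y.1.1.2 j = true := by
  have key : ∀ {x y : CutPoint Q}, d j < Γ.floor n x → d j < Γ.floor n y →
      (Γ.grid n).tree.par (Γ.vert n y) = Γ.vert n x → (x.1.1.2 j = true ↔ y.1.1.2 j = true) := by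
    intro x y hx hy hp
    by_cases hy0 : Γ.vert n y = (Γ.grid n).tree.root
    · rw [hy0, par_root, ← hy0] at hp
      have h1 : j ∈ (Γ.grid n).br (Γ.vert n x) ↔ j ∈ (Γ.grid n).br (Γ.vert n y) := by rw [hp]
      rw [mem_br_vert, mem_br_vert] at h1
      tauto
    · have h1 : j ∈ (Γ.grid n).br (Γ.vert n x) ↔ _ := hp ▸ Grid.mem_br_par hy0
      rw [← Grid.lev_par hy0, hp, mem_br_vert, mem_br_vert, lev_vert] at h1
      tauto
  rw [E_iff] at hE
  rcases hE with h | h | h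
  · have h1 : j ∈ (Γ.grid n).br (Γ.vert n x) ↔ j ∈ (Γ.grid n).br (Γ.vert n y) := by rw [h]
    rw [mem_br_vert, mem_br_vert] at h1
    tauto
  · exact key hx hy h
  · exact (key hy hx h).symm

/-- Different heights are separated by two cuts in some grid. When the heights agree, a cut between
`d j` and that height makes the choice at `j` visible in a finite tree, where adjacency forces
agreement. -/
theorem E_limVert_iff (hd : IsMNSequence d) (x y : CutPoint Q) :
    (Γ.invSeq h).lim.E (Γ.limVert h x) (Γ.limVert h y) ↔
      mnLimPoint d x.1.1 = mnLimPoint d y.1.1 := by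
  rw [mnLimPoint_eq_iff]
  refine ⟨fun hE => ?_, fun hxy => Γ.E_vert hxy.1 hxy.2⟩
  have key : ∀ {x y : CutPoint Q}, (Γ.invSeq h).lim.E (Γ.limVert h x) (Γ.limVert h y) →
      y.1.1.1 ≤ x.1.1.1 := by
    intro x y hE
    by_contra! hlt
    obtain ⟨c, hc, h1, h2⟩ := h.dense x.1.1.1 y.1.1.1 x.1.1.1.2.1 hlt y.1.1.1.2.2
    obtain ⟨c', hc', h3, h4⟩ := h.dense c y.1.1.1 (h.pos c hc).le h2 y.1.1.1.2.2
    obtain ⟨n, hn⟩ := Γ.exists_mem c hc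
    obtain ⟨n', hn'⟩ := Γ.exists_mem c' hc'
    exact Γ.not_E_of_cut_between (Γ.C_mono (le_max_left n n') hn) (Γ.C_mono (le_max_right n n') hn')
      h1 h3 h4 (hE (max n n'))
  have hxy := (key ((Γ.invSeq h).lim.symm _ _ hE)).antisymm (key hE)
  refine ⟨hxy, fun j hj => Bool.eq_iff_iff.2 ?_⟩
  obtain ⟨c, hc, h1, h2⟩ := h.dense (d j) x.1.1.1 (hd.1 j).1 hj x.1.1.1.2.2
  obtain ⟨n, hn⟩ := Γ.exists_mem c hc
  have hn' := Γ.C_mono (le_max_left n (j + 1)) hn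
  exact Γ.branch_iff_of_E ((Nat.lt_succ_self j).trans_le (le_max_right n (j + 1)))
    (h1.trans_le (Γ.le_floor_of_lt hn' h2)) (h1.trans_le (Γ.le_floor_of_lt hn' (hxy ▸ h2)))
    (hE (max n (j + 1)))

theorem surjective_cutPoint (Q : Set ℝ) : Function.Surjective fun x : CutPoint Q => x.1.1 := by
  intro p
  exact ⟨⟨(p, fun c => decide (c ≤ p.1)), fun c _ => ⟨fun hc => of_decide_eq_true hc,
    fun hc => (not_le.1 (of_decide_eq_false hc)).le⟩⟩, rfl⟩

theorem isPrespace_and_nonempty_homeomorph (hd : IsMNSequence d) {K : RootedTopGraph}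
    (e : (Γ.invSeq h).lim.Iso K) : K.IsPrespace ∧ Nonempty (K.Realization ≃ₜ MNDendroid d) := by
  have := t2Space_mnDendroid d
  refine RootedTopGraph.isPrespace_and_nonempty_homeomorph
    (a := fun x : CutPoint Q => e.toHomeo (Γ.limVert h x)) (b := fun x => mnLimPoint d x.1.1)
    (e.toHomeo.continuous.comp (Γ.continuous_limVert h))
    ((continuous_mnLimPoint d).comp (continuous_fst.comp continuous_subtype_val))
    (e.toHomeo.surjective.comp (Γ.surjective_limVert h))
    ((surjective_mnLimPoint d).comp (surjective_cutPoint Q)) fun x y => ?_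
  rw [← e.edge_iff]
  exact Γ.E_limVert_iff h hd x y

end GridSeq

/-- The inverse of an isomorphism. -/
def RootedTopGraph.Iso.symm {K L : RootedTopGraph} (e : K.Iso L) : L.Iso K where
  toHomeo := e.toHomeo.symm
  edge_iff a b := by simp [e.edge_iff]
  map_root := by rw [← e.map_root, Homeomorph.symm_apply_apply]

/-- The sequence `d` is arbitrary here: its own grids give a model of the limit, which uniqueness
identifies with `K`. -/
theorem IsProjFraisseLimit.isPrespace_and_nonempty_homeomorph {K : RootedTopGraph}
    (hK : IsProjFraisseLimit TCE K) {d : ℕ → ℝ} (hd : IsMNSequence d) :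
    K.IsPrespace ∧ Nonempty (K.Realization ≃ₜ MNDendroid d) := by
  obtain ⟨Q, hQ, hQc⟩ := exists_isCutSet d
  obtain ⟨Γ⟩ := hQ.nonempty_gridSeq hd hQc
  obtain ⟨S, e, h1, h2, -⟩ := hK
  obtain ⟨S', e', h1', h2', -⟩ := Γ.isProjFraisseLimit hQ hd
  obtain ⟨i⟩ := (InvSeq.isFraisse_of_isProjFraisseLimit e h1 h2).nonempty_iso
    (InvSeq.isFraisse_of_isProjFraisseLimit e' h1' h2')
  exact Γ.isPrespace_and_nonempty_homeomorph hQ hd ((e'.trans i).trans e.symm)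

theorem theorem9p1 :
    (∃ K : RootedTopGraph, IsProjFraisseLimit TCE K) ∧
      ∀ K : RootedTopGraph, IsProjFraisseLimit TCE K →
        K.IsPrespace ∧
          ∀ d : ℕ → ℝ, IsMNSequence d → Nonempty (K.Realization ≃ₜ MNDendroid d) := by
  obtain ⟨d, hd⟩ := exists_isMNSequence
  obtain ⟨Q, hQ, hQc⟩ := exists_isCutSet d
  obtain ⟨Γ⟩ := hQ.nonempty_gridSeq hd hQc
  exact ⟨⟨_, Γ.isProjFraisseLimit hQ hd⟩, fun K hK =>
    ⟨(hK.isPrespace_and_nonempty_homeomorph hd).1,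
      fun d' hd' => (hK.isPrespace_and_nonempty_homeomorph hd').2⟩⟩
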